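/- **Setting.** Let $N\ge 1$, write $[n]=\{1,\dots,n\}$, and let $0\le a_i<\infty$ and $0<b_i<\infty$ for $i\in[N+1]$. Let $X(t)=(X_1(t),\dots,X_{N+1}(t))$, $t\ge 0$, be the continuous-time Markov chain, with right-continuous paths, on $\{x\in\mathbb Z^{N+1}:x_1<\dots<x_{N+1}\}$, started from a fixed configuration, in which for each $i$ particle $i$ attempts to jump one step to the left at rate $a_i$ and one step to the right at rate $b_i$, an attempted jump being suppressed if its target site is occupied. Put $\eta_i(t)=X_{i+1}(t)-X_i(t)-1\in\mathbb Z_+=\{0,1,2,\dots\}$ for $i\in[N]$. For $i\in[N]$ let $\mu_i=b_i+a_{i+1}$. Let $\lambda_1=a_1+b_2$ if $N=1$; if $N\ge2$ let $\lambda_1=a_1$, $\lambda_N=b_{N+1}$ and $\lambda_j=0$ for $2\le j\le N-1$. Let $P=(P_{i,j})_{i,j\in[N]}$ have entries $P_{i,i-1}=b_i/\mu_i$ for $2\le i\le N$, $P_{i,i+1}=a_{i+1}/\mu_i$ for $1\le i\le N-1$, and all other entries $0$. The general traffic equation for $\nu\in\mathbb R^N$ (a row vector) is $\nu=(\nu\wedge\mu)P+\lambda$,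 with $\wedge$ the componentwise minimum. A discrete interval is a non-empty set $I=\{\ell,\ell+1,\dots,q\}\subseteq[N+1]$ of consecutive integers. Put $$\alpha(I)=\prod_{u=\ell}^{q}\frac{a_u}{b_u},\qquad \beta(I)=\sum_{w=\ell}^{q}\frac{\prod_{u=w+1}^{q}a_u}{\prod_{u=w}^{q}b_u},\qquad \hat v(I)=\frac{1-\alpha(I)}{\beta(I)}.$$ If $|I|\ge2$, put $I^\circ=I\setminus\{\max I\}$, $\hat\rho_I(j)=\alpha(\{\ell,\dots,j\})+\beta(\{\ell,\dots,j\})\,\hat v(I)$ for $j\in I^\circ$, $\eta_I(t)=(\eta_j(t))_{j\in I^\circ}$, $R_I(t)=\max_{i\in I}X_i(t)-\min_{i\in I}X_i(t)$, and, for $A\subseteq\mathbb Z_+^{I^\circ}$, $$\varpi_I(A)=\sum_{z\in A}\ \prod_{j\in I^\circ}\hat\rho_I(j)^{z_j}\bigl(1-\hat\rho_I(j)\bigr).$$ An ordered partition of $[N+1]$ is a tuple $\Theta=(\theta_1,\dots,\theta_n)$ of pairwise disjoint discrete intervals with union $[N+1]$ such that $i<j$ whenever $i\in\theta_\ell$,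 $j\in\theta_r$ and $\ell<r$. Write $\Theta^\star$ for the collection of those parts that have at least two elements. **Theorem.** The general traffic equation has a unique solution $\nu\in\mathbb R^N$. Put $\rho_i=\nu_i/\mu_i$ for $i\in[N]$. There is a unique ordered partition $\Theta=(\theta_1,\dots,\theta_n)$ of $[N+1]$ (the cloud partition) such that $\rho_j=\hat\rho_\theta(j)\in(0,1)$ for every $\theta\in\Theta^\star$ and $j\in\theta^\circ$, and $\rho_{\max\theta}\ge1$ for every $\theta\in\Theta$ with $\max\theta\le N$. Moreover: (i) For any sets $A_\theta\subseteq\mathbb Z_+^{\theta^\circ}$, $\theta\in\Theta^\star$, $$\lim_{t\to\infty}\frac1t\int_0^t\mathbf 1\Bigl(\bigcap_{\theta\in\Theta^\star}\{\eta_\theta(s)\in A_\theta\}\Bigr)ds=\lim_{t\to\infty}\mathbb P\Bigl(\bigcap_{\theta\in\Theta^\star}\{\eta_\theta(t)\in A_\theta\}\Bigr)=\prod_{\theta\in\Theta^\star}\varpi_\theta(A_\theta),$$ the first limit holding almost surely and in $L^1$. Moreover, for every $\theta\in\Theta^\star$, $R_\theta(t)$ is integrable for every $t\ge0$ and $$\lim_{t\to\infty}\mathbb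 E R_\theta(t)=\sum_{j\in\theta^\circ}\frac1{1-\hat\rho_\theta(j)}.$$ (ii) If $1\le\ell<r\le n$, $i\in\theta_\ell$ and $j\in\theta_r$, then $\lim_{t\to\infty}\mathbb P\bigl[|X_j(t)-X_i(t)|\le B\bigr]=0$ for every $B\in[0,\infty)$. (iii) For $i\in[N+1]$ put $v_i=\hat v(\theta)$, where $\theta$ is the part of $\Theta$ containing $i$. Then $-\infty<v_1\le\dots\le v_{N+1}<\infty$; for every $i\in[N+1]$, $\lim_{t\to\infty}X_i(t)/t=v_i$ almost surely; and $v_{i+1}-v_i=(\rho_i-1)^+(b_i+a_{i+1})$ for all $i\in[N]$, where $x^+=\max(x,0)$. -/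

import Mathlib

open MeasureTheory Filter Topology
open scoped NNReal ENNReal

noncomputable section

namespace ExclusionClouds

/-!
Labels are shifted by one: the `N + 1` particles are labelled by `Fin (N + 1)` (particle `i + 1` of
the usual numbering is `i`) and the `N` gaps by `Fin N`; gap `j` lies between the particles
`j.castSucc` and `j.succ`.
-/

/-! ### Parameters, traffic equation -/

/-- Service rates `μ_j = b_j + a_{j+1}`. -/
def serviceRate {N : ℕ} (a b : Fin (N + 1) → ℝ) (j : Fin N) : ℝ :=
  b j.castSucc + a j.succ

/-- Arrival rates `λ`: the leftmost gap receives `a` of the first particle and the rightmost gap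
receives `b` of the last particle; all other entries vanish. If there is only one gap, it receives
both contributions. -/
def arrivalRate {N : ℕ} (a b : Fin (N + 1) → ℝ) (j : Fin N) : ℝ :=
  (if (j : ℕ) = 0 then a 0 else 0) + (if (j : ℕ) + 1 = N then b (Fin.last N) else 0)

/-- The routing matrix `P`. -/
def routing {N : ℕ} (a b : Fin (N + 1) → ℝ) : Matrix (Fin N) (Fin N) ℝ :=
  Matrix.of fun i j =>
    if (j : ℕ) + 1 = i then b i.castSucc / serviceRate a b i
    else if (i : ℕ) + 1 = j then a i.succ / serviceRate a b i
    else 0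

/-- The general traffic equation `ν = (ν ∧ μ) P + λ`, with row vectors. -/
def IsTrafficSolution {N : ℕ} (a b : Fin (N + 1) → ℝ) (ν : Fin N → ℝ) : Prop :=
  ν = Matrix.vecMul (ν ⊓ serviceRate a b) (routing a b) + arrivalRate a b

/-- The workload `ρ_j = ν_j / μ_j`. -/
def workload {N : ℕ} (a b : Fin (N + 1) → ℝ) (ν : Fin N → ℝ) (j : Fin N) : ℝ :=
  ν j / serviceRate a b j

/-! ### Quantities attached to a discrete interval of particles -/

/-- `α(I) = ∏_{u ∈ I} a_u / b_u`. -/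
def alpha {N : ℕ} (a b : Fin (N + 1) → ℝ) (I : Finset (Fin (N + 1))) : ℝ :=
  ∏ u ∈ I, a u / b u

/-- `β(I)`: for `I = {ℓ, …, q}` this is
`1 / b_q + a_q / (b_q b_{q-1}) + ⋯ + (a_q ⋯ a_{ℓ+1}) / (b_q ⋯ b_ℓ)`. -/
def beta {N : ℕ} (a b : Fin (N + 1) → ℝ) (I : Finset (Fin (N + 1))) : ℝ :=
  ∑ w ∈ I, (∏ u ∈ I with w < u, a u) / (∏ u ∈ I with w ≤ u, b u)

/-- The intrinsic speed `(1 - α(I)) / β(I)` of `I`. -/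
def intrinsicSpeed {N : ℕ} (a b : Fin (N + 1) → ℝ) (I : Finset (Fin (N + 1))) : ℝ :=
  (1 - alpha a b I) / beta a b I

/-- `ρ̂_I(j) = α({u ∈ I : u ≤ j}) + β({u ∈ I : u ≤ j}) * v̂(I)`. -/
def intrinsicLoad {N : ℕ} (a b : Fin (N + 1) → ℝ) (I : Finset (Fin (N + 1))) (j : Fin N) : ℝ :=
  alpha a b {u ∈ I | u ≤ j.castSucc} +
    beta a b {u ∈ I | u ≤ j.castSucc} * intrinsicSpeed a b I

/-- The gaps inside a set `I` of particles: those with both neighbouring particles in `I`. For a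
discrete interval these are the labels in `I` other than the maximal one. -/
def inner {N : ℕ} (I : Finset (Fin (N + 1))) : Finset (Fin N) :=
  {j | j.castSucc ∈ I ∧ j.succ ∈ I}

/-- The product-geometric weight `ϖ_I(z) = ∏_j ρ̂_I(j)^{z_j} (1 - ρ̂_I(j))`. -/
def cloudWeight {N : ℕ} (a b : Fin (N + 1) → ℝ) (I : Finset (Fin (N + 1)))
    (z : inner I → ℕ) : ℝ :=
  ∏ j : inner I, intrinsicLoad a b I j ^ z j * (1 - intrinsicLoad a b I j)

/-- `ϖ_I(A) = ∑_{z ∈ A} ϖ_I(z)`. -/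
def cloudLaw {N : ℕ} (a b : Fin (N + 1) → ℝ) (I : Finset (Fin (N + 1)))
    (A : Set (inner I → ℕ)) : ℝ :=
  ∑' z : A, cloudWeight a b I z

/-! ### Ordered partitions into discrete intervals -/

/-- An ordered partition of the set of particle labels into discrete intervals. -/
structure OrderedPartition (N : ℕ) where
  size : ℕ
  part : Fin size → Finset (Fin (N + 1))
  interval : ∀ k, ∃ p q, p ≤ q ∧ part k = Finset.Icc p q
  disjoint : ∀ k l, k ≠ l → Disjoint (part k) (part l)
  cover : ∀ i, ∃ k, i ∈ part k
  ordered : ∀ k l, k < l → ∀ i ∈ part k, ∀ j ∈ part l, i < j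

namespace OrderedPartition

variable {N : ℕ} (Θ : OrderedPartition N)

theorem nonempty (k : Fin Θ.size) : (Θ.part k).Nonempty := by
  obtain ⟨p, q, hpq, h⟩ := Θ.interval k
  rw [h]
  exact Finset.nonempty_Icc.2 hpq

/-- The indices of the parts with at least two elements. -/
def nonSingletons : Finset (Fin Θ.size) :=
  {k | 2 ≤ (Θ.part k).card}

/-- The index of the part that contains the particle `i`. -/
def index (i : Fin (N + 1)) : Fin Θ.size :=
  (Θ.cover i).choose

theorem mem_part_index (i : Fin (N + 1)) : i ∈ Θ.part (Θ.index i) :=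
  (Θ.cover i).choose_spec

theorem index_eq {i : Fin (N + 1)} {k : Fin Θ.size} (h : i ∈ Θ.part k) : Θ.index i = k := by
  by_contra hne
  exact Finset.disjoint_left.1 (Θ.disjoint _ _ hne) (Θ.mem_part_index i) h

/-- The speed `v_i = v̂(θ)`, where `θ` is the part containing `i`. -/
def speed (a b : Fin (N + 1) → ℝ) (i : Fin (N + 1)) : ℝ :=
  intrinsicSpeed a b (Θ.part (Θ.index i))

end OrderedPartition

/-- `Θ` is a cloud partition for the workloads determined by `ν`. -/
structure IsCloudPartition {N : ℕ} (a b : Fin (N + 1) → ℝ) (ν : Fin N → ℝ)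
    (Θ : OrderedPartition N) : Prop where
  inside : ∀ k ∈ Θ.nonSingletons, ∀ j ∈ inner (Θ.part k),
    workload a b ν j = intrinsicLoad a b (Θ.part k) j ∧ workload a b ν j ∈ Set.Ioo (0 : ℝ) 1
  boundary : ∀ k, ∀ j : Fin N,
    IsGreatest (Θ.part k : Set (Fin (N + 1))) j.castSucc → 1 ≤ workload a b ν j

/-! ### The particle system -/

/-- Configurations `x_1 < x_2 < ⋯ < x_{N+1}` of particles on `ℤ`. -/
abbrev Config (N : ℕ) : Type := {x : Fin (N + 1) → ℤ // StrictMono x}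

namespace Config

variable {N : ℕ}

/-- The site `s` carries no particle. -/
def IsVacant (x : Config N) (s : ℤ) : Prop := ∀ j, x.1 j ≠ s

theorem strictMono_right (x : Config N) (i : Fin (N + 1)) (h : x.IsVacant (x.1 i + 1)) :
    StrictMono (Function.update x.1 i (x.1 i + 1)) := by
  intro j k hjk
  have hx := x.2 hjk
  have hk := h k
  by_cases hj : j = i <;> by_cases hk' : k = i
  · omega
  · subst hj
    rw [Function.update_self, Function.update_of_ne hk']
    omega
  · subst hk'
    rw [Function.update_self, Function.update_of_ne hj]
    omega
  · rw [Function.update_of_ne hj, Function.update_of_ne hk']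
    exact hx

theorem strictMono_left (x : Config N) (i : Fin (N + 1)) (h : x.IsVacant (x.1 i - 1)) :
    StrictMono (Function.update x.1 i (x.1 i - 1)) := by
  intro j k hjk
  have hx := x.2 hjk
  have hj' := h j
  by_cases hj : j = i <;> by_cases hk' : k = i
  · omega
  · subst hj
    rw [Function.update_self, Function.update_of_ne hk']
    omega
  · subst hk'
    rw [Function.update_self, Function.update_of_ne hj]
    omega
  · rw [Function.update_of_ne hj, Function.update_of_ne hk']
    exact hx

open scoped Classical in
/-- The result of an attempted jump of particle `i` to the right: the jump is suppressed if the
target site is occupied. -/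
def jumpRight (x : Config N) (i : Fin (N + 1)) : Config N :=
  if h : x.IsVacant (x.1 i + 1) then
    ⟨Function.update x.1 i (x.1 i + 1), x.strictMono_right i h⟩
  else x

open scoped Classical in
/-- The result of an attempted jump of particle `i` to the left. -/
def jumpLeft (x : Config N) (i : Fin (N + 1)) : Config N :=
  if h : x.IsVacant (x.1 i - 1) then
    ⟨Function.update x.1 i (x.1 i - 1), x.strictMono_left i h⟩
  else x

/-- The number `η_j` of empty sites between the particles `j` and `j + 1`. -/
def gap (x : Config N) (j : Fin N) : ℕ := (x.1 j.succ - x.1 j.castSucc - 1).toNat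

theorem gap_cast (x : Config N) (j : Fin N) :
    (x.gap j : ℤ) = x.1 j.succ - x.1 j.castSucc - 1 := by
  have := x.2 (Fin.castSucc_lt_succ (i := j))
  unfold gap
  omega

/-- The gaps inside the set `I` of particles. -/
def gapsIn (x : Config N) (I : Finset (Fin (N + 1))) : inner I → ℕ := fun j => x.gap j

/-- The distance between the extreme particles indexed by `I`. -/
def diameter (x : Config N) (I : Finset (Fin (N + 1))) (hI : I.Nonempty) : ℤ :=
  I.sup' hI x.1 - I.inf' hI x.1

end Config

/-- The generator of the exclusion dynamics: particle `i` attempts to jump to the right at rate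
`b i` and to the left at rate `a i`. -/
def generator {N : ℕ} (a b : Fin (N + 1) → ℝ) (f : Config N → ℝ) (x : Config N) : ℝ :=
  ∑ i, (b i * (f (x.jumpRight i) - f x) + a i * (f (x.jumpLeft i) - f x))

/-- `X` is a continuous-time Markov chain with right-continuous paths, started from `x₀`, with the
jump rates of the exclusion dynamics. As the total jump rate is bounded, the law of such a chain is
characterised by the martingale problem for the generator acting on bounded functions. -/
structure IsExclusionProcess {N : ℕ} (a b : Fin (N + 1) → ℝ) (x₀ : Config N)
    {Ω : Type*} [MeasurableSpace Ω] (P : Measure Ω) (X : ℝ≥0 → Ω → Config N) : Prop where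
  measurable : ∀ t, Measurable (X t)
  rightContinuous : ∀ ω t, ∀ᶠ s in 𝓝[≥] t, X s ω = X t ω
  initial : ∀ᵐ ω ∂P, X 0 ω = x₀
  martingale : ∀ f : Config N → ℝ, (∃ C, ∀ x, |f x| ≤ C) →
    Martingale
      (fun (t : ℝ≥0) ω => f (X t ω) - ∫ s in (0 : ℝ)..t, generator a b f (X s.toNNReal ω))
      (Filtration.natural X fun t => (measurable t).stronglyMeasurable) P

/-- The configurations in which `η_θ ∈ A_θ` for every non-singleton part `θ` of `Θ`. -/
def cloudEvent {N : ℕ} (Θ : OrderedPartition N) (A : ∀ k, Set (inner (Θ.part k) → ℕ)) :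
    Set (Config N) :=
  {x | ∀ k ∈ Θ.nonSingletons, x.gapsIn (Θ.part k) ∈ A k}

/-- The fraction of the time interval `[0, t]` that the path `X · ω` spends in `E`. -/
def occupation {N : ℕ} {Ω : Type*} (X : ℝ≥0 → Ω → Config N) (E : Set (Config N)) (t : ℝ≥0)
    (ω : Ω) : ℝ :=
  1 / (t : ℝ) * ∫ s in (0 : ℝ)..t, E.indicator (fun _ => (1 : ℝ)) (X s.toNNReal ω)

end ExclusionClouds

end

/-!
# Clouds in the exclusion process with particle-dependent jump rates

The gaps between neighbouring particles form a queueing network: a right jump of particle `i` moves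
a hole from the gap on its right to the gap on its left, and a left jump moves it back. Outside the
system there is an inexhaustible supply of holes. The attempted moves are increasing maps of the
vector of gaps, so the kernel `K` of the uniformised gap chain preserves increasing functions, and
most of the argument is a comparison of networks on such functions.

*Traffic.* In terms of the busy fractions `ρ_j ∧ 1`, the traffic equation says that the resulting
drift of particle `i + 1` exceeds that of particle `i` by `(ν_i - μ_i)⁺` (`drift_busy_succ_sub`).
Hence drifts are constant along the maximal runs of gaps with `ρ_j < 1`, these runs form the
only possible cloud partition (`existsUnique_cloudPartition`), and solving the linear recursion
along a run identifies drift and loads with `v̂` and `ρ̂`.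

*Stable networks.* If every node has load below `1`, the product-geometric law is stationary
(`Network.Balanced.isStationary`) and the chain converges to it on increasing functions
(`Network.tendsto_iterate_kernel`): chains from a state and from the empty state stay ordered and
merge when the larger one empties, which it does almost surely, since, in the
presence of a stationary law, a bounded harmonic function that vanishes at the empty state is zero.

*Unstable networks.* The gap network is squeezed between two stable ones. From below, thin the
arrivals from outside by a factor `t < 1` and serve customers additionally at the excess rates; this
network is stable with loads `t (ρ_j ∧ 1)`. From above, declare the unstable gaps to be never empty,
that is, merge them with the outside; the remaining gaps form a stable network with loads `ρ_j`. So
`K ^ n` converges on functions of the stable gaps (`tendsto_iterate_gapKernel`), while unstable gaps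
diverge. Convergence on increasing sets suffices: they determine the mass of every point, and
no mass is lost. As the process is the uniformised chain at Poisson times, its
one-dimensional laws and the means of the gaps converge as well.

*Almost sure statements.* Dynkin martingales of functions with unit jumps satisfy a strong law
(`IsExclusionProcess.ae_tendsto_dynkin_div`). Therefore time averages are asymptotically invariant
under `K`, and those of increasing functions are bounded below by `K ^ n` started from the
origin. In particular gap `j` is nonempty for at least a fraction `ρ_j ∧ 1` of the time. The matching
upper bounds come from the particle positions: the strong law expresses their speeds through the
busy fractions, and the particles cannot overtake each other (`tendsto_drift`). This gives the
speeds and the busy fractions, the busy fractions give tightness of the stable gaps, and tightness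
permits the comparison with the collapsed network (`tendsto_timeAvg_of_isUpperSet`).
-/

open MeasureTheory Filter Topology
open scoped NNReal ENNReal

noncomputable section

namespace ExclusionClouds

set_option linter.unusedSectionVars false

/-! ### Transfer networks and their uniformised kernels -/

section Network

variable {ι M : Type*} [DecidableEq ι] [Fintype M]

/-- Add one customer at `s`; the value `none` stands for the outside of the network. -/
def inc (s : Option ι) (x : ι → ℕ) : ι → ℕ := fun i => if s = some i then x i + 1 else x i

/-- Remove one customer at `s`, if there is one. -/
def dec (s : Option ι) (x : ι → ℕ) : ι → ℕ := fun i => if s = some i then x i - 1 else x i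

theorem inc_apply (s : Option ι) (x : ι → ℕ) (i : ι) :
    inc s x i = if s = some i then x i + 1 else x i := rfl

theorem dec_apply (s : Option ι) (x : ι → ℕ) (i : ι) :
    dec s x i = if s = some i then x i - 1 else x i := rfl

/-- A customer is available at `s`; the outside never runs out of customers. -/
def Avail (s : Option ι) (x : ι → ℕ) : Prop := ∀ i, s = some i → x i ≠ 0

open scoped Classical in
/-- Transfer a customer from `s` to `d`; nothing happens if none is available. -/
def transfer (s d : Option ι) (x : ι → ℕ) : ι → ℕ := if Avail s x then inc d (dec s x) else x

theorem transfer_of_avail {s : Option ι} {x : ι → ℕ} (h : Avail s x) (d : Option ι) :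
    transfer s d x = inc d (dec s x) := if_pos h

theorem transfer_of_not_avail {s : Option ι} {x : ι → ℕ} (h : ¬ Avail s x) (d : Option ι) :
    transfer s d x = x := if_neg h

theorem avail_none (x : ι → ℕ) : Avail none x := by simp [Avail]

theorem avail_some {i : ι} {x : ι → ℕ} : Avail (some i) x ↔ x i ≠ 0 := by
  simp [Avail]

theorem inc_mono (s : Option ι) : Monotone (inc s) := by
  intro x y h i
  have h2 : x i ≤ y i := h i
  simp only [inc_apply]
  split_ifs <;> omega

theorem le_inc (s : Option ι) (x : ι → ℕ) : x ≤ inc s x := by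
  intro i
  simp only [inc_apply]
  split_ifs <;> omega

theorem dec_le (s : Option ι) (x : ι → ℕ) : dec s x ≤ x := by
  intro i
  simp only [dec_apply]
  split_ifs <;> omega

@[simp] theorem inc_none (x : ι → ℕ) : inc none x = x := by
  ext i; simp [inc]

@[simp] theorem dec_none (x : ι → ℕ) : dec none x = x := by
  ext i; simp [dec]

theorem inc_dec {s : Option ι} {x : ι → ℕ} (h : Avail s x) : inc s (dec s x) = x := by
  ext i
  have := h i
  simp only [inc_apply, dec_apply]
  split_ifs with hs
  · have := this hs
    omega
  · rfl

theorem dec_inc (s : Option ι) (x : ι → ℕ) : dec s (inc s x) = x := by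
  ext i
  simp only [inc_apply, dec_apply]
  split_ifs <;> simp

theorem avail_inc (s : Option ι) (x : ι → ℕ) : Avail s (inc s x) := by
  intro i hs
  simp [inc, hs]

theorem transfer_mono (s d : Option ι) : Monotone (transfer s d) := by
  intro x y h
  by_cases hx : Avail s x
  · have hy : Avail s y := fun i hi => by
      have h1 := hx i hi
      have h2 : x i ≤ y i := h i
      omega
    rw [transfer_of_avail hx, transfer_of_avail hy]
    apply inc_mono
    intro i
    have h2 : x i ≤ y i := h i
    simp only [dec_apply]
    split_ifs <;> omega
  · rw [transfer_of_not_avail hx]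
    by_cases hy : Avail s y
    · rw [transfer_of_avail hy]
      refine le_trans ?_ (le_inc _ _)
      intro i
      have h2 : x i ≤ y i := h i
      simp only [dec_apply]
      split_ifs with hs
      · rw [hs, avail_some] at hx
        omega
      · exact h2
    · rw [transfer_of_not_avail hy]
      exact h

theorem transfer_le_inc (s d : Option ι) (x : ι → ℕ) : transfer s d x ≤ inc d x := by
  by_cases hx : Avail s x
  · rw [transfer_of_avail hx]
    exact inc_mono _ (dec_le _ _)
  · rw [transfer_of_not_avail hx]
    exact le_inc _ _

theorem le_transfer_none (d : Option ι) (x : ι → ℕ) : x ≤ transfer none d x := by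
  rw [transfer_of_avail (avail_none x), dec_none]
  exact le_inc _ _

theorem transfer_to_none_le (s : Option ι) (x : ι → ℕ) : transfer s none x ≤ x := by
  simpa using transfer_le_inc s none x

theorem dec_le_transfer (s d : Option ι) (x : ι → ℕ) : dec s x ≤ transfer s d x := by
  by_cases hx : Avail s x
  · rw [transfer_of_avail hx]
    exact le_inc _ _
  · rw [transfer_of_not_avail hx]
    exact dec_le _ _

variable (ι M) in
/-- A queueing network given by a finite family of transfers, each attempted at its own rate. -/
structure Network where
  src : M → Option ι
  dst : M → Option ι
  rate : M → ℝ
  rate_nonneg : ∀ m, 0 ≤ rate m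

namespace Network

variable (Q : Network ι M)

/-- The generator of the network. -/
def gen (f : (ι → ℕ) → ℝ) (x : ι → ℕ) : ℝ :=
  ∑ m, Q.rate m * (f (transfer (Q.src m) (Q.dst m) x) - f x)

/-- The transition kernel of the chain uniformised at rate `Λ`, acting on functions. -/
def kernel (Λ : ℝ) (f : (ι → ℕ) → ℝ) (x : ι → ℕ) : ℝ := f x + Λ⁻¹ * Q.gen f x

/-- `Λ` is an admissible uniformisation rate. -/
def Admissible (Λ : ℝ) : Prop := 0 < Λ ∧ ∑ m, Q.rate m ≤ Λ

variable {Q} {Λ : ℝ}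

theorem kernel_eq (f : (ι → ℕ) → ℝ) (x : ι → ℕ) :
    Q.kernel Λ f x = ∑ m, Λ⁻¹ * Q.rate m * f (transfer (Q.src m) (Q.dst m) x) +
      (1 - Λ⁻¹ * ∑ m, Q.rate m) * f x := by
  unfold kernel gen
  simp only [mul_sub, Finset.sum_sub_distrib, Finset.mul_sum, sub_mul, one_mul, Finset.sum_mul,
    mul_assoc]
  ring

theorem Admissible.weight_nonneg (h : Q.Admissible Λ) (m : M) : 0 ≤ Λ⁻¹ * Q.rate m :=
  mul_nonneg (inv_nonneg.2 h.1.le) (Q.rate_nonneg m)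

theorem Admissible.stay_nonneg (h : Q.Admissible Λ) : 0 ≤ 1 - Λ⁻¹ * ∑ m, Q.rate m := by
  have := h.1
  rw [sub_nonneg, inv_mul_le_iff₀ this, mul_one]
  exact h.2

theorem kernel_le_kernel (h : Q.Admissible Λ) {f g : (ι → ℕ) → ℝ} (x : ι → ℕ)
    (hm : ∀ m, f (transfer (Q.src m) (Q.dst m) x) ≤ g (transfer (Q.src m) (Q.dst m) x))
    (hx : f x ≤ g x) : Q.kernel Λ f x ≤ Q.kernel Λ g x := by
  rw [kernel_eq, kernel_eq]
  gcongr with m _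
  · exact h.weight_nonneg m
  · exact hm m
  · exact h.stay_nonneg

theorem kernel_mono (h : Q.Admissible Λ) {f g : (ι → ℕ) → ℝ} (hfg : f ≤ g) :
    Q.kernel Λ f ≤ Q.kernel Λ g := fun x =>
  kernel_le_kernel h x (fun _ => hfg _) (hfg _)

theorem kernel_monotone (h : Q.Admissible Λ) {f : (ι → ℕ) → ℝ} (hf : Monotone f) :
    Monotone (Q.kernel Λ f) := by
  intro x y hxy
  rw [kernel_eq, kernel_eq]
  gcongr with m _
  · exact h.weight_nonneg m
  · exact hf (transfer_mono _ _ hxy)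
  · exact h.stay_nonneg
  · exact hf hxy

@[simp] theorem kernel_const (c : ℝ) : Q.kernel Λ (fun _ => c) = fun _ => c := by
  ext x
  simp [kernel, gen]

theorem iterate_kernel_const (c : ℝ) (n : ℕ) : (Q.kernel Λ)^[n] (fun _ => c) = fun _ => c :=
  Function.iterate_fixed (kernel_const c) n

theorem kernel_add (f g : (ι → ℕ) → ℝ) :
    Q.kernel Λ (f + g) = Q.kernel Λ f + Q.kernel Λ g := by
  ext x
  simp only [kernel_eq, Pi.add_apply, mul_add, Finset.sum_add_distrib]
  ring

theorem kernel_smul (c : ℝ) (f : (ι → ℕ) → ℝ) :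
    Q.kernel Λ (c • f) = c • Q.kernel Λ f := by
  ext x
  simp only [kernel_eq, Pi.smul_apply, smul_eq_mul, mul_add, Finset.mul_sum]
  congr 1
  · exact Finset.sum_congr rfl fun m _ => by ring
  · ring

theorem iterate_kernel_add (f g : (ι → ℕ) → ℝ) (n : ℕ) :
    (Q.kernel Λ)^[n] (f + g) = (Q.kernel Λ)^[n] f + (Q.kernel Λ)^[n] g := by
  induction n generalizing f g with
  | zero => rfl
  | succ n ih => rw [Function.iterate_succ_apply, kernel_add, ih]; rfl

theorem iterate_kernel_mono (h : Q.Admissible Λ) {f g : (ι → ℕ) → ℝ} (hfg : f ≤ g) (n : ℕ) :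
    (Q.kernel Λ)^[n] f ≤ (Q.kernel Λ)^[n] g := by
  have : Monotone (Q.kernel Λ) := fun _ _ => kernel_mono h
  exact this.iterate n hfg

theorem iterate_kernel_monotone (h : Q.Admissible Λ) {f : (ι → ℕ) → ℝ} (hf : Monotone f)
    (n : ℕ) : Monotone ((Q.kernel Λ)^[n] f) := by
  induction n with
  | zero => exact hf
  | succ n ih =>
    rw [Function.iterate_succ_apply']
    exact kernel_monotone h ih

theorem abs_iterate_kernel_le (h : Q.Admissible Λ) {f : (ι → ℕ) → ℝ} {C : ℝ}
    (hf : ∀ x, |f x| ≤ C) (n : ℕ) (x : ι → ℕ) : |(Q.kernel Λ)^[n] f x| ≤ C := by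
  rw [abs_le]
  constructor
  · have := iterate_kernel_mono h (f := fun _ => -C) (g := f)
      (fun x => (abs_le.1 (hf x)).1) n x
    rwa [iterate_kernel_const] at this
  · have := iterate_kernel_mono h (g := fun _ => C) (f := f)
      (fun x => (abs_le.1 (hf x)).2) n x
    rwa [iterate_kernel_const] at this

/-- Comparison of two networks along a projection: if one step of `Q` is dominated by one step of
`Q'` on increasing functions, then so are `n` steps. -/
theorem iterate_kernel_comp_le {ι' M' : Type*} [DecidableEq ι'] [Fintype M']
    {Q' : Network ι' M'} (h : Q.Admissible Λ) (h' : Q'.Admissible Λ) {p : (ι → ℕ) → (ι' → ℕ)}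
    (hstep : ∀ f : (ι' → ℕ) → ℝ, Monotone f → ∀ x, Q.gen (f ∘ p) x ≤ Q'.gen f (p x))
    {f : (ι' → ℕ) → ℝ} (hf : Monotone f) (n : ℕ) (x : ι → ℕ) :
    (Q.kernel Λ)^[n] (f ∘ p) x ≤ (Q'.kernel Λ)^[n] f (p x) := by
  induction n generalizing f x with
  | zero => exact le_rfl
  | succ n ih =>
    rw [Function.iterate_succ_apply, Function.iterate_succ_apply]
    refine le_trans ?_ (ih (kernel_monotone h' hf) x)
    refine iterate_kernel_mono h (fun y => ?_) n x
    have := inv_nonneg.2 h.1.le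
    unfold kernel
    simp only [Function.comp]
    gcongr
    exact hstep f hf y

/-- Comparison of two networks on the same nodes. -/
theorem iterate_kernel_ge {M' : Type*} [Fintype M']
    {Q' : Network ι M'} (h : Q.Admissible Λ) (h' : Q'.Admissible Λ)
    (hstep : ∀ f : (ι → ℕ) → ℝ, Monotone f → ∀ x, Q'.gen f x ≤ Q.gen f x)
    {f : (ι → ℕ) → ℝ} (hf : Monotone f) (n : ℕ) (x : ι → ℕ) :
    (Q'.kernel Λ)^[n] f x ≤ (Q.kernel Λ)^[n] f x :=
  iterate_kernel_comp_le (p := id) h' h hstep hf n x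

end Network

end Network

/-! ### Convergence of monotone functionals of a stable network -/

section Convergence

variable {ι M : Type*} [DecidableEq ι] [Fintype ι] [Fintype M]

theorem sum_mul_inc (c : ι → ℕ) (s : Option ι) (x : ι → ℕ) :
    ∑ i, c i * inc s x i = ∑ i, c i * x i + s.elim 0 c := by
  cases s with
  | none => simp
  | some j =>
    have : ∀ i, c i * inc (some j) x i = c i * x i + if j = i then c i else 0 := by
      intro i
      simp only [inc_apply, Option.some.injEq]
      split_ifs <;> ring
    simp [this, Finset.sum_add_distrib]

/-- Functions of at most linear growth. -/
def LinearGrowth (f : (ι → ℕ) → ℝ) : Prop := ∃ C : ℝ, ∀ x, |f x| ≤ C * (1 + ∑ i, (x i : ℝ))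

theorem LinearGrowth.of_bounded {f : (ι → ℕ) → ℝ} {C : ℝ} (h : ∀ x, |f x| ≤ C) :
    LinearGrowth f := by
  refine ⟨C, fun x => (h x).trans ?_⟩
  have h0 : 0 ≤ C := (abs_nonneg _).trans (h x)
  have h1 : (0 : ℝ) ≤ ∑ i, (x i : ℝ) := Finset.sum_nonneg fun i _ => Nat.cast_nonneg _
  nlinarith

theorem LinearGrowth.coord (j : ι) : LinearGrowth fun x : ι → ℕ => (x j : ℝ) := by
  refine ⟨1, fun x => ?_⟩
  have h1 : (x j : ℝ) ≤ ∑ i, (x i : ℝ) :=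
    Finset.single_le_sum (f := fun i => (x i : ℝ)) (fun i _ => Nat.cast_nonneg _)
      (Finset.mem_univ j)
  rw [abs_of_nonneg (Nat.cast_nonneg _)]
  linarith

theorem LinearGrowth.add {f g : (ι → ℕ) → ℝ} (hf : LinearGrowth f) (hg : LinearGrowth g) :
    LinearGrowth fun x => f x + g x := by
  obtain ⟨C, hC⟩ := hf
  obtain ⟨D, hD⟩ := hg
  refine ⟨C + D, fun x => (abs_add_le _ _).trans ?_⟩
  linarith [hC x, hD x]

theorem LinearGrowth.const_mul {f : (ι → ℕ) → ℝ} (hf : LinearGrowth f) (c : ℝ) :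
    LinearGrowth fun x => c * f x := by
  obtain ⟨C, hC⟩ := hf
  refine ⟨|c| * C, fun x => ?_⟩
  rw [abs_mul, mul_assoc]
  exact mul_le_mul_of_nonneg_left (hC x) (abs_nonneg _)

theorem LinearGrowth.neg {f : (ι → ℕ) → ℝ} (hf : LinearGrowth f) :
    LinearGrowth fun x => - f x := by
  simpa using hf.const_mul (-1)

theorem LinearGrowth.sum {κ : Type*} {s : Finset κ} {f : κ → (ι → ℕ) → ℝ}
    (hf : ∀ k ∈ s, LinearGrowth (f k)) : LinearGrowth fun x => ∑ k ∈ s, f k x := by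
  classical
  induction s using Finset.induction_on with
  | empty => exact ⟨0, fun x => by simp⟩
  | insert k s hk ih =>
    simp only [Finset.sum_insert hk]
    exact (hf k (Finset.mem_insert_self _ _)).add
      (ih fun k' hk' => hf k' (Finset.mem_insert_of_mem hk'))

theorem LinearGrowth.comp_le {f : (ι → ℕ) → ℝ} (hf : LinearGrowth f)
    {T : (ι → ℕ) → (ι → ℕ)} {s : Option ι} (hT : ∀ x, T x ≤ inc s x) :
    LinearGrowth fun x => f (T x) := by
  obtain ⟨C, hC⟩ := hf
  refine ⟨|C| * 2, fun x => (hC _).trans ?_⟩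
  have h1 : ∑ i, (T x i : ℝ) ≤ ∑ i, (x i : ℝ) + 1 := by
    have h2 : ∑ i, T x i ≤ ∑ i, inc s x i := Finset.sum_le_sum fun i _ => hT x i
    have h3 := sum_mul_inc (fun _ => 1) s x
    simp only [one_mul] at h3
    have h4 : s.elim 0 (fun _ => 1) ≤ 1 := by cases s <;> simp
    have : ∑ i, T x i ≤ ∑ i, x i + 1 := by omega
    exact_mod_cast this
  have h5 : (0 : ℝ) ≤ ∑ i, (x i : ℝ) := Finset.sum_nonneg fun i _ => Nat.cast_nonneg _
  have h6 : (0 : ℝ) ≤ ∑ i, (T x i : ℝ) := Finset.sum_nonneg fun i _ => Nat.cast_nonneg _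
  have h7 : C * (1 + ∑ i, (T x i : ℝ)) ≤ |C| * (1 + ∑ i, (T x i : ℝ)) :=
    mul_le_mul_of_nonneg_right (le_abs_self C) (by linarith)
  have h8 := abs_nonneg C
  nlinarith

/-- On a countable state space charged everywhere by `π`, a nonnegative function with vanishing
integral vanishes everywhere. -/
theorem eq_zero_of_integral_eq_zero {π : Measure (ι → ℕ)} (hpos : ∀ x, π {x} ≠ 0)
    {f : (ι → ℕ) → ℝ} (hf : ∀ x, 0 ≤ f x) (hi : Integrable f π) (h0 : ∫ x, f x ∂π = 0)
    (x : ι → ℕ) : f x = 0 := by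
  have h := (integral_eq_zero_iff_of_nonneg hf hi).1 h0
  by_contra hx
  have h2 : π {x} ≤ 0 := by
    rw [← ae_iff.1 h]
    exact measure_mono (by simpa using hx)
  exact hpos x (le_antisymm h2 bot_le)

namespace Network

variable (Q : Network ι M)

/-- From each node, customers can be sent on along a route that leaves the network. -/
def Drains : Prop :=
  ∃ rank : ι → ℕ, ∀ i, ∃ m, 0 < Q.rate m ∧ Q.src m = some i ∧
    ∀ j, Q.dst m = some j → rank j < rank i

/-- `π` is a stationary law of the network which charges every state and has first moments. -/
structure IsStationary (Λ : ℝ) (π : Measure (ι → ℕ)) : Prop where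
  pos : ∀ x, π {x} ≠ 0
  integrable : ∀ f, LinearGrowth f → Integrable f π
  invariant : ∀ f, LinearGrowth f → ∫ x, Q.kernel Λ f x ∂π = ∫ x, f x ∂π

variable {Q} {Λ : ℝ}

theorem linearGrowth_kernel {f : (ι → ℕ) → ℝ} (hf : LinearGrowth f) :
    LinearGrowth (Q.kernel Λ f) := by
  unfold kernel gen
  refine hf.add (LinearGrowth.const_mul (LinearGrowth.sum fun m _ => ?_) _)
  refine LinearGrowth.const_mul ?_ _
  simp only [sub_eq_add_neg]
  exact (hf.comp_le (transfer_le_inc (Q.src m) (Q.dst m))).add hf.neg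

theorem linearGrowth_iterate {f : (ι → ℕ) → ℝ} (hf : LinearGrowth f) (n : ℕ) :
    LinearGrowth ((Q.kernel Λ)^[n] f) := by
  induction n with
  | zero => exact hf
  | succ n ih =>
    rw [Function.iterate_succ_apply']
    exact linearGrowth_kernel ih

theorem IsStationary.integral_iterate {π : Measure (ι → ℕ)} (hπ : Q.IsStationary Λ π)
    {f : (ι → ℕ) → ℝ} (hf : LinearGrowth f) (n : ℕ) :
    ∫ x, (Q.kernel Λ)^[n] f x ∂π = ∫ x, f x ∂π := by
  induction n with
  | zero => rfl
  | succ n ih =>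
    rw [Function.iterate_succ_apply', hπ.invariant _ (linearGrowth_iterate hf n), ih]

/-- A function that is unchanged by every transfer of positive rate is constant. -/
theorem eq_apply_zero_of_drains (hd : Q.Drains) {q : (ι → ℕ) → ℝ}
    (hq : ∀ m, 0 < Q.rate m → ∀ x, q (transfer (Q.src m) (Q.dst m) x) = q x) (x : ι → ℕ) :
    q x = q 0 := by
  obtain ⟨rank, hrank⟩ := hd
  -- induction on the total number of routing steps that are left to the customers in `x`
  induction hn : ∑ i, (rank i + 1) * x i using Nat.strong_induction_on generalizing x with
  | _ n ih =>
    by_cases hx : x = 0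
    · rw [hx]
    obtain ⟨i, hi⟩ := Function.ne_iff.1 hx
    obtain ⟨m, hm, hs, hdst⟩ := hrank i
    have hav : Avail (Q.src m) x := by
      rw [hs, avail_some]
      exact hi
    rw [← hq m hm x]
    refine ih _ ?_ _ rfl
    rw [transfer_of_avail hav, sum_mul_inc, ← hn]
    conv_rhs => rw [← inc_dec hav]
    rw [sum_mul_inc, hs]
    cases hdm : Q.dst m with
    | none => simp
    | some j =>
      have := hdst j hdm
      simp only [Option.elim_some]
      omega

/-- The probability that the uniformised chain has not visited the empty state by time `n`. -/
def survival (Q : Network ι M) (Λ : ℝ) : ℕ → (ι → ℕ) → ℝ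
  | 0 => fun x => if x = 0 then 0 else 1
  | n + 1 => fun x => if x = 0 then 0 else Q.kernel Λ (survival Q Λ n) x

theorem survival_nonneg (h : Q.Admissible Λ) (n : ℕ) (x : ι → ℕ) : 0 ≤ survival Q Λ n x := by
  induction n generalizing x with
  | zero => unfold survival; split_ifs <;> simp
  | succ n ih =>
    unfold survival
    split_ifs
    · exact le_rfl
    · have := kernel_mono h (f := fun _ => (0 : ℝ)) (g := survival Q Λ n) (fun y => ih y) x
      rwa [kernel_const] at this

theorem survival_le_one (h : Q.Admissible Λ) (n : ℕ) (x : ι → ℕ) : survival Q Λ n x ≤ 1 := by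
  induction n generalizing x with
  | zero => unfold survival; split_ifs <;> simp
  | succ n ih =>
    unfold survival
    split_ifs
    · exact zero_le_one
    · have := kernel_mono h (g := fun _ => (1 : ℝ)) (f := survival Q Λ n) (fun y => ih y) x
      rwa [kernel_const] at this

theorem survival_antitone (h : Q.Admissible Λ) (x : ι → ℕ) :
    Antitone fun n => survival Q Λ n x := by
  refine antitone_nat_of_succ_le fun n => ?_
  induction n generalizing x with
  | zero =>
    have := survival_le_one h 1 x
    by_cases hx : x = 0
    · simp [survival, hx]
    · simpa [survival, hx] using this
  | succ n ih =>
    by_cases hx : x = 0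
    · simp [survival, hx]
    · have h1 := kernel_mono h (fun y => ih y) x
      change (if x = 0 then 0 else Q.kernel Λ (survival Q Λ (n + 1)) x) ≤
        if x = 0 then 0 else Q.kernel Λ (survival Q Λ n) x
      rwa [if_neg hx, if_neg hx]

theorem tendsto_kernel {u : ℕ → (ι → ℕ) → ℝ} {q : (ι → ℕ) → ℝ}
    (hu : ∀ x, Tendsto (fun n => u n x) atTop (𝓝 (q x))) (x : ι → ℕ) :
    Tendsto (fun n => Q.kernel Λ (u n) x) atTop (𝓝 (Q.kernel Λ q x)) := by
  unfold kernel gen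
  exact (hu x).add (((tendsto_finsetSum _ fun m _ => ((hu _).sub (hu x)).const_mul _)).const_mul _)

/-- A stable network empties almost surely. -/
theorem tendsto_survival (h : Q.Admissible Λ) (hd : Q.Drains) {π : Measure (ι → ℕ)}
    [IsProbabilityMeasure π] (hπ : Q.IsStationary Λ π) (x : ι → ℕ) :
    Tendsto (fun n => survival Q Λ n x) atTop (𝓝 0) := by
  have hbdd : ∀ x, BddBelow (Set.range fun n => survival Q Λ n x) := fun x =>
    ⟨0, by rintro _ ⟨n, rfl⟩; exact survival_nonneg h n x⟩
  obtain ⟨q, hq⟩ : ∃ q : (ι → ℕ) → ℝ,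
      ∀ x, Tendsto (fun n => survival Q Λ n x) atTop (𝓝 (q x)) :=
    ⟨_, fun x => tendsto_atTop_ciInf (survival_antitone h x) (hbdd x)⟩
  have hq0 : ∀ x, 0 ≤ q x := fun x => ge_of_tendsto' (hq x) fun n => survival_nonneg h n x
  have hq1 : ∀ x, q x ≤ 1 := fun x => le_of_tendsto' (hq x) fun n => survival_le_one h n x
  have hqabs : ∀ x, |q x| ≤ 1 := fun x => abs_le.2 ⟨by linarith [hq0 x], hq1 x⟩
  have hz : q 0 = 0 := by
    refine tendsto_nhds_unique (hq 0) ?_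
    have : (fun n => survival Q Λ n 0) = fun _ => 0 := by
      ext n; cases n <;> simp [survival]
    rw [this]
    exact tendsto_const_nhds
  have hne : ∀ x, x ≠ 0 → q x = Q.kernel Λ q x := fun x hx => by
    refine tendsto_nhds_unique ((tendsto_add_atTop_iff_nat 1).2 (hq x)) ?_
    simp only [survival, if_neg hx]
    exact tendsto_kernel hq x
  have hKq0 : ∀ x, 0 ≤ Q.kernel Λ q x := fun x => by
    have := kernel_mono h (f := fun _ => (0 : ℝ)) (g := q) hq0 x
    rwa [kernel_const] at this
  have hlq : LinearGrowth q := LinearGrowth.of_bounded hqabs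
  -- stationarity at the empty state makes `q` harmonic there as well
  have hharm : ∀ x, Q.kernel Λ q x = q x := by
    have hint := (hπ.integrable _ (linearGrowth_kernel (Q := Q) (Λ := Λ) hlq)).sub
      (hπ.integrable _ hlq)
    have h0 : ∫ x, (Q.kernel Λ q - q) x ∂π = 0 := by
      simp only [Pi.sub_apply]
      rw [integral_sub (hπ.integrable _ (linearGrowth_kernel hlq)) (hπ.integrable _ hlq),
        hπ.invariant _ hlq, sub_self]
    intro x
    refine sub_eq_zero.1 (eq_zero_of_integral_eq_zero hπ.pos (fun x => ?_) hint h0 x)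
    by_cases hx : x = 0
    · simp only [Pi.sub_apply, hx, hz, sub_zero]
      exact hKq0 0
    · simp [← hne x hx]
  have hgen : ∀ x, Q.gen q x = 0 := fun x => by
    have h1 := hharm x
    unfold kernel at h1
    have h2 : Λ⁻¹ * Q.gen q x = 0 := by linarith
    exact (mul_eq_zero.1 h2).resolve_left (inv_ne_zero h.1.ne')
  -- the carré du champ of a bounded harmonic function has zero mean
  have hsq : LinearGrowth fun x => q x ^ 2 :=
    LinearGrowth.of_bounded (C := 1) fun x => by
      rw [abs_pow]; exact pow_le_one₀ (abs_nonneg _) (hqabs x)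
  have hcarre : ∀ x, Q.kernel Λ (fun x => q x ^ 2) x - q x ^ 2 =
      Λ⁻¹ * ∑ m, Q.rate m * (q (transfer (Q.src m) (Q.dst m) x) - q x) ^ 2 := fun x => by
    have h1 := hgen x
    unfold gen at h1
    unfold kernel gen
    have : ∑ m, Q.rate m * (q (transfer (Q.src m) (Q.dst m) x) - q x) ^ 2 =
        ∑ m, Q.rate m * (q (transfer (Q.src m) (Q.dst m) x) ^ 2 - q x ^ 2) -
          2 * q x * ∑ m, Q.rate m * (q (transfer (Q.src m) (Q.dst m) x) - q x) := by
      rw [Finset.mul_sum, ← Finset.sum_sub_distrib]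
      exact Finset.sum_congr rfl fun m _ => by ring
    rw [this, h1]
    ring
  have hterm : ∀ x m, 0 ≤ Q.rate m * (q (transfer (Q.src m) (Q.dst m) x) - q x) ^ 2 :=
    fun x m => mul_nonneg (Q.rate_nonneg m) (sq_nonneg _)
  have hcarre0 : ∀ x, Q.kernel Λ (fun x => q x ^ 2) x - q x ^ 2 = 0 := by
    refine eq_zero_of_integral_eq_zero hπ.pos (fun x => ?_)
      ((hπ.integrable _ (linearGrowth_kernel hsq)).sub (hπ.integrable _ hsq)) ?_
    · rw [hcarre]
      exact mul_nonneg (inv_nonneg.2 h.1.le) (Finset.sum_nonneg fun m _ => hterm x m)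
    · rw [integral_sub (hπ.integrable _ (linearGrowth_kernel hsq)) (hπ.integrable _ hsq),
        hπ.invariant _ hsq, sub_self]
  have hinv : ∀ m, 0 < Q.rate m → ∀ x, q (transfer (Q.src m) (Q.dst m) x) = q x := by
    intro m hm x
    have h1 := hcarre0 x
    rw [hcarre] at h1
    have h2 := (mul_eq_zero.1 h1).resolve_left (inv_ne_zero h.1.ne')
    have h3 := (Finset.sum_eq_zero_iff_of_nonneg fun m _ => hterm x m).1 h2 m (Finset.mem_univ m)
    have h4 := (mul_eq_zero.1 h3).resolve_left hm.ne'
    exact sub_eq_zero.1 (pow_eq_zero_iff two_ne_zero |>.1 h4)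
  have := hq x
  rwa [eq_apply_zero_of_drains hd hinv x, hz] at this

/-- Chains started from `x` and from the empty state can be kept ordered until the former one
visits the empty state, when they merge. -/
theorem iterate_kernel_sub_le (h : Q.Admissible Λ) {f : (ι → ℕ) → ℝ} (hf : Monotone f) {C : ℝ}
    (hC : ∀ x, |f x| ≤ C) (n : ℕ) (x : ι → ℕ) :
    (Q.kernel Λ)^[n] f x - (Q.kernel Λ)^[n] f 0 ≤ 2 * C * survival Q Λ n x := by
  have hb : ∀ n x, |(Q.kernel Λ)^[n] f x| ≤ C := abs_iterate_kernel_le h hC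
  by_cases hx : x = 0
  · have : survival Q Λ n x = 0 := by cases n <;> simp [survival, hx]
    rw [this, hx]
    simp
  induction n generalizing x with
  | zero =>
    have h1 := abs_le.1 (hb 0 x)
    have h2 := abs_le.1 (hb 0 0)
    simp only [survival, if_neg hx, mul_one]
    linarith
  | succ n ih =>
    have ih' : ∀ y, (Q.kernel Λ)^[n] f y - (Q.kernel Λ)^[n] f 0 ≤ 2 * C * survival Q Λ n y := by
      intro y
      by_cases hy : y = 0
      · have : survival Q Λ n y = 0 := by cases n <;> simp [survival, hy]
        rw [this, hy]
        simp
      · exact ih y hy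
    rw [Function.iterate_succ_apply']
    set g := (Q.kernel Λ)^[n] f with hg
    have hgm : Monotone g := iterate_kernel_monotone h hf n
    have h0 : g 0 ≤ Q.kernel Λ g 0 := by
      have := kernel_mono h (f := fun _ => g 0) (g := g) (fun y => hgm zero_le) 0
      rwa [kernel_const] at this
    have h1 : Q.kernel Λ g x ≤ g 0 + 2 * C * survival Q Λ (n + 1) x := by
      have h2 : g ≤ (fun _ => g 0) + (2 * C) • survival Q Λ n := fun y => by
        simp only [Pi.add_apply, Pi.smul_apply, smul_eq_mul]
        linarith [ih' y]
      have h3 := kernel_mono h h2 x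
      rw [kernel_add, kernel_const, kernel_smul] at h3
      simpa [survival, hx] using h3
    linarith

theorem tendsto_iterate_kernel_of_bounded (h : Q.Admissible Λ) (hd : Q.Drains)
    {π : Measure (ι → ℕ)} [IsProbabilityMeasure π] (hπ : Q.IsStationary Λ π)
    {f : (ι → ℕ) → ℝ} (hf : Monotone f) {C : ℝ} (hC : ∀ x, |f x| ≤ C) (x : ι → ℕ) :
    Tendsto (fun n => (Q.kernel Λ)^[n] f x) atTop (𝓝 (∫ y, f y ∂π)) := by
  have hdiff : ∀ x, Tendsto (fun n => (Q.kernel Λ)^[n] f x - (Q.kernel Λ)^[n] f 0) atTop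
      (𝓝 0) := fun x => by
    have h1 := (tendsto_survival h hd hπ x).const_mul (2 * C)
    rw [mul_zero] at h1
    exact tendsto_of_tendsto_of_tendsto_of_le_of_le tendsto_const_nhds h1
      (fun n => sub_nonneg.2 (iterate_kernel_monotone h hf n zero_le))
      (fun n => iterate_kernel_sub_le h hf hC n x)
  have hlf : LinearGrowth f := LinearGrowth.of_bounded hC
  have h0 : Tendsto (fun n => (Q.kernel Λ)^[n] f 0) atTop (𝓝 (∫ y, f y ∂π)) := by
    have h1 : Tendsto (fun n => ∫ y, ((Q.kernel Λ)^[n] f y - (Q.kernel Λ)^[n] f 0) ∂π) atTop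
        (𝓝 (∫ _, 0 ∂π)) := by
      refine tendsto_integral_of_dominated_convergence (fun _ => 2 * C)
        (fun n => Measurable.of_discrete.aestronglyMeasurable)
        (integrable_const _) (fun n => ae_of_all _ fun y => ?_) (ae_of_all _ hdiff)
      have h2 := abs_iterate_kernel_le h hC n y
      have h3 := abs_iterate_kernel_le h hC n 0
      rw [Real.norm_eq_abs]
      exact (abs_sub _ _).trans (by linarith)
    have h2 : ∀ n, ∫ y, ((Q.kernel Λ)^[n] f y - (Q.kernel Λ)^[n] f 0) ∂π =
        ∫ y, f y ∂π - (Q.kernel Λ)^[n] f 0 := fun n => by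
      rw [integral_sub (hπ.integrable _ (linearGrowth_iterate hlf n)) (integrable_const _),
        hπ.integral_iterate hlf]
      simp
    simp only [h2, integral_zero] at h1
    simpa using h1.const_sub (∫ y, f y ∂π)
  simpa using (hdiff x).add h0

/-- Convergence to equilibrium for increasing functions with finite mean. As `π` charges `x`, the
nonnegative difference between the chains from `x` and from the empty state is controlled by its
mean under `π`. -/
theorem tendsto_iterate_kernel (h : Q.Admissible Λ) (hd : Q.Drains)
    {π : Measure (ι → ℕ)} [IsProbabilityMeasure π] (hπ : Q.IsStationary Λ π)
    {f : (ι → ℕ) → ℝ} (hf : Monotone f) (hlf : LinearGrowth f) (x : ι → ℕ) :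
    Tendsto (fun n => (Q.kernel Λ)^[n] f x) atTop (𝓝 (∫ y, f y ∂π)) := by
  have hmono : ∀ n, Monotone ((Q.kernel Λ)^[n] f) := iterate_kernel_monotone h hf
  have hle : ∀ n, (Q.kernel Λ)^[n] f 0 ≤ ∫ y, f y ∂π := fun n => by
    rw [← hπ.integral_iterate hlf n]
    have := integral_mono (μ := π) (integrable_const ((Q.kernel Λ)^[n] f 0))
      (hπ.integrable _ (linearGrowth_iterate hlf n)) (fun y => hmono n zero_le)
    simpa using this
  have htrunc : Tendsto (fun R : ℕ => ∫ y, min (f y) R ∂π) atTop (𝓝 (∫ y, f y ∂π)) := by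
    refine tendsto_integral_of_dominated_convergence (fun y => |f y|)
      (fun n => Measurable.of_discrete.aestronglyMeasurable)
      (hπ.integrable _ hlf).abs (fun R => ae_of_all _ fun y => ?_) (ae_of_all _ fun y => ?_)
    · rw [Real.norm_eq_abs, abs_le]
      have hR : (0 : ℝ) ≤ R := Nat.cast_nonneg R
      constructor
      · exact le_min (neg_abs_le _) ((neg_nonpos.2 (abs_nonneg _)).trans hR)
      · exact (min_le_left _ _).trans (le_abs_self _)
    · obtain ⟨R₀, hR₀⟩ := exists_nat_ge (f y)
      refine tendsto_const_nhds.congr' ?_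
      filter_upwards [eventually_ge_atTop R₀] with R hR
      have : (R₀ : ℝ) ≤ R := by exact_mod_cast hR
      rw [min_eq_left (by linarith)]
  have h0 : Tendsto (fun n => (Q.kernel Λ)^[n] f 0) atTop (𝓝 (∫ y, f y ∂π)) := by
    refine tendsto_order.2 ⟨fun a ha => ?_, fun a ha => Eventually.of_forall fun n =>
      (hle n).trans_lt ha⟩
    obtain ⟨R, hR⟩ := ((tendsto_order.1 htrunc).1 a ha).exists
    have hbd : ∀ x, |min (f x) (R : ℝ)| ≤ |f 0| + R := fun x => by
      have hR : (0 : ℝ) ≤ R := Nat.cast_nonneg R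
      have h1 : f 0 ≤ f x := hf zero_le
      have h2 := neg_abs_le (f 0)
      have h3 := abs_nonneg (f 0)
      rw [abs_le]
      exact ⟨le_min (by linarith) (by linarith), (min_le_right _ _).trans (by linarith)⟩
    have h1 := tendsto_iterate_kernel_of_bounded h hd hπ (f := fun x => min (f x) (R : ℝ))
      (fun x y hxy => min_le_min_right _ (hf hxy)) hbd 0
    filter_upwards [(tendsto_order.1 h1).1 a hR] with n hn
    exact hn.trans_le (iterate_kernel_mono h (fun y => min_le_left _ _) n 0)
  have hx : 0 < π.real {x} := ENNReal.toReal_pos (hπ.pos x) (measure_ne_top _ _)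
  have hdiff : Tendsto (fun n => (Q.kernel Λ)^[n] f x - (Q.kernel Λ)^[n] f 0) atTop (𝓝 0) := by
    have h1 := (h0.const_sub (∫ y, f y ∂π)).div_const (π.real {x})
    rw [sub_self, zero_div] at h1
    refine tendsto_of_tendsto_of_tendsto_of_le_of_le tendsto_const_nhds h1
      (fun n => sub_nonneg.2 (hmono n zero_le)) (fun n => ?_)
    rw [le_div_iff₀ hx]
    have hint : Integrable (fun y => (Q.kernel Λ)^[n] f y - (Q.kernel Λ)^[n] f 0) π :=
      (hπ.integrable _ (linearGrowth_iterate hlf n)).sub (integrable_const _)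
    have h2 : ∫ y in {x}, ((Q.kernel Λ)^[n] f y - (Q.kernel Λ)^[n] f 0) ∂π ≤
        ∫ y, ((Q.kernel Λ)^[n] f y - (Q.kernel Λ)^[n] f 0) ∂π :=
      setIntegral_le_integral hint
        (ae_of_all _ fun y => sub_nonneg.2 (hmono n zero_le))
    rw [integral_singleton, integral_sub (hπ.integrable _ (linearGrowth_iterate hlf n))
      (integrable_const _), hπ.integral_iterate hlf] at h2
    simp only [smul_eq_mul, integral_const, probReal_univ, one_mul] at h2
    linarith
  simpa using hdiff.add h0

end Network
end Convergence

/-! ### Product-geometric stationary laws -/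

/-- The geometric law `n ↦ ρ ^ n * (1 - ρ)` on `ℕ`, for `0 ≤ ρ < 1`. Projecting the parameter to the
unit interval makes this a probability measure for every real `ρ`. -/
def geoLaw (ρ : ℝ) : Measure ℕ :=
  ProbabilityTheory.geometricMeasure (Set.projIcc 0 1 zero_le_one (1 - ρ))

instance (ρ : ℝ) : IsProbabilityMeasure (geoLaw ρ) := by
  unfold geoLaw; infer_instance

section Geo

variable {ρ : ℝ}

theorem coe_projIcc_one_sub (h0 : 0 ≤ ρ) (h1 : ρ < 1) :
    ((Set.projIcc 0 1 zero_le_one (1 - ρ) : unitInterval) : ℝ) = 1 - ρ := by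
  rw [Set.projIcc_of_mem zero_le_one (⟨by linarith, by linarith⟩ : 1 - ρ ∈ Set.Icc (0 : ℝ) 1)]

theorem projIcc_one_sub_ne_zero (h0 : 0 ≤ ρ) (h1 : ρ < 1) :
    (Set.projIcc 0 1 zero_le_one (1 - ρ) : unitInterval) ≠ 0 := by
  intro h
  have := coe_projIcc_one_sub h0 h1
  rw [h] at this
  simp only [Set.Icc.coe_zero] at this
  linarith

theorem geoLaw_singleton (h0 : 0 ≤ ρ) (h1 : ρ < 1) (n : ℕ) :
    geoLaw ρ {n} = ENNReal.ofReal (ρ ^ n * (1 - ρ)) := by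
  unfold geoLaw
  rw [ProbabilityTheory.geometricMeasure_singleton (projIcc_one_sub_ne_zero h0 h1),
    coe_projIcc_one_sub h0 h1, sub_sub_cancel]

theorem summable_coe_mul_geo (h0 : 0 ≤ ρ) (h1 : ρ < 1) :
    HasSum (fun n : ℕ => ρ ^ n * (1 - ρ) * n) (ρ / (1 - ρ)) := by
  have h := (hasSum_coe_mul_geometric_of_norm_lt_one (𝕜 := ℝ) (r := ρ)
    (by rwa [Real.norm_eq_abs, abs_of_nonneg h0])).mul_right (1 - ρ)
  have h2 : 1 - ρ ≠ 0 := by linarith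
  convert! h using 1
  · ext n; ring
  · field_simp

theorem integrable_coe_geoLaw (h0 : 0 ≤ ρ) (h1 : ρ < 1) :
    Integrable (fun n : ℕ => (n : ℝ)) (geoLaw ρ) := by
  unfold geoLaw
  rw [ProbabilityTheory.integrable_geometricMeasure_iff (projIcc_one_sub_ne_zero h0 h1),
    coe_projIcc_one_sub h0 h1, sub_sub_cancel]
  simpa using (summable_coe_mul_geo h0 h1).summable

theorem integral_coe_geoLaw (h0 : 0 ≤ ρ) (h1 : ρ < 1) :
    ∫ n : ℕ, (n : ℝ) ∂(geoLaw ρ) = ρ / (1 - ρ) := by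
  have h := ProbabilityTheory.hasSum_integral_geometricMeasure
    (projIcc_one_sub_ne_zero h0 h1) (integrable_coe_geoLaw h0 h1)
  rw [coe_projIcc_one_sub h0 h1, sub_sub_cancel] at h
  exact h.unique (summable_coe_mul_geo h0 h1)

/-- Tails of the geometric law. -/
theorem geoLaw_Ici (h0 : 0 ≤ ρ) (h1 : ρ < 1) (k : ℕ) :
    (geoLaw ρ).real (Set.Ici k) = ρ ^ k := by
  induction k with
  | zero =>
    have : Set.Ici 0 = (Set.univ : Set ℕ) := by ext; simp
    rw [this]
    simp
  | succ k ih =>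
    have hk : (Set.Ici k : Set ℕ) = {k} ∪ Set.Ici (k + 1) := by
      ext n
      simp only [Set.mem_Ici, Set.singleton_union, Set.mem_insert_iff]
      omega
    rw [hk, measureReal_union (by simp) (MeasurableSet.of_discrete), measureReal_def,
      geoLaw_singleton h0 h1, ENNReal.toReal_ofReal
        (mul_nonneg (pow_nonneg h0 _) (by linarith))] at ih
    rw [pow_succ]
    linarith

end Geo

section Product

variable {ι M : Type*} [DecidableEq ι] [Fintype ι] [Fintype M]

/-- The product-geometric law with parameters `ρ`. -/
def prodLaw (ρ : ι → ℝ) : Measure (ι → ℕ) := Measure.pi fun i => geoLaw (ρ i)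

instance (ρ : ι → ℝ) : IsProbabilityMeasure (prodLaw ρ) := by
  unfold prodLaw; infer_instance

/-- The load of a node; the outside behaves like a node that is always busy. -/
def load (ρ : ι → ℝ) (s : Option ι) : ℝ := s.elim 1 ρ

@[simp] theorem load_none (ρ : ι → ℝ) : load ρ none = 1 := rfl

@[simp] theorem load_some (ρ : ι → ℝ) (i : ι) : load ρ (some i) = ρ i := rfl

variable {ρ : ι → ℝ}

theorem prodLaw_singleton (hρ : ∀ i, 0 ≤ ρ i ∧ ρ i < 1) (x : ι → ℕ) :
    prodLaw ρ {x} = ENNReal.ofReal (∏ i, ρ i ^ x i * (1 - ρ i)) := by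
  unfold prodLaw
  rw [Measure.pi_singleton, ENNReal.ofReal_prod_of_nonneg fun i _ =>
    mul_nonneg (pow_nonneg (hρ i).1 _) (by linarith [(hρ i).2])]
  exact Finset.prod_congr rfl fun i _ => geoLaw_singleton (hρ i).1 (hρ i).2 _

theorem prodLaw_real_singleton (hρ : ∀ i, 0 ≤ ρ i ∧ ρ i < 1) (x : ι → ℕ) :
    (prodLaw ρ).real {x} = ∏ i, ρ i ^ x i * (1 - ρ i) := by
  rw [measureReal_def, prodLaw_singleton hρ, ENNReal.toReal_ofReal]
  exact Finset.prod_nonneg fun i _ =>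
    mul_nonneg (pow_nonneg (hρ i).1 _) (by linarith [(hρ i).2])

theorem load_nonneg (hρ : ∀ i, 0 ≤ ρ i ∧ ρ i < 1) (s : Option ι) : 0 ≤ load ρ s := by
  cases s with
  | none => exact zero_le_one
  | some i => exact (hρ i).1

theorem prodLaw_real_singleton_inc (hρ : ∀ i, 0 ≤ ρ i ∧ ρ i < 1) (s : Option ι) (x : ι → ℕ) :
    (prodLaw ρ).real {inc s x} = load ρ s * (prodLaw ρ).real {x} := by
  rw [prodLaw_real_singleton hρ, prodLaw_real_singleton hρ]
  cases s with
  | none => simp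
  | some j =>
    rw [← Finset.mul_prod_erase _ _ (Finset.mem_univ j),
      ← Finset.mul_prod_erase _ (fun i => ρ i ^ x i * (1 - ρ i)) (Finset.mem_univ j)]
    have : ∏ i ∈ Finset.univ.erase j, ρ i ^ inc (some j) x i * (1 - ρ i) =
        ∏ i ∈ Finset.univ.erase j, ρ i ^ x i * (1 - ρ i) := by
      refine Finset.prod_congr rfl fun i hi => ?_
      have : j ≠ i := fun h => Finset.ne_of_mem_erase hi h.symm
      simp [inc_apply, this]
    rw [this]
    simp only [inc_apply, if_true, load_some, pow_succ]
    ring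

/-- Conditioning on the presence of a customer amounts to adding one. -/
theorem map_inc_prodLaw (hρ : ∀ i, 0 ≤ ρ i ∧ ρ i < 1) (s : Option ι) :
    ENNReal.ofReal (load ρ s) • (prodLaw ρ).map (inc s) =
      (prodLaw ρ).restrict {x | Avail s x} := by
  refine Measure.ext_of_singleton fun x => ?_
  rw [Measure.smul_apply, Measure.map_apply Measurable.of_discrete MeasurableSet.of_discrete,
    Measure.restrict_apply MeasurableSet.of_discrete, smul_eq_mul]
  by_cases hx : Avail s x
  · have h1 : inc s ⁻¹' {x} = {dec s x} := by
      ext y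
      simp only [Set.mem_preimage, Set.mem_singleton_iff]
      constructor
      · rintro rfl
        rw [dec_inc]
      · rintro rfl
        exact inc_dec hx
    have h2 : ({x} ∩ {x | Avail s x} : Set (ι → ℕ)) = {x} := by
      rw [Set.inter_eq_left]
      simpa using hx
    have h3 := prodLaw_real_singleton_inc hρ s (dec s x)
    rw [inc_dec hx] at h3
    rw [h1, h2, ← ofReal_measureReal (μ := prodLaw ρ) (s := {x}), h3,
      ENNReal.ofReal_mul (load_nonneg hρ s), ofReal_measureReal]
  · have h1 : inc s ⁻¹' {x} = ∅ := by
      ext y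
      simp only [Set.mem_preimage, Set.mem_singleton_iff, Set.mem_empty_iff_false, iff_false]
      rintro rfl
      exact hx (avail_inc s y)
    have h2 : ({x} ∩ {x | Avail s x} : Set (ι → ℕ)) = ∅ := by
      simpa using hx
    rw [h1, h2]
    simp

theorem setIntegral_avail (hρ : ∀ i, 0 ≤ ρ i ∧ ρ i < 1) (s : Option ι) (F : (ι → ℕ) → ℝ) :
    ∫ x in {x | Avail s x}, F x ∂(prodLaw ρ) = load ρ s * ∫ y, F (inc s y) ∂(prodLaw ρ) := by
  rw [← map_inc_prodLaw hρ s, integral_smul_measure, integral_map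
    Measurable.of_discrete.aemeasurable Measurable.of_discrete.aestronglyMeasurable,
    ENNReal.toReal_ofReal (load_nonneg hρ s), smul_eq_mul]

theorem integrable_coord (hρ : ∀ i, 0 ≤ ρ i ∧ ρ i < 1) (j : ι) :
    Integrable (fun x : ι → ℕ => (x j : ℝ)) (prodLaw ρ) :=
  (measurePreserving_eval (fun i => geoLaw (ρ i)) j).integrable_comp_of_integrable
    (integrable_coe_geoLaw (hρ j).1 (hρ j).2)

theorem integral_coord (hρ : ∀ i, 0 ≤ ρ i ∧ ρ i < 1) (j : ι) :
    ∫ x : ι → ℕ, (x j : ℝ) ∂(prodLaw ρ) = ρ j / (1 - ρ j) := by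
  rw [← integral_coe_geoLaw (hρ j).1 (hρ j).2,
    ← (measurePreserving_eval (fun i => geoLaw (ρ i)) j).map_eq,
    integral_map (measurable_pi_apply j).aemeasurable Measurable.of_discrete.aestronglyMeasurable]
  rfl

theorem prodLaw_real_coord_ge (hρ : ∀ i, 0 ≤ ρ i ∧ ρ i < 1) (j : ι) (k : ℕ) :
    (prodLaw ρ).real {x | k ≤ x j} = ρ j ^ k := by
  rw [← geoLaw_Ici (hρ j).1 (hρ j).2 k, measureReal_def, measureReal_def,
    ← (measurePreserving_eval (fun i => geoLaw (ρ i)) j).measure_preimage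
      MeasurableSet.of_discrete.nullMeasurableSet]
  rfl

theorem integrable_of_linearGrowth (hρ : ∀ i, 0 ≤ ρ i ∧ ρ i < 1) {f : (ι → ℕ) → ℝ}
    (hf : LinearGrowth f) : Integrable f (prodLaw ρ) := by
  obtain ⟨C, hC⟩ := hf
  refine Integrable.mono'
    (((integrable_const (1 : ℝ)).add
      (integrable_finsetSum Finset.univ fun i _ => integrable_coord hρ i)).const_mul C)
    Measurable.of_discrete.aestronglyMeasurable (ae_of_all _ fun x => ?_)
  simpa using hC x

namespace Network

variable (Q : Network ι M) {Λ : ℝ}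

/-- The traffic equations of a stable network in terms of the loads: for each node, the rate of
departures equals the rate of arrivals. -/
def Balanced (ρ : ι → ℝ) : Prop := ∀ j : ι,
  ∑ m, (if Q.src m = some j then Q.rate m * load ρ (Q.src m) else 0) =
    ∑ m, (if Q.dst m = some j then Q.rate m * load ρ (Q.src m) else 0)

variable {Q}

theorem integral_transfer_sub (hρ : ∀ i, 0 ≤ ρ i ∧ ρ i < 1) {f : (ι → ℕ) → ℝ}
    (hf : LinearGrowth f) (s d : Option ι) :
    ∫ x, (f (transfer s d x) - f x) ∂(prodLaw ρ) =
      load ρ s * (∫ y, f (inc d y) ∂(prodLaw ρ) - ∫ y, f (inc s y) ∂(prodLaw ρ)) := by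
  have hinc : ∀ s, Integrable (fun y => f (inc s y)) (prodLaw ρ) := fun s =>
    integrable_of_linearGrowth hρ (hf.comp_le (s := s) fun _ => le_rfl)
  have h1 : ∀ x, f (transfer s d x) - f x =
      Set.indicator {x | Avail s x} (fun x => f (inc d (dec s x)) - f x) x := fun x => by
    by_cases hx : Avail s x
    · rw [transfer_of_avail hx, Set.indicator_of_mem (by exact hx)]
    · rw [transfer_of_not_avail hx, Set.indicator_of_notMem (by exact hx), sub_self]
  simp only [h1]
  rw [integral_indicator MeasurableSet.of_discrete, setIntegral_avail hρ]
  simp only [dec_inc]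
  rw [integral_sub (hinc d) (hinc s)]

/-- **Jackson's theorem**: the product-geometric law of a solution of the traffic equations is
stationary. -/
theorem Balanced.isStationary (hQ : Q.Balanced ρ) (hρ : ∀ i, 0 < ρ i ∧ ρ i < 1) :
    Q.IsStationary Λ (prodLaw ρ) := by
  have hρ' : ∀ i, 0 ≤ ρ i ∧ ρ i < 1 := fun i => ⟨(hρ i).1.le, (hρ i).2⟩
  refine ⟨fun x => ?_, fun f hf => integrable_of_linearGrowth hρ' hf, fun f hf => ?_⟩
  · rw [prodLaw_singleton hρ', Ne, ENNReal.ofReal_eq_zero, not_le]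
    exact Finset.prod_pos fun i _ => mul_pos (pow_pos (hρ i).1 _) (by linarith [(hρ i).2])
  have hterm : ∀ m, Integrable (fun x => Q.rate m *
      (f (transfer (Q.src m) (Q.dst m) x) - f x)) (prodLaw ρ) := fun m =>
    ((integrable_of_linearGrowth hρ'
      (hf.comp_le (transfer_le_inc (Q.src m) (Q.dst m)))).sub
        (integrable_of_linearGrowth hρ' hf)).const_mul _
  have hgen : ∫ x, Q.gen f x ∂(prodLaw ρ) = 0 := by
    unfold gen
    rw [integral_finsetSum _ fun m _ => hterm m]
    simp only [integral_const_mul, integral_transfer_sub hρ' hf]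
    set F : Option ι → ℝ := fun s => ∫ y, f (inc s y) ∂(prodLaw ρ) with hF
    have hsplit : ∀ s : Option ι, F s - F none =
        ∑ j, if s = some j then F (some j) - F none else 0 := by
      intro s
      cases s with
      | none => simp
      | some i => simp [Finset.sum_ite_eq]
    have h1 : ∀ m, Q.rate m * (load ρ (Q.src m) * (F (Q.dst m) - F (Q.src m))) =
        ∑ j, (F (some j) - F none) *
          ((if Q.dst m = some j then Q.rate m * load ρ (Q.src m) else 0) -
            (if Q.src m = some j then Q.rate m * load ρ (Q.src m) else 0)) := by
      intro m
      have h2 : F (Q.dst m) - F (Q.src m) =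
          ((F (Q.dst m) - F none) - (F (Q.src m) - F none)) := by ring
      rw [h2, hsplit (Q.dst m), hsplit (Q.src m), ← Finset.sum_sub_distrib, Finset.mul_sum,
        Finset.mul_sum]
      refine Finset.sum_congr rfl fun j _ => ?_
      split_ifs <;> ring
    change ∑ m, Q.rate m * (load ρ (Q.src m) * (F (Q.dst m) - F (Q.src m))) = 0
    simp only [h1]
    rw [Finset.sum_comm]
    refine Finset.sum_eq_zero fun j _ => ?_
    rw [← Finset.mul_sum, Finset.sum_sub_distrib, hQ j, sub_self, mul_zero]
  unfold kernel
  rw [integral_add (integrable_of_linearGrowth hρ' hf), integral_const_mul, hgen, mul_zero,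
    add_zero]
  refine Integrable.const_mul ?_ _
  unfold gen
  exact integrable_finsetSum _ fun m _ => hterm m

end Network

end Product

/-! ### The general traffic equation -/

section Traffic

variable {N : ℕ}

/-- The gap to the right of a particle; `none` for the rightmost particle. -/
def rightGap (i : Fin (N + 1)) : Option (Fin N) := if h : (i : ℕ) < N then some ⟨i, h⟩ else none

/-- The gap to the left of a particle; `none` for the leftmost particle. -/
def leftGap (i : Fin (N + 1)) : Option (Fin N) :=
  if h : 0 < (i : ℕ) then some ⟨i - 1, by omega⟩ else none

theorem rightGap_eq_some {i : Fin (N + 1)} {j : Fin N} :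
    rightGap i = some j ↔ i = j.castSucc := by
  unfold rightGap
  split_ifs with h
  · simp [Fin.ext_iff]
  · simp only [Fin.ext_iff, Fin.val_castSucc, false_iff]
    omega

theorem leftGap_eq_some {i : Fin (N + 1)} {j : Fin N} : leftGap i = some j ↔ i = j.succ := by
  unfold leftGap
  split_ifs with h
  · simp only [Option.some.injEq, Fin.ext_iff, Fin.val_succ]
    omega
  · simp only [Fin.ext_iff, Fin.val_succ, false_iff]
    omega

@[simp] theorem rightGap_castSucc (j : Fin N) : rightGap j.castSucc = some j :=
  rightGap_eq_some.2 rfl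

@[simp] theorem leftGap_succ (j : Fin N) : leftGap j.succ = some j := leftGap_eq_some.2 rfl

@[simp] theorem rightGap_last : rightGap (Fin.last N) = none := by simp [rightGap]

@[simp] theorem leftGap_zero : leftGap (0 : Fin (N + 1)) = none := by simp [leftGap]

/-- The fraction of time `ρ_j ∧ 1` during which a node of workload `ρ_j` is busy. -/
def busy (a b : Fin (N + 1) → ℝ) (ν : Fin N → ℝ) (j : Fin N) : ℝ := min (workload a b ν j) 1

/-- The total arrival rate at a node when node `i` is busy a fraction `d i` of the time. -/
def inflow (a b : Fin (N + 1) → ℝ) (d : Fin N → ℝ) (j : Fin N) : ℝ :=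
  b j.succ * load d (rightGap j.succ) + a j.castSucc * load d (leftGap j.castSucc)

/-- The drift of particle `i` when gap `j` is nonempty a fraction `d j` of the time. -/
def drift (a b : Fin (N + 1) → ℝ) (d : Fin N → ℝ) (i : Fin (N + 1)) : ℝ :=
  b i * load d (rightGap i) - a i * load d (leftGap i)

theorem drift_succ_sub (a b : Fin (N + 1) → ℝ) (d : Fin N → ℝ) (j : Fin N) :
    drift a b d j.succ - drift a b d j.castSucc = inflow a b d j - serviceRate a b j * d j := by
  simp only [drift, inflow, serviceRate, leftGap_succ, rightGap_castSucc, load_some]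
  ring

variable {a b : Fin (N + 1) → ℝ} (ha : ∀ i, 0 ≤ a i) (hb : ∀ i, 0 < b i)

include ha hb

theorem serviceRate_pos (j : Fin N) : 0 < serviceRate a b j :=
  add_pos_of_pos_of_nonneg (hb _) (ha _)

theorem serviceRate_mul_busy (ν : Fin N → ℝ) (j : Fin N) :
    serviceRate a b j * busy a b ν j = min (ν j) (serviceRate a b j) := by
  have h := serviceRate_pos ha hb j
  unfold busy workload
  rw [mul_min_of_nonneg _ _ h.le, mul_div_cancel₀ _ h.ne', mul_one]

theorem isTrafficSolution_iff (ν : Fin N → ℝ) :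
    IsTrafficSolution a b ν ↔ ∀ j, ν j = inflow a b (busy a b ν) j := by
  unfold IsTrafficSolution
  rw [funext_iff]
  refine forall_congr' fun j => ?_
  suffices h : (Matrix.vecMul (ν ⊓ serviceRate a b) (routing a b) + arrivalRate a b) j =
      inflow a b (busy a b ν) j by rw [h]
  have hmin : ∀ i c, (ν ⊓ serviceRate a b) i * (c / serviceRate a b i) = c * busy a b ν i := by
    intro i c
    have h := serviceRate_pos ha hb i
    rw [Pi.inf_apply, ← serviceRate_mul_busy ha hb]
    field_simp
  have hterm : ∀ i, (ν ⊓ serviceRate a b) i * routing a b i j =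
      (if (j : ℕ) + 1 = i then b i.castSucc * busy a b ν i else 0) +
        (if (i : ℕ) + 1 = j then a i.succ * busy a b ν i else 0) := by
    intro i
    simp only [routing, Matrix.of_apply]
    split_ifs with h1 h2 h2
    · omega
    · rw [hmin, add_zero]
    · rw [hmin, zero_add]
    · simp
  simp only [Pi.add_apply, Matrix.vecMul, dotProduct, hterm, Finset.sum_add_distrib,
    arrivalRate, inflow]
  have hR : (∑ i : Fin N, if (j : ℕ) + 1 = i then b i.castSucc * busy a b ν i else 0) +
      (if (j : ℕ) + 1 = N then b (Fin.last N) else 0) =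
        b j.succ * load (busy a b ν) (rightGap j.succ) := by
    by_cases hj : (j : ℕ) + 1 = N
    · have h1 : j.succ = Fin.last N := by ext; simpa using hj
      rw [h1, rightGap_last, if_pos hj, Finset.sum_eq_zero]
      · simp
      · intro i _
        rw [if_neg]
        omega
    · have h1 : j.succ = (⟨j + 1, by omega⟩ : Fin N).castSucc := by ext; simp
      rw [h1, rightGap_castSucc, if_neg hj, Finset.sum_eq_single ⟨j + 1, by omega⟩]
      · simp
      · intro i _ hi
        rw [if_neg]
        intro h
        exact hi (Fin.ext h.symm)
      · simp
  have hL : (∑ i : Fin N, if (i : ℕ) + 1 = j then a i.succ * busy a b ν i else 0) +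
      (if (j : ℕ) = 0 then a 0 else 0) =
        a j.castSucc * load (busy a b ν) (leftGap j.castSucc) := by
    by_cases hj : (j : ℕ) = 0
    · have h1 : j.castSucc = 0 := by ext; simpa using hj
      rw [h1, leftGap_zero, if_pos hj, Finset.sum_eq_zero]
      · simp
      · intro i _
        rw [if_neg]
        omega
    · have h1 : j.castSucc = (⟨j - 1, by omega⟩ : Fin N).succ := by ext; simp; omega
      rw [h1, leftGap_succ, if_neg hj, Finset.sum_eq_single ⟨j - 1, by omega⟩]
      · rw [if_pos (by simp only; omega), load_some, add_zero]
      · intro i _ hi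
        rw [if_neg]
        intro h
        exact hi (Fin.ext (by simp; omega))
      · simp
  rw [← hR, ← hL]
  ring

/-- The traffic equation says that the drift increases by `(ν_j - μ_j)⁺` across gap `j`. -/
theorem drift_busy_succ_sub {ν : Fin N → ℝ} (hν : IsTrafficSolution a b ν) (j : Fin N) :
    drift a b (busy a b ν) j.succ - drift a b (busy a b ν) j.castSucc =
      max (workload a b ν j - 1) 0 * serviceRate a b j := by
  have h := serviceRate_pos ha hb j
  rw [drift_succ_sub, ← (isTrafficSolution_iff ha hb ν).1 hν j]
  unfold busy
  have h1 : ν j = serviceRate a b j * workload a b ν j := by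
    unfold workload; field_simp
  conv_lhs => rw [h1]
  rcases le_total (workload a b ν j) 1 with h2 | h2
  · rw [min_eq_left h2, max_eq_right (by linarith)]; ring
  · rw [min_eq_right h2, max_eq_left (by linarith)]; ring

theorem inflow_mono {d d' : Fin N → ℝ} (h : d ≤ d') : inflow a b d ≤ inflow a b d' := by
  have hl : ∀ s, load d s ≤ load d' s := by
    intro s; cases s
    · exact le_rfl
    · exact h _
  intro j
  exact add_le_add (mul_le_mul_of_nonneg_left (hl _) (hb _).le)
    (mul_le_mul_of_nonneg_left (hl _) (ha _))

theorem busy_mono {ν ν' : Fin N → ℝ} (h : ν ≤ ν') : busy a b ν ≤ busy a b ν' := by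
  intro j
  unfold busy workload
  have := serviceRate_pos ha hb j
  exact min_le_min_right _ (div_le_div_of_nonneg_right (h j) this.le)

/-- The right-hand side of the traffic equation is increasing, bounded and continuous in `ν`, so its
iterates started from `0` increase to a solution. -/
theorem exists_trafficSolution : ∃ ν : Fin N → ℝ, IsTrafficSolution a b ν ∧ ∀ j, 0 ≤ ν j := by
  set F : (Fin N → ℝ) → (Fin N → ℝ) := fun ν => inflow a b (busy a b ν) with hF
  have hFm : Monotone F := fun x y h => inflow_mono ha hb (busy_mono ha hb h)
  have hload : ∀ d : Fin N → ℝ, (∀ j, 0 ≤ d j) → ∀ s, 0 ≤ load d s := by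
    intro d hd s; cases s
    · exact zero_le_one
    · exact hd _
  have hF0 : (0 : Fin N → ℝ) ≤ F 0 := by
    have hd : ∀ j, 0 ≤ busy a b 0 j := fun j => by simp [busy, workload]
    intro j
    exact add_nonneg (mul_nonneg (hb _).le (hload _ hd _)) (mul_nonneg (ha _) (hload _ hd _))
  have hmono : Monotone fun n => F^[n] 0 := by
    refine monotone_nat_of_le_succ fun n => ?_
    rw [Function.iterate_succ_apply]
    exact hFm.iterate n hF0
  have hbound : ∀ ν, F ν ≤ inflow a b (fun _ => 1) := fun ν =>
    inflow_mono ha hb fun j => min_le_right _ _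
  have hbdd : ∀ n, F^[n] 0 ≤ inflow a b (fun _ => 1) := by
    intro n
    cases n with
    | zero => exact hF0.trans (hbound 0)
    | succ n => rw [Function.iterate_succ_apply']; exact hbound _
  have hlim : ∀ j, Tendsto (fun n => F^[n] 0 j) atTop (𝓝 (⨆ n, F^[n] 0 j)) := fun j =>
    tendsto_atTop_ciSup (fun n m h => hmono h j)
      ⟨inflow a b (fun _ => 1) j, by rintro _ ⟨n, rfl⟩; exact hbdd n j⟩
  set ν : Fin N → ℝ := fun j => ⨆ n, F^[n] 0 j with hνdef
  have hlim' : Tendsto (fun n => F^[n] 0) atTop (𝓝 ν) := tendsto_pi_nhds.2 hlim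
  have hcont : Continuous F := by
    have hbusy : ∀ s : Option (Fin N), Continuous fun ν => load (busy a b ν) s := by
      intro s; cases s with
      | none => exact continuous_const
      | some i =>
        simp only [load_some, busy, workload]
        fun_prop
    refine continuous_pi fun j => ?_
    exact ((hbusy _).const_mul _).add ((hbusy _).const_mul _)
  refine ⟨ν, (isTrafficSolution_iff ha hb ν).2 fun j => ?_, fun j => ?_⟩
  · have h1 : Tendsto (fun n => F^[n + 1] 0) atTop (𝓝 (F ν)) := by
      simp only [Function.iterate_succ_apply']
      exact (hcont.tendsto ν).comp hlim'
    exact congrFun (tendsto_nhds_unique ((tendsto_add_atTop_iff_nat 1).2 hlim') h1) j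
  · exact ge_of_tendsto' (hlim j) fun n => hmono (Nat.zero_le n) j

/-- The discrepancy `δ` between the busy fractions of two solutions makes `b_i δ_i - a_i δ_{i-1}`
nondecreasing in the particle `i`, nonnegative at the left end and nonpositive at the right end. -/
theorem trafficSolution_unique {ν ν' : Fin N → ℝ} (h : IsTrafficSolution a b ν)
    (h' : IsTrafficSolution a b ν') : ν = ν' := by
  rw [isTrafficSolution_iff ha hb] at h h'
  set d := busy a b ν with hd
  set d' := busy a b ν' with hd'
  set δ : Option (Fin N) → ℝ := fun s => |load d s - load d' s| with hδ
  have hδ0 : ∀ s, 0 ≤ δ s := fun s => abs_nonneg _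
  have hδn : δ none = 0 := by simp [hδ]
  set U : Fin (N + 1) → ℝ := fun i => b i * δ (rightGap i) - a i * δ (leftGap i) with hU
  have hstep : ∀ j : Fin N, U j.castSucc ≤ U j.succ := by
    intro j
    have hμ := serviceRate_pos ha hb j
    have h1 : serviceRate a b j * δ (some j) ≤ |ν j - ν' j| := by
      have h2 : serviceRate a b j * δ (some j) =
          |min (ν j) (serviceRate a b j) - min (ν' j) (serviceRate a b j)| := by
        rw [← serviceRate_mul_busy ha hb, ← serviceRate_mul_busy ha hb, ← mul_sub, abs_mul,
          abs_of_pos hμ]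
        rfl
      rw [h2]
      exact (abs_min_sub_min_le_max _ _ _ _).trans (by simp)
    have h3 : |ν j - ν' j| ≤ b j.succ * δ (rightGap j.succ) +
        a j.castSucc * δ (leftGap j.castSucc) := by
      have h4 : ν j - ν' j = b j.succ * (load d (rightGap j.succ) - load d' (rightGap j.succ)) +
          a j.castSucc * (load d (leftGap j.castSucc) - load d' (leftGap j.castSucc)) := by
        rw [h j, h' j]
        unfold inflow
        ring
      rw [h4]
      refine (abs_add_le _ _).trans ?_
      rw [abs_mul, abs_mul, abs_of_pos (hb _), abs_of_nonneg (ha _)]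
    simp only [hU, rightGap_castSucc, leftGap_succ]
    unfold serviceRate at h1
    linarith
  have hmono : Monotone U := Fin.monotone_iff_le_succ.2 hstep
  have h0 : 0 ≤ U 0 := by
    simp only [hU, leftGap_zero, hδn, mul_zero, sub_zero]
    exact mul_nonneg (hb _).le (hδ0 _)
  have hN : U (Fin.last N) ≤ 0 := by
    simp only [hU, rightGap_last, hδn, mul_zero, zero_sub, neg_nonpos]
    exact mul_nonneg (ha _) (hδ0 _)
  have hU0 : ∀ i, U i = 0 := fun i => le_antisymm ((hmono (Fin.le_last i)).trans hN)
    (h0.trans (hmono (Fin.zero_le i)))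
  have hright : ∀ i : Fin (N + 1), δ (rightGap i) = 0 := by
    intro i
    have hl : δ (leftGap i) = 0 → δ (rightGap i) = 0 := fun h1 => by
      have h2 := hU0 i
      simp only [hU, h1, mul_zero, sub_zero] at h2
      exact (mul_eq_zero.1 h2).resolve_left (hb i).ne'
    induction i using Fin.induction with
    | zero => exact hl (by rw [leftGap_zero, hδn])
    | succ j ih =>
      refine hl ?_
      rw [leftGap_succ, ← rightGap_castSucc]
      refine ih fun h1 => ?_
      have h2 := hU0 j.castSucc
      simp only [hU, h1, mul_zero, sub_zero] at h2
      exact (mul_eq_zero.1 h2).resolve_left (hb _).ne'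
  have hdd : d = d' := by
    funext j
    have := hright j.castSucc
    rw [rightGap_castSucc] at this
    exact sub_eq_zero.1 (abs_eq_zero.1 this)
  funext j
  rw [h j, h' j, hdd]

theorem trafficSolution_nonneg {ν : Fin N → ℝ} (hν : IsTrafficSolution a b ν) (j : Fin N) :
    0 ≤ ν j := by
  obtain ⟨ν', h', h0⟩ := exists_trafficSolution ha hb
  rw [trafficSolution_unique ha hb hν h']
  exact h0 j

theorem busy_nonneg {ν : Fin N → ℝ} (hν : IsTrafficSolution a b ν) (j : Fin N) :
    0 ≤ busy a b ν j :=
  le_min (div_nonneg (trafficSolution_nonneg ha hb hν j) (serviceRate_pos ha hb j).le) zero_le_one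

/-- Holes enter at the right end and move to the left, so every gap carries traffic. -/
theorem workload_pos {ν : Fin N → ℝ} (hν : IsTrafficSolution a b ν) (j : Fin N) :
    0 < workload a b ν j := by
  have key : ∀ i : Fin (N + 1), 0 < load (busy a b ν) (rightGap i) := by
    intro i
    induction i using Fin.reverseInduction with
    | last => simp
    | cast j ih =>
      rw [rightGap_castSucc, load_some]
      refine lt_min (div_pos ?_ (serviceRate_pos ha hb j)) one_pos
      rw [(isTrafficSolution_iff ha hb ν).1 hν j]
      refine add_pos_of_pos_of_nonneg (mul_pos (hb _) ih) (mul_nonneg (ha _) ?_)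
      cases leftGap j.castSucc with
      | none => exact zero_le_one
      | some i => exact busy_nonneg ha hb hν i
  have := key j.castSucc
  rw [rightGap_castSucc, load_some] at this
  exact this.trans_le (min_le_left _ _)

omit ha in
/-- On an interval `{p, …, i}` along which the drift is constant and which has a busy gap at its
left end, the busy fractions are given by `α` and `β`. -/
theorem load_rightGap_eq {d : Fin N → ℝ} {p q : Fin (N + 1)} {v : ℝ}
    (hp : load d (leftGap p) = 1) (hv : ∀ i ∈ Finset.Icc p q, drift a b d i = v)
    {i : Fin (N + 1)} (hpi : p ≤ i) (hiq : i ≤ q) :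
    load d (rightGap i) = alpha a b (Finset.Icc p i) + beta a b (Finset.Icc p i) * v := by
  induction i using Fin.induction with
  | zero =>
    have : p = 0 := le_antisymm hpi (Fin.zero_le _)
    subst this
    have h1 := hv 0 (Finset.mem_Icc.2 ⟨le_rfl, hiq⟩)
    have h2 := (hb 0).ne'
    unfold drift at h1
    rw [hp] at h1
    have h3 : (Finset.Icc (0 : Fin (N + 1)) 0) = {0} := by simp
    simp only [alpha, beta, h3, Finset.prod_singleton, Finset.sum_singleton,
      Finset.filter_singleton, lt_self_iff_false, le_refl, if_true, if_false, Finset.prod_empty]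
    field_simp
    linarith
  | succ j ih =>
    have h1 := hv j.succ (Finset.mem_Icc.2 ⟨hpi, hiq⟩)
    have h2 := (hb j.succ).ne'
    unfold drift at h1
    rcases hpi.eq_or_lt with hpe | hlt
    · subst hpe
      rw [hp] at h1
      simp only [alpha, beta, Finset.Icc_self, Finset.prod_singleton, Finset.sum_singleton,
        Finset.filter_singleton, lt_self_iff_false, le_refl, if_true, if_false,
        Finset.prod_empty]
      field_simp
      linarith
    · have hpj : p ≤ j.castSucc := Fin.le_castSucc_iff.2 hlt
      have hjq : j.castSucc ≤ q := (Fin.castSucc_lt_succ (i := j)).le.trans hiq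
      have h3 := ih hpj hjq
      rw [rightGap_castSucc] at h3
      rw [leftGap_succ, h3] at h1
      have hins : Finset.Icc p j.succ = insert j.succ (Finset.Icc p j.castSucc) := by
        ext u
        simp only [Finset.mem_Icc, Finset.mem_insert, Fin.le_def, Fin.ext_iff, Fin.val_succ,
          Fin.val_castSucc] at hpj ⊢
        omega
      have hnot : j.succ ∉ Finset.Icc p j.castSucc := by
        simp only [Finset.mem_Icc, not_and, not_le]
        exact fun _ => Fin.castSucc_lt_succ
      have hα : alpha a b (Finset.Icc p j.succ) =
          a j.succ / b j.succ * alpha a b (Finset.Icc p j.castSucc) := by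
        unfold alpha
        rw [hins, Finset.prod_insert hnot]
      have hβ : beta a b (Finset.Icc p j.succ) =
          a j.succ / b j.succ * beta a b (Finset.Icc p j.castSucc) + 1 / b j.succ := by
        unfold beta
        rw [hins, Finset.sum_insert hnot, add_comm, Finset.mul_sum]
        congr 1
        · refine Finset.sum_congr rfl fun w hw => ?_
          have hw' : w < j.succ :=
            (Finset.mem_Icc.1 hw).2.trans_lt Fin.castSucc_lt_succ
          rw [Finset.filter_insert, if_pos hw', Finset.filter_insert, if_pos hw'.le,
            Finset.prod_insert, Finset.prod_insert, mul_div_mul_comm]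
          · exact fun h => hnot (Finset.mem_filter.1 h).1
          · exact fun h => hnot (Finset.mem_filter.1 h).1
        · have e1 : (Finset.Icc p j.castSucc).filter (fun u => j.succ < u) = ∅ := by
            refine Finset.filter_eq_empty_iff.2 fun u hu => not_lt.2 ?_
            exact (Finset.mem_Icc.1 hu).2.trans Fin.castSucc_lt_succ.le
          have e2 : (Finset.Icc p j.castSucc).filter (fun u => j.succ ≤ u) = ∅ := by
            refine Finset.filter_eq_empty_iff.2 fun u hu => not_le.2 ?_
            exact (Finset.mem_Icc.1 hu).2.trans_lt Fin.castSucc_lt_succ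
          rw [Finset.filter_insert, if_neg (lt_irrefl _), e1, Finset.filter_insert,
            if_pos le_rfl, e2]
          simp
      rw [hα, hβ]
      field_simp
      linarith

theorem beta_pos {I : Finset (Fin (N + 1))} (hI : I.Nonempty) : 0 < beta a b I := by
  have hnn : ∀ w ∈ I, 0 ≤ (∏ u ∈ I with w < u, a u) / ∏ u ∈ I with w ≤ u, b u := fun w _ =>
    div_nonneg (Finset.prod_nonneg fun u _ => ha u) (Finset.prod_nonneg fun u _ => (hb u).le)
  refine Finset.sum_pos' hnn ⟨I.max' hI, I.max'_mem hI, ?_⟩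
  have h1 : I.filter (fun u => I.max' hI < u) = ∅ :=
    Finset.filter_eq_empty_iff.2 fun u hu => not_lt.2 (I.le_max' u hu)
  rw [h1, Finset.prod_empty]
  exact div_pos one_pos (Finset.prod_pos fun u _ => hb u)

/-- The common drift along an interval with busy gaps at both ends is its intrinsic speed. -/
theorem intrinsicSpeed_eq {d : Fin N → ℝ} {p q : Fin (N + 1)} {v : ℝ} (hpq : p ≤ q)
    (hp : load d (leftGap p) = 1) (hq : load d (rightGap q) = 1)
    (hv : ∀ i ∈ Finset.Icc p q, drift a b d i = v) :
    intrinsicSpeed a b (Finset.Icc p q) = v := by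
  have h := load_rightGap_eq hb hp hv hpq le_rfl
  have hβ := beta_pos ha hb (Finset.nonempty_Icc.2 hpq)
  unfold intrinsicSpeed
  rw [hq] at h
  field_simp
  linarith

end Traffic

/-! ### The cloud partition -/

section Clouds

variable {N : ℕ} {a b : Fin (N + 1) → ℝ} {ν : Fin N → ℝ}

namespace OrderedPartition

theorem eq_of_mem {Θ : OrderedPartition N} {k l : Fin Θ.size} {i : Fin (N + 1)}
    (hk : i ∈ Θ.part k) (hl : i ∈ Θ.part l) : k = l := by
  rw [← Θ.index_eq hk, Θ.index_eq hl]

/-- Neighbouring particles are separated exactly by the gaps with `ρ_j ≥ 1`. -/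
def CutsAt (Θ : OrderedPartition N) (ρ : Fin N → ℝ) : Prop :=
  ∀ j : Fin N, ∀ k, j.castSucc ∈ Θ.part k → (j.succ ∈ Θ.part k ↔ ρ j < 1)

theorem mem_nonSingletons_of_mem_inner {Θ : OrderedPartition N} {k : Fin Θ.size} {j : Fin N}
    (h : j ∈ inner (Θ.part k)) : k ∈ Θ.nonSingletons := by
  simp only [inner, Finset.mem_filter, Finset.mem_univ, true_and] at h
  simp only [nonSingletons, Finset.mem_filter, Finset.mem_univ, true_and]
  exact Finset.one_lt_card.2 ⟨_, h.1, _, h.2, (Fin.castSucc_lt_succ (i := j)).ne⟩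

theorem isGreatest_castSucc {Θ : OrderedPartition N} {k : Fin Θ.size} {j : Fin N}
    (h : j.castSucc ∈ Θ.part k) (h' : j.succ ∉ Θ.part k) :
    IsGreatest (Θ.part k : Set (Fin (N + 1))) j.castSucc := by
  obtain ⟨p, q, hpq, hk⟩ := Θ.interval k
  refine ⟨h, fun i hi => ?_⟩
  rw [hk] at h h'
  rw [Finset.mem_coe, hk] at hi
  rw [Finset.mem_Icc] at h h' hi
  by_contra hlt
  rw [not_le] at hlt
  exact h' ⟨h.1.trans (Fin.castSucc_lt_succ (i := j)).le,
    (Fin.castSucc_lt_iff_succ_le.1 hlt).trans hi.2⟩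

theorem _root_.ExclusionClouds.IsCloudPartition.cutsAt {Θ : OrderedPartition N}
    (h : IsCloudPartition a b ν Θ) : Θ.CutsAt (workload a b ν) := by
  intro j k hk
  constructor
  · intro hk'
    have hj : j ∈ inner (Θ.part k) := by simp [inner, hk, hk']
    exact (h.inside k (mem_nonSingletons_of_mem_inner hj) j hj).2.2
  · intro hlt
    by_contra hk'
    exact absurd (h.boundary k j (isGreatest_castSucc hk hk')) (not_le.2 hlt)

section CutsAt

variable {Θ : OrderedPartition N} (hΘ : Θ.CutsAt (workload a b ν))

include hΘ

theorem CutsAt.load_leftGap {k : Fin Θ.size} {p q : Fin (N + 1)} (hpq : p ≤ q)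
    (hk : Θ.part k = Finset.Icc p q) : load (busy a b ν) (leftGap p) = 1 := by
  induction p using Fin.cases with
  | zero => simp
  | succ j =>
    rw [leftGap_succ, load_some]
    refine min_eq_right (not_lt.1 fun hlt => ?_)
    have h1 := (hΘ j _ (Θ.mem_part_index j.castSucc)).2 hlt
    have h2 : j.succ ∈ Θ.part k := by rw [hk]; exact Finset.mem_Icc.2 ⟨le_rfl, hpq⟩
    have h3 : j.castSucc ∈ Θ.part k := by
      rw [eq_of_mem h2 h1]
      exact Θ.mem_part_index _
    rw [hk, Finset.mem_Icc] at h3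
    exact absurd h3.1 (not_le.2 Fin.castSucc_lt_succ)

theorem CutsAt.load_rightGap {k : Fin Θ.size} {p q : Fin (N + 1)} (hpq : p ≤ q)
    (hk : Θ.part k = Finset.Icc p q) : load (busy a b ν) (rightGap q) = 1 := by
  induction q using Fin.lastCases with
  | last => simp
  | cast j =>
    rw [rightGap_castSucc, load_some]
    refine min_eq_right (not_lt.1 fun hlt => ?_)
    have h2 : j.castSucc ∈ Θ.part k := by rw [hk]; exact Finset.mem_Icc.2 ⟨hpq, le_rfl⟩
    have h3 := (hΘ j k h2).2 hlt
    rw [hk, Finset.mem_Icc] at h3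
    exact absurd h3.2 (not_le.2 Fin.castSucc_lt_succ)

variable (ha : ∀ i, 0 ≤ a i) (hb : ∀ i, 0 < b i) (hν : IsTrafficSolution a b ν)

include ha hb hν

theorem CutsAt.drift_eq {k : Fin Θ.size} {p q : Fin (N + 1)}
    (hk : Θ.part k = Finset.Icc p q) {i : Fin (N + 1)} (hi : i ∈ Finset.Icc p q) :
    drift a b (busy a b ν) i = drift a b (busy a b ν) p := by
  rw [Finset.mem_Icc] at hi
  induction i using Fin.induction with
  | zero => rw [le_antisymm hi.1 (Fin.zero_le _)]
  | succ j ih =>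
    rcases hi.1.eq_or_lt with hpe | hlt
    · rw [hpe]
    · have h1 : j.castSucc ∈ Finset.Icc p q := Finset.mem_Icc.2
        ⟨Fin.le_castSucc_iff.2 hlt, (Fin.castSucc_lt_succ (i := j)).le.trans hi.2⟩
      have h2 : workload a b ν j < 1 := by
        refine (hΘ j k (by rw [hk]; exact h1)).1 ?_
        rw [hk]
        exact Finset.mem_Icc.2 hi
      have h3 := drift_busy_succ_sub ha hb hν j
      rw [max_eq_right (by linarith), zero_mul, ih (Finset.mem_Icc.1 h1)] at h3
      linarith

theorem CutsAt.intrinsicSpeed_part {k : Fin Θ.size} {i : Fin (N + 1)} (hi : i ∈ Θ.part k) :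
    intrinsicSpeed a b (Θ.part k) = drift a b (busy a b ν) i := by
  obtain ⟨p, q, hpq, hk⟩ := Θ.interval k
  rw [hk] at hi ⊢
  refine intrinsicSpeed_eq ha hb hpq (hΘ.load_leftGap hpq hk) (hΘ.load_rightGap hpq hk)
    fun i' hi' => ?_
  rw [hΘ.drift_eq ha hb hν hk hi', hΘ.drift_eq ha hb hν hk hi]

theorem CutsAt.speed_eq (i : Fin (N + 1)) : Θ.speed a b i = drift a b (busy a b ν) i :=
  hΘ.intrinsicSpeed_part ha hb hν (Θ.mem_part_index i)

theorem CutsAt.workload_eq {k : Fin Θ.size} {j : Fin N} (hj : j ∈ inner (Θ.part k)) :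
    workload a b ν j = intrinsicLoad a b (Θ.part k) j ∧ workload a b ν j < 1 := by
  simp only [inner, Finset.mem_filter, Finset.mem_univ, true_and] at hj
  have hlt := (hΘ j k hj.1).1 hj.2
  refine ⟨?_, hlt⟩
  obtain ⟨p, q, hpq, hk⟩ := Θ.interval k
  have hpj := Finset.mem_Icc.1 (hk ▸ hj.1)
  have h1 := load_rightGap_eq hb (hΘ.load_leftGap hpq hk)
    (fun i hi => (hΘ.intrinsicSpeed_part ha hb hν (i := i) (by rw [hk]; exact hi)).symm)
    hpj.1 hpj.2
  rw [rightGap_castSucc, load_some] at h1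
  have h2 : busy a b ν j = workload a b ν j := min_eq_left hlt.le
  have h3 : (Θ.part k).filter (fun u => u ≤ j.castSucc) = Finset.Icc p j.castSucc := by
    rw [hk]
    ext u
    simp only [Finset.mem_filter, Finset.mem_Icc]
    exact ⟨fun h => ⟨h.1.1, h.2⟩, fun h => ⟨⟨h.1, h.2.trans hpj.2⟩, h.2⟩⟩
  rw [← h2, h1]
  unfold intrinsicLoad
  rw [h3]

theorem CutsAt.isCloudPartition : IsCloudPartition a b ν Θ where
  inside k _ j hj := ⟨(hΘ.workload_eq ha hb hν hj).1,
    workload_pos ha hb hν j, (hΘ.workload_eq ha hb hν hj).2⟩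
  boundary k j hj := by
    refine not_lt.1 fun hlt => ?_
    exact absurd (hj.2 ((hΘ j k hj.1).2 hlt)) (not_le.2 Fin.castSucc_lt_succ)

end CutsAt

/-- The number of separating gaps to the left of particle `i`. -/
def cuts (ρ : Fin N → ℝ) (i : Fin (N + 1)) : ℕ :=
  (Finset.univ.filter fun j : Fin N => j.castSucc < i ∧ 1 ≤ ρ j).card

theorem cuts_zero (ρ : Fin N → ℝ) : cuts ρ 0 = 0 := by
  simp [cuts]

theorem cuts_succ (ρ : Fin N → ℝ) (j : Fin N) :
    cuts ρ j.succ = cuts ρ j.castSucc + if 1 ≤ ρ j then 1 else 0 := by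
  have key : ∀ i : Fin N, (i.castSucc < j.succ ↔ i.castSucc < j.castSucc ∨ i = j) := by
    intro i
    simp only [Fin.lt_def, Fin.ext_iff, Fin.val_succ, Fin.val_castSucc]
    omega
  unfold cuts
  split_ifs with h
  · rw [← Finset.card_insert_of_notMem (a := j)]
    · congr 1
      ext i
      simp only [Finset.mem_filter, Finset.mem_univ, true_and, Finset.mem_insert, key]
      constructor
      · tauto
      · rintro (rfl | h')
        · exact ⟨Or.inr rfl, h⟩
        · exact ⟨Or.inl h'.1, h'.2⟩
    · simp
  · rw [add_zero]
    congr 1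
    ext i
    simp only [Finset.mem_filter, Finset.mem_univ, true_and, key]
    constructor
    · rintro ⟨h1 | rfl, h2⟩
      · exact ⟨h1, h2⟩
      · exact absurd h2 h
    · exact fun h' => ⟨Or.inl h'.1, h'.2⟩

theorem cuts_monotone (ρ : Fin N → ℝ) : Monotone (cuts ρ) := by
  refine Fin.monotone_iff_le_succ.2 fun j => ?_
  rw [cuts_succ]
  exact Nat.le_add_right _ _

theorem exists_cuts_eq (ρ : Fin N → ℝ) (i : Fin (N + 1)) {c : ℕ} (hc : c ≤ cuts ρ i) :
    ∃ i', cuts ρ i' = c := by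
  induction i using Fin.induction with
  | zero =>
    rw [cuts_zero] at hc
    exact ⟨0, by rw [cuts_zero]; omega⟩
  | succ j ih =>
    by_cases h : c ≤ cuts ρ j.castSucc
    · exact ih h
    · refine ⟨j.succ, ?_⟩
      rw [cuts_succ] at hc ⊢
      split_ifs at hc ⊢ <;> omega

/-- The partition of the particles along the gaps with `ρ_j ≥ 1`. -/
def ofCuts (ρ : Fin N → ℝ) : OrderedPartition N where
  size := cuts ρ (Fin.last N) + 1
  part k := Finset.univ.filter fun i => cuts ρ i = k
  interval k := by
    have hne : (Finset.univ.filter fun i => cuts ρ i = k).Nonempty := by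
      obtain ⟨i, hi⟩ := exists_cuts_eq ρ (Fin.last N) (c := k) (by omega)
      exact ⟨i, by simpa using hi⟩
    refine ⟨Finset.min' _ hne, Finset.max' _ hne, Finset.min'_le_max' _ hne, ?_⟩
    ext i
    constructor
    · exact fun hi => Finset.mem_Icc.2 ⟨Finset.min'_le _ _ hi, Finset.le_max' _ _ hi⟩
    · intro hi
      rw [Finset.mem_Icc] at hi
      have h1 := (Finset.mem_filter.1 (Finset.min'_mem _ hne)).2
      have h2 := (Finset.mem_filter.1 (Finset.max'_mem _ hne)).2
      have h3 := cuts_monotone ρ hi.1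
      have h4 := cuts_monotone ρ hi.2
      simp only [Finset.mem_filter, Finset.mem_univ, true_and]
      omega
  disjoint k l hkl := by
    refine Finset.disjoint_left.2 fun i hi hi' => hkl (Fin.ext ?_)
    rw [← (Finset.mem_filter.1 hi).2, ← (Finset.mem_filter.1 hi').2]
  cover i := ⟨⟨cuts ρ i, Nat.lt_succ_of_le (cuts_monotone ρ (Fin.le_last i))⟩, by simp⟩
  ordered k l hkl i hi j hj := by
    by_contra hij
    have h1 := cuts_monotone ρ (not_lt.1 hij)
    rw [(Finset.mem_filter.1 hi).2, (Finset.mem_filter.1 hj).2] at h1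
    exact absurd hkl (not_lt.2 h1)

theorem cutsAt_ofCuts (ρ : Fin N → ℝ) : (ofCuts ρ).CutsAt ρ := by
  intro j k hk
  simp only [ofCuts, Finset.mem_filter, Finset.mem_univ, true_and] at hk ⊢
  rw [cuts_succ, hk]
  split_ifs with h
  · exact ⟨fun h' => by omega, fun h' => absurd h (not_le.2 h')⟩
  · exact ⟨fun _ => not_le.1 h, fun _ => by omega⟩

theorem CutsAt.mem_part_iff {Θ : OrderedPartition N} {ρ : Fin N → ℝ} (hΘ : Θ.CutsAt ρ)
    (i : Fin (N + 1)) (k : Fin Θ.size) : i ∈ Θ.part k ↔ cuts ρ i = k := by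
  have hindex : ∀ i, cuts ρ i = Θ.index i := by
    intro i
    induction i using Fin.induction with
    | zero =>
      rw [cuts_zero]
      by_contra hne
      have hpos : (⟨0, by have := (Θ.index 0).2; omega⟩ : Fin Θ.size) < Θ.index 0 := by
        rw [Fin.lt_def]
        exact Nat.pos_of_ne_zero (Ne.symm hne)
      obtain ⟨i, hi⟩ := Θ.nonempty ⟨0, by have := (Θ.index 0).2; omega⟩
      exact absurd (Θ.ordered _ _ hpos i hi 0 (Θ.mem_part_index 0)) (Fin.not_lt_zero i)
    | succ j ih =>
      rw [cuts_succ, ih]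
      have h1 := hΘ j _ (Θ.mem_part_index j.castSucc)
      split_ifs with h
      · have h2 : j.succ ∉ Θ.part (Θ.index j.castSucc) := fun h' =>
          absurd (h1.1 h') (not_lt.2 h)
        have hlt : Θ.index j.castSucc < Θ.index j.succ := by
          rcases lt_trichotomy (Θ.index j.castSucc) (Θ.index j.succ) with h3 | h3 | h3
          · exact h3
          · rw [h3] at h2
            exact absurd (Θ.mem_part_index j.succ) h2
          · exact absurd (Θ.ordered _ _ h3 _ (Θ.mem_part_index _) _ (Θ.mem_part_index _))
              (not_lt.2 (Fin.castSucc_lt_succ (i := j)).le)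
        by_contra hne
        rw [Fin.lt_def] at hlt
        -- a part strictly between two neighbouring particles would be empty
        obtain ⟨i, hi⟩ := Θ.nonempty
          ⟨(Θ.index j.castSucc : ℕ) + 1, by have := (Θ.index j.succ).2; omega⟩
        have h4 := Θ.ordered (Θ.index j.castSucc) _ (by rw [Fin.lt_def]; exact Nat.lt_succ_self _)
          _ (Θ.mem_part_index _) i hi
        have h5 := Θ.ordered _ (Θ.index j.succ) (by rw [Fin.lt_def]; simp only; omega) i hi _
          (Θ.mem_part_index _)
        simp only [Fin.lt_def, Fin.val_castSucc, Fin.val_succ] at h4 h5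
        omega
      · rw [add_zero, Θ.index_eq (h1.2 (not_le.1 h))]
  rw [hindex i]
  constructor
  · intro h
    rw [Θ.index_eq h]
  · intro h
    rw [← Fin.ext h]
    exact Θ.mem_part_index i

theorem CutsAt.size_eq {Θ : OrderedPartition N} {ρ : Fin N → ℝ} (hΘ : Θ.CutsAt ρ) :
    Θ.size = cuts ρ (Fin.last N) + 1 := by
  have h1 := (hΘ.mem_part_iff _ _).1 (Θ.mem_part_index (Fin.last N))
  have h2 := (Θ.index (Fin.last N)).2
  obtain ⟨i, hi⟩ := Θ.nonempty ⟨Θ.size - 1, by omega⟩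
  have h3 := (hΘ.mem_part_iff _ _).1 hi
  have h4 := cuts_monotone ρ (Fin.le_last i)
  simp only at h3
  omega

theorem CutsAt.unique {Θ Θ' : OrderedPartition N} {ρ : Fin N → ℝ} (hΘ : Θ.CutsAt ρ)
    (hΘ' : Θ'.CutsAt ρ) : Θ = Θ' := by
  have hsize : Θ.size = Θ'.size := hΘ.size_eq.trans hΘ'.size_eq.symm
  have hpart : ∀ k : Fin Θ.size, Θ.part k = Θ'.part (Fin.cast hsize k) := by
    intro k
    ext i
    rw [hΘ.mem_part_iff, hΘ'.mem_part_iff, Fin.val_cast]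
  obtain ⟨n, part, h1, h2, h3, h4⟩ := Θ
  obtain ⟨n', part', h1', h2', h3', h4'⟩ := Θ'
  simp only at hsize
  subst hsize
  have : part = part' := funext hpart
  subst this
  rfl

end OrderedPartition

theorem existsUnique_cloudPartition (ha : ∀ i, 0 ≤ a i) (hb : ∀ i, 0 < b i)
    (hν : IsTrafficSolution a b ν) : ∃! Θ : OrderedPartition N, IsCloudPartition a b ν Θ :=
  ⟨OrderedPartition.ofCuts (workload a b ν),
    (OrderedPartition.cutsAt_ofCuts _).isCloudPartition ha hb hν,
    fun _ h => h.cutsAt.unique (OrderedPartition.cutsAt_ofCuts _)⟩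

end Clouds

/-! ### Convergence of finitely additive contents -/

section Content

variable {α : Type*}

/-- A finitely additive probability on all subsets of `α`. -/
structure IsContent (Φ : Set α → ℝ) : Prop where
  nonneg : ∀ A, 0 ≤ Φ A
  union : ∀ A B, Disjoint A B → Φ (A ∪ B) = Φ A + Φ B
  univ : Φ Set.univ = 1

namespace IsContent

variable {Φ : Set α → ℝ} (h : IsContent Φ)

include h

theorem empty : Φ ∅ = 0 := by
  have := h.union ∅ ∅ (by simp)
  rw [Set.union_empty] at this
  linarith

theorem mono {A B : Set α} (hAB : A ⊆ B) : Φ A ≤ Φ B := by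
  have := h.union A (B \ A) Set.disjoint_sdiff_right
  rw [Set.union_sdiff_cancel hAB] at this
  linarith [h.nonneg (B \ A)]

theorem diff {A B : Set α} (hAB : A ⊆ B) : Φ (B \ A) = Φ B - Φ A := by
  have := h.union A (B \ A) Set.disjoint_sdiff_right
  rw [Set.union_sdiff_cancel hAB] at this
  linarith

theorem compl (A : Set α) : Φ Aᶜ = 1 - Φ A := by
  rw [Set.compl_eq_univ_sdiff, h.diff (Set.subset_univ A), h.univ]

theorem finset (F : Finset α) : Φ F = ∑ z ∈ F, Φ {z} := by
  classical
  induction F using Finset.induction_on with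
  | empty => simpa using h.empty
  | insert z F hz ih =>
    rw [Finset.sum_insert hz, ← ih, Finset.coe_insert, Set.insert_eq, h.union]
    simpa using hz

end IsContent

theorem isContent_measureReal [MeasurableSpace α] [DiscreteMeasurableSpace α] (π : Measure α)
    [IsProbabilityMeasure π] : IsContent fun A => π.real A where
  nonneg _ := measureReal_nonneg
  union _ _ h := measureReal_union h MeasurableSet.of_discrete
  univ := probReal_univ

variable [MeasurableSpace α] [DiscreteMeasurableSpace α] [Countable α] {π : Measure α}
  [IsProbabilityMeasure π] {T : Type*} {l : Filter T} {Φ : T → Set α → ℝ}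

theorem hasSum_measureReal_singleton (A : Set α) :
    HasSum (fun z : A => π.real {(z : α)}) (π.real A) := by
  have h1 : ∑' z : A, π {(z : α)} = π A := by
    rw [← measure_iUnion₀]
    · congr 1
      ext z
      simp
    · intro z w hzw
      refine (Set.disjoint_singleton.2 fun h => hzw (Subtype.ext h)).aedisjoint
    · exact fun z => MeasurableSet.of_discrete.nullMeasurableSet
  have h2 := ENNReal.hasSum_toReal (f := fun z : A => π {(z : α)})
    (by rw [h1]; exact measure_ne_top _ _)
  rw [← ENNReal.tsum_toReal_eq fun z => measure_ne_top _ _, h1] at h2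
  exact h2

theorem exists_finset_measureReal_gt (A : Set α) {c : ℝ} (hc : c < π.real A) :
    ∃ F : Finset α, (F : Set α) ⊆ A ∧ c < π.real F := by
  classical
  obtain ⟨F, hF⟩ := ((tendsto_order.1 (hasSum_measureReal_singleton (π := π) A)).1 c hc).exists
  refine ⟨F.map (Function.Embedding.subtype _), ?_, ?_⟩
  · intro z hz
    simp only [Finset.coe_map, Function.Embedding.subtype_apply, Set.mem_image] at hz
    obtain ⟨w, _, rfl⟩ := hz
    exact w.2
  · rw [(isContent_measureReal π).finset, Finset.sum_map]
    exact hF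

/-- If no mass is lost in the limit, convergence at every point implies convergence on every
set. -/
theorem tendsto_content_of_singleton (hΦ : ∀ᶠ t in l, IsContent (Φ t))
    (h : ∀ z, Tendsto (fun t => Φ t {z}) l (𝓝 (π.real {z}))) (A : Set α) :
    Tendsto (fun t => Φ t A) l (𝓝 (π.real A)) := by
  have hlow : ∀ A : Set α, ∀ c < π.real A, ∀ᶠ t in l, c < Φ t A := by
    intro A c hc
    obtain ⟨F, hFA, hF⟩ := exists_finset_measureReal_gt A hc
    have h1 : Tendsto (fun t => Φ t F) l (𝓝 (π.real F)) := by
      rw [(isContent_measureReal π).finset]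
      refine (tendsto_finsetSum _ fun z _ => h z).congr' ?_
      filter_upwards [hΦ] with t ht
      rw [ht.finset]
    filter_upwards [(tendsto_order.1 h1).1 c hF, hΦ] with t ht hΦt
    exact ht.trans_le (hΦt.mono hFA)
  refine tendsto_order.2 ⟨hlow A, fun c hc => ?_⟩
  have h2 : 1 - c < π.real Aᶜ := by
    rw [(isContent_measureReal π).compl]
    linarith
  filter_upwards [hlow Aᶜ _ h2, hΦ] with t ht hΦt
  rw [hΦt.compl] at ht
  linarith

/-- Increasing sets of the form `Ici z` and `Ioi z` determine the mass of every point. -/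
theorem tendsto_content_of_Ici_of_Ioi [PartialOrder α] (hΦ : ∀ᶠ t in l, IsContent (Φ t))
    (hIci : ∀ z, Tendsto (fun t => Φ t (Set.Ici z)) l (𝓝 (π.real (Set.Ici z))))
    (hIoi : ∀ z, Tendsto (fun t => Φ t (Set.Ioi z)) l (𝓝 (π.real (Set.Ioi z)))) (A : Set α) :
    Tendsto (fun t => Φ t A) l (𝓝 (π.real A)) := by
  refine tendsto_content_of_singleton hΦ (fun z => ?_) A
  have h1 : ({z} : Set α) = Set.Ici z \ Set.Ioi z := by
    ext w
    simp only [Set.mem_singleton_iff, Set.mem_sdiff, Set.mem_Ici, Set.mem_Ioi]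
    constructor
    · rintro rfl
      exact ⟨le_rfl, lt_irrefl _⟩
    · rintro ⟨h1, h2⟩
      exact (h1.eq_of_not_lt h2).symm
  have h2 : Set.Ioi z ⊆ Set.Ici z := Set.Ioi_subset_Ici_self
  have h3 := (hIci z).sub (hIoi z)
  rw [← (isContent_measureReal π).diff h2, ← h1] at h3
  refine h3.congr' ?_
  filter_upwards [hΦ] with t ht
  rw [← ht.diff h2, ← h1]

theorem tendsto_content_of_isUpperSet [PartialOrder α] (hΦ : ∀ᶠ t in l, IsContent (Φ t))
    (h : ∀ U, IsUpperSet U → Tendsto (fun t => Φ t U) l (𝓝 (π.real U))) (A : Set α) :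
    Tendsto (fun t => Φ t A) l (𝓝 (π.real A)) :=
  tendsto_content_of_Ici_of_Ioi hΦ (fun z => h _ (isUpperSet_Ici z))
    (fun z => h _ (isUpperSet_Ioi z)) A

end Content

/-! ### Thinned and collapsed networks -/

section Sandwich

variable {ι M : Type*} [DecidableEq ι] [Fintype ι] [Fintype M]

/-- The indicator function of a set. -/
abbrev ind {α : Type*} (A : Set α) : α → ℝ := A.indicator fun _ => 1

theorem monotone_ind {α : Type*} [Preorder α] {U : Set α} (hU : IsUpperSet U) :
    Monotone (ind U) := by
  intro x y hxy
  by_cases hx : x ∈ U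
  · rw [ind, Set.indicator_of_mem hx, Set.indicator_of_mem (hU hxy hx)]
  · rw [ind, Set.indicator_of_notMem hx]
    exact Set.indicator_nonneg (fun _ _ => zero_le_one) _

theorem ind_nonneg {α : Type*} (A : Set α) (x : α) : 0 ≤ ind A x :=
  Set.indicator_nonneg (fun _ _ => zero_le_one) _

theorem ind_le_one {α : Type*} (A : Set α) (x : α) : ind A x ≤ 1 :=
  Set.indicator_le' (fun _ _ => le_rfl) (fun _ _ => zero_le_one) _

theorem abs_ind_le {α : Type*} (A : Set α) (x : α) : |ind A x| ≤ 1 := by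
  rw [abs_of_nonneg (ind_nonneg A x)]
  exact ind_le_one A x

theorem integral_ind {α : Type*} [MeasurableSpace α] [DiscreteMeasurableSpace α] (π : Measure α)
    (A : Set α) : ∫ x, ind A x ∂π = π.real A := by
  rw [ind, integral_indicator MeasurableSet.of_discrete]
  simp

namespace Network

theorem isContent_iterate_kernel {Q : Network ι M} {Λ : ℝ} (h : Q.Admissible Λ) {α : Type*}
    (p : (ι → ℕ) → α) (n : ℕ) (x : ι → ℕ) :
    IsContent fun A : Set α => (Q.kernel Λ)^[n] (ind (p ⁻¹' A)) x where
  nonneg A := by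
    have := iterate_kernel_mono h (f := fun _ => (0 : ℝ)) (g := ind (p ⁻¹' A))
      (fun y => ind_nonneg _ y) n x
    rwa [iterate_kernel_const] at this
  union A B hAB := by
    have : ind (p ⁻¹' (A ∪ B)) = ind (p ⁻¹' A) + ind (p ⁻¹' B) := by
      rw [Set.preimage_union]
      exact Set.indicator_union_of_disjoint (hAB.preimage p) _
    rw [this, iterate_kernel_add]
    rfl
  univ := by
    have : ind (p ⁻¹' Set.univ) = fun _ => (1 : ℝ) := by
      ext; simp [ind]
    rw [this, iterate_kernel_const]

/-- The network in which arrivals from outside are thinned by the factor `t`, and a customer at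
node `i` is additionally removed at rate `κ i`. -/
def thin (Q : Network ι M) (t : ℝ) (ht : 0 ≤ t) (κ : ι → ℝ) (hκ : ∀ i, 0 ≤ κ i) :
    Network ι (M ⊕ ι) where
  src := Sum.elim Q.src some
  dst := Sum.elim Q.dst fun _ => none
  rate := Sum.elim (fun m => if Q.src m = none then t * Q.rate m else Q.rate m) κ
  rate_nonneg := by
    rintro (m | i)
    · simp only [Sum.elim_inl]
      split_ifs
      · exact mul_nonneg ht (Q.rate_nonneg m)
      · exact Q.rate_nonneg m
    · exact hκ i

section Thin

variable {Q : Network ι M} {t : ℝ} {ht : 0 ≤ t} {κ : ι → ℝ} {hκ : ∀ i, 0 ≤ κ i} {Λ : ℝ}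

theorem admissible_thin (ht1 : t ≤ 1) (hΛ : 0 < Λ) (h : ∑ m, Q.rate m + ∑ i, κ i ≤ Λ) :
    (Q.thin t ht κ hκ).Admissible Λ := by
  refine ⟨hΛ, le_trans ?_ h⟩
  rw [Fintype.sum_sum_type]
  refine add_le_add (Finset.sum_le_sum fun m _ => ?_) le_rfl
  simp only [thin, Sum.elim_inl]
  split_ifs
  · exact mul_le_of_le_one_left (Q.rate_nonneg m) ht1
  · exact le_rfl

/-- Thinned arrivals and additional departures decrease the network. -/
theorem gen_thin_le (ht1 : t ≤ 1) {f : (ι → ℕ) → ℝ} (hf : Monotone f) (x : ι → ℕ) :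
    (Q.thin t ht κ hκ).gen f x ≤ Q.gen f x := by
  unfold gen
  rw [Fintype.sum_sum_type]
  have h1 : ∑ i, (Q.thin t ht κ hκ).rate (Sum.inr i) *
      (f (transfer ((Q.thin t ht κ hκ).src (Sum.inr i)) ((Q.thin t ht κ hκ).dst (Sum.inr i)) x)
        - f x) ≤ 0 := by
    refine Finset.sum_nonpos fun i _ => mul_nonpos_of_nonneg_of_nonpos (hκ i) ?_
    exact sub_nonpos.2 (hf (transfer_to_none_le _ _))
  refine (add_le_of_nonpos_right h1).trans (Finset.sum_le_sum fun m _ => ?_)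
  simp only [thin, Sum.elim_inl]
  split_ifs with hs
  · rw [mul_assoc]
    refine mul_le_of_le_one_left (mul_nonneg (Q.rate_nonneg m) (sub_nonneg.2 (hf ?_))) ht1
    rw [hs]
    exact le_transfer_none _ _
  · exact le_rfl

theorem drains_thin (hd : Q.Drains) : (Q.thin t ht κ hκ).Drains := by
  obtain ⟨rank, hrank⟩ := hd
  refine ⟨rank, fun i => ?_⟩
  obtain ⟨m, hm, hs, hdst⟩ := hrank i
  refine ⟨Sum.inl m, ?_, hs, hdst⟩
  simp only [thin, Sum.elim_inl, hs]
  simpa using hm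

/-- Additional departures turn an unbalanced network with busy fractions `d` into a balanced one;
thinning by `t` then multiplies all loads by `t`. -/
theorem balanced_thin {d : ι → ℝ}
    (h : ∀ j, ∑ m, (if Q.src m = some j then Q.rate m * load d (Q.src m) else 0) + κ j * d j =
      ∑ m, (if Q.dst m = some j then Q.rate m * load d (Q.src m) else 0)) :
    (Q.thin t ht κ hκ).Balanced fun j => t * d j := by
  have hload : ∀ m, (if Q.src m = none then t * Q.rate m else Q.rate m) *
      load (fun j => t * d j) (Q.src m) = t * (Q.rate m * load d (Q.src m)) := by
    intro m
    cases hs : Q.src m with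
    | none => simp
    | some i => simp only [reduceCtorEq, if_false, load_some]; ring
  intro j
  simp only [Fintype.sum_sum_type, thin, Sum.elim_inl, Sum.elim_inr, hload, Option.some.injEq,
    load_some, Finset.sum_ite_eq', Finset.mem_univ, if_true, reduceCtorEq, if_false,
    Finset.sum_const_zero, add_zero]
  have h1 := congrArg (fun y => t * y) (h j)
  simp only [mul_add, Finset.mul_sum, mul_ite, mul_zero] at h1
  rw [← h1]
  ring

end Thin

variable {ι' : Type*} [DecidableEq ι'] [Fintype ι']

open scoped Classical in
/-- Left inverse of an embedding of nodes; the nodes outside the range become part of the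
outside. -/
def retract (e : ι' → ι) (s : Option ι) : Option ι' :=
  if h : ∃ i, s = some (e i) then some h.choose else none

theorem retract_eq_some {e : ι' → ι} (he : Function.Injective e) {s : Option ι} {i : ι'} :
    retract e s = some i ↔ s = some (e i) := by
  unfold retract
  split_ifs with h
  · rw [Option.some.injEq]
    constructor
    · rintro rfl
      exact h.choose_spec
    · intro h'
      exact he (Option.some.inj (h.choose_spec.symm.trans h'))
  · simp only [false_iff]
    exact fun h' => h ⟨i, h'⟩

/-- The network on the nodes in the range of `e` in which all other nodes are saturated. -/
def collapse (Q : Network ι M) (e : ι' → ι) : Network ι' M where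
  src m := retract e (Q.src m)
  dst m := retract e (Q.dst m)
  rate := Q.rate
  rate_nonneg := Q.rate_nonneg

section Collapse

variable {Q : Network ι M} {e : ι' → ι} (he : Function.Injective e) {Λ : ℝ}

theorem admissible_collapse (h : Q.Admissible Λ) : (Q.collapse e).Admissible Λ := h

include he

theorem inc_comp (s : Option ι) (x : ι → ℕ) : inc s x ∘ e = inc (retract e s) (x ∘ e) := by
  ext i
  simp only [Function.comp, inc_apply, retract_eq_some he]

theorem dec_comp (s : Option ι) (x : ι → ℕ) : dec s x ∘ e = dec (retract e s) (x ∘ e) := by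
  ext i
  simp only [Function.comp, dec_apply, retract_eq_some he]

theorem transfer_comp_le (s d : Option ι) (x : ι → ℕ) :
    transfer s d x ∘ e ≤ transfer (retract e s) (retract e d) (x ∘ e) := by
  cases hs : retract e s with
  | none =>
    rw [transfer_of_avail (avail_none _), dec_none, ← inc_comp he]
    exact fun i => transfer_le_inc s d x (e i)
  | some i =>
    have hs' := (retract_eq_some he).1 hs
    by_cases hx : Avail s x
    · have hx' : Avail (some i) (x ∘ e) := by
        rw [hs', avail_some] at hx
        rwa [avail_some]
      rw [transfer_of_avail hx, transfer_of_avail hx', inc_comp he, dec_comp he, hs]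
    · have hx' : ¬ Avail (some i) (x ∘ e) := by
        rw [hs', avail_some] at hx
        rwa [avail_some]
      rw [transfer_of_not_avail hx, transfer_of_not_avail hx']

/-- Saturating some of the nodes increases the others. -/
theorem gen_comp_le_collapse {f : (ι' → ℕ) → ℝ} (hf : Monotone f) (x : ι → ℕ) :
    Q.gen (f ∘ fun x => x ∘ e) x ≤ (Q.collapse e).gen f (x ∘ e) := by
  unfold gen
  refine Finset.sum_le_sum fun m _ => mul_le_mul_of_nonneg_left ?_ (Q.rate_nonneg m)
  exact sub_le_sub_right (hf (transfer_comp_le he _ _ _)) _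

theorem drains_collapse (hd : Q.Drains) : (Q.collapse e).Drains := by
  obtain ⟨rank, hrank⟩ := hd
  refine ⟨fun i => rank (e i), fun i => ?_⟩
  obtain ⟨m, hm, hs, hdst⟩ := hrank (e i)
  refine ⟨m, hm, ?_, fun j hj => hdst _ ?_⟩
  · rw [collapse, retract_eq_some he, hs]
  · rwa [collapse, retract_eq_some he] at hj

/-- Collapsing nodes that are always busy does not change the loads. -/
theorem load_retract {d : ι → ℝ} (hd : ∀ j, j ∉ Set.range e → d j = 1) (s : Option ι) :
    load (d ∘ e) (retract e s) = load d s := by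
  cases hs : retract e s with
  | some i => rw [(retract_eq_some he).1 hs]; rfl
  | none =>
    cases s with
    | none => rfl
    | some j =>
      rw [load_none, load_some, hd j]
      rintro ⟨i, rfl⟩
      rw [(retract_eq_some he).2 rfl] at hs
      exact absurd hs (by simp)

theorem balanced_collapse {d : ι → ℝ} (hd : ∀ j, j ∉ Set.range e → d j = 1)
    (h : ∀ j ∈ Set.range e,
      ∑ m, (if Q.src m = some j then Q.rate m * load d (Q.src m) else 0) =
        ∑ m, (if Q.dst m = some j then Q.rate m * load d (Q.src m) else 0)) :
    (Q.collapse e).Balanced (d ∘ e) := by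
  intro j
  have h1 := h (e j) ⟨j, rfl⟩
  simpa only [collapse, retract_eq_some he, load_retract he hd] using h1

end Collapse

end Network

theorem map_comp_prodLaw {ι' : Type*} [DecidableEq ι'] [Fintype ι'] {e : ι' → ι}
    (he : Function.Injective e) (ρ : ι → ℝ) :
    (prodLaw ρ).map (fun x => x ∘ e) = prodLaw (ρ ∘ e) := by
  refine Measure.ext_of_singleton fun z => ?_
  rw [Measure.map_apply Measurable.of_discrete MeasurableSet.of_discrete]
  classical
  have h1 : (fun x : ι → ℕ => x ∘ e) ⁻¹' {z} =
      Set.univ.pi fun j => if h : ∃ i, e i = j then {z h.choose} else Set.univ := by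
    ext x
    simp only [Set.mem_preimage, Set.mem_singleton_iff, Set.mem_univ_pi]
    constructor
    · rintro rfl j
      split_ifs with h
      · simp [h.choose_spec]
      · trivial
    · intro h
      ext i
      have h2 := h (e i)
      have h3 : ∃ i', e i' = e i := ⟨i, rfl⟩
      rw [dif_pos h3, he h3.choose_spec] at h2
      exact h2
  rw [h1]
  unfold prodLaw
  rw [Measure.pi_pi, Measure.pi_singleton]
  symm
  refine Finset.prod_of_injOn e he.injOn (by simp) (fun j _ hj => ?_) (fun i _ => ?_)
  · have h3 : ¬ ∃ i, e i = j := by simpa using hj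
    rw [dif_neg h3, measure_univ]
  · have h3 : ∃ i', e i' = e i := ⟨i, rfl⟩
    rw [dif_pos h3, he h3.choose_spec]
    rfl

end Sandwich

/-! ### The gaps of the exclusion process as a network -/

section Exclusion

variable {N : ℕ}

/-- The network formed by the gaps: a right jump of particle `i` moves a hole from the gap on its
right to the gap on its left, and a left jump moves a hole in the opposite direction. -/
def gapNetwork (a b : Fin (N + 1) → ℝ) (ha : ∀ i, 0 ≤ a i) (hb : ∀ i, 0 < b i) :
    Network (Fin N) (Fin (N + 1) ⊕ Fin (N + 1)) where
  src := Sum.elim rightGap leftGap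
  dst := Sum.elim leftGap rightGap
  rate := Sum.elim b a
  rate_nonneg := by
    rintro (i | i)
    · exact (hb i).le
    · exact ha i

theorem isVacant_add_one_iff (x : Config N) (i : Fin (N + 1)) :
    x.IsVacant (x.1 i + 1) ↔ Avail (rightGap i) x.gap := by
  constructor
  · intro h j hj
    rw [rightGap_eq_some] at hj
    subst hj
    have h1 := x.gap_cast j
    have h2 := h j.succ
    omega
  · intro h k hk
    have hik : i < k := by
      rw [← x.2.lt_iff_lt]
      omega
    have hi : (i : ℕ) < N := by
      have := k.2
      rw [Fin.lt_def] at hik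
      omega
    have h1 := x.gap_cast ⟨i, hi⟩
    have h2 := h ⟨i, hi⟩ (rightGap_eq_some.2 rfl)
    have h3 : x.1 (Fin.succ ⟨i, hi⟩) ≤ x.1 k := by
      rw [x.2.le_iff_le, Fin.le_def]
      exact hik
    have h4 : (Fin.castSucc ⟨i, hi⟩ : Fin (N + 1)) = i := rfl
    rw [h4] at h1
    omega

theorem isVacant_sub_one_iff (x : Config N) (i : Fin (N + 1)) :
    x.IsVacant (x.1 i - 1) ↔ Avail (leftGap i) x.gap := by
  constructor
  · intro h j hj
    rw [leftGap_eq_some] at hj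
    subst hj
    have h1 := x.gap_cast j
    have h2 := h j.castSucc
    omega
  · intro h k hk
    have hki : k < i := by
      rw [← x.2.lt_iff_lt]
      omega
    induction i using Fin.cases with
    | zero => exact absurd hki (Fin.not_lt_zero k)
    | succ j =>
      have h1 := x.gap_cast j
      have h2 := h j (leftGap_succ j)
      have h3 : x.1 k ≤ x.1 j.castSucc := by
        rw [x.2.le_iff_le]
        exact Fin.le_castSucc_iff.2 hki
      omega

theorem gap_jumpRight (x : Config N) (i : Fin (N + 1)) :
    (x.jumpRight i).gap = transfer (rightGap i) (leftGap i) x.gap := by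
  unfold Config.jumpRight
  split_ifs with h
  · rw [transfer_of_avail ((isVacant_add_one_iff x i).1 h)]
    ext j
    have h1 := Config.gap_cast ⟨_, x.strictMono_right i h⟩ j
    have h2 := x.gap_cast j
    have h3 := (isVacant_add_one_iff x i).1 h j
    simp only [inc_apply, dec_apply, rightGap_eq_some, leftGap_eq_some] at h3 ⊢
    have hne : j.succ ≠ j.castSucc := (Fin.castSucc_lt_succ (i := j)).ne'
    by_cases hr : i = j.castSucc
    · subst hr
      have h4 := h3 rfl
      rw [if_neg hne.symm, if_pos rfl]
      simp only [Function.update_self, Function.update_of_ne hne] at h1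
      omega
    · rw [if_neg hr]
      by_cases hl : i = j.succ
      · subst hl
        rw [if_pos rfl]
        simp only [Function.update_self, Function.update_of_ne hne.symm] at h1
        omega
      · rw [if_neg hl]
        simp only [Function.update_of_ne (Ne.symm hr), Function.update_of_ne (Ne.symm hl)] at h1
        omega
  · rw [transfer_of_not_avail fun h' => h ((isVacant_add_one_iff x i).2 h')]

theorem gap_jumpLeft (x : Config N) (i : Fin (N + 1)) :
    (x.jumpLeft i).gap = transfer (leftGap i) (rightGap i) x.gap := by
  unfold Config.jumpLeft
  split_ifs with h
  · rw [transfer_of_avail ((isVacant_sub_one_iff x i).1 h)]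
    ext j
    have h1 := Config.gap_cast ⟨_, x.strictMono_left i h⟩ j
    have h2 := x.gap_cast j
    have h3 := (isVacant_sub_one_iff x i).1 h j
    simp only [inc_apply, dec_apply, rightGap_eq_some, leftGap_eq_some] at h3 ⊢
    have hne : j.succ ≠ j.castSucc := (Fin.castSucc_lt_succ (i := j)).ne'
    by_cases hr : i = j.castSucc
    · subst hr
      rw [if_pos rfl, if_neg hne.symm]
      simp only [Function.update_self, Function.update_of_ne hne] at h1
      omega
    · rw [if_neg hr]
      by_cases hl : i = j.succ
      · subst hl
        have h4 := h3 rfl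
        rw [if_pos rfl]
        simp only [Function.update_self, Function.update_of_ne hne.symm] at h1
        omega
      · rw [if_neg hl]
        simp only [Function.update_of_ne (Ne.symm hr), Function.update_of_ne (Ne.symm hl)] at h1
        omega
  · rw [transfer_of_not_avail fun h' => h ((isVacant_sub_one_iff x i).2 h')]

variable {a b : Fin (N + 1) → ℝ} (ha : ∀ i, 0 ≤ a i) (hb : ∀ i, 0 < b i)

theorem generator_comp_gap (F : (Fin N → ℕ) → ℝ) (x : Config N) :
    generator a b (fun x => F x.gap) x = (gapNetwork a b ha hb).gen F x.gap := by
  unfold generator Network.gen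
  rw [Fintype.sum_sum_type, ← Finset.sum_add_distrib]
  refine Finset.sum_congr rfl fun i _ => ?_
  simp only [gap_jumpRight, gap_jumpLeft]
  rfl

/-- Holes leave every gap to the left, by right jumps. -/
theorem drains_gapNetwork : (gapNetwork a b ha hb).Drains := by
  refine ⟨fun j => j, fun j => ⟨Sum.inl j.castSucc, hb _, rightGap_castSucc j, fun k hk => ?_⟩⟩
  have h1 : j.castSucc = k.succ := leftGap_eq_some.1 hk
  have h2 := congrArg Fin.val h1
  simp only [Fin.val_castSucc, Fin.val_succ] at h2 ⊢
  omega

theorem sum_src_gapNetwork (G : Fin (N + 1) ⊕ Fin (N + 1) → ℝ) (j : Fin N) :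
    ∑ m, (if (gapNetwork a b ha hb).src m = some j then G m else 0) =
      G (Sum.inl j.castSucc) + G (Sum.inr j.succ) := by
  rw [Fintype.sum_sum_type]
  simp [gapNetwork, rightGap_eq_some, leftGap_eq_some]

theorem sum_dst_gapNetwork (G : Fin (N + 1) ⊕ Fin (N + 1) → ℝ) (j : Fin N) :
    ∑ m, (if (gapNetwork a b ha hb).dst m = some j then G m else 0) =
      G (Sum.inl j.succ) + G (Sum.inr j.castSucc) := by
  rw [Fintype.sum_sum_type]
  simp [gapNetwork, rightGap_eq_some, leftGap_eq_some]

theorem sum_outflow (d : Fin N → ℝ) (j : Fin N) :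
    ∑ m, (if (gapNetwork a b ha hb).src m = some j then
      (gapNetwork a b ha hb).rate m * load d ((gapNetwork a b ha hb).src m) else 0) =
        serviceRate a b j * d j := by
  rw [sum_src_gapNetwork]
  simp [gapNetwork, serviceRate]
  ring

theorem sum_inflow (d : Fin N → ℝ) (j : Fin N) :
    ∑ m, (if (gapNetwork a b ha hb).dst m = some j then
      (gapNetwork a b ha hb).rate m * load d ((gapNetwork a b ha hb).src m) else 0) =
        inflow a b d j := by
  rw [sum_dst_gapNetwork]
  simp [gapNetwork, inflow]

/-- The rate at which holes pile up in a gap. -/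
def excess (a b : Fin (N + 1) → ℝ) (ν : Fin N → ℝ) (j : Fin N) : ℝ :=
  max (ν j - serviceRate a b j) 0

/-- A uniformisation rate that is large enough for the gap network and its thinned versions. -/
def uniformRate (a b : Fin (N + 1) → ℝ) (ν : Fin N → ℝ) : ℝ :=
  ∑ i, b i + ∑ i, a i + ∑ j, excess a b ν j + 1

variable {ν : Fin N → ℝ}

include ha hb in
theorem uniformRate_pos : 0 < uniformRate a b ν := by
  have h1 : 0 ≤ ∑ i, b i := Finset.sum_nonneg fun i _ => (hb i).le
  have h2 : 0 ≤ ∑ i, a i := Finset.sum_nonneg fun i _ => ha i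
  have h3 : 0 ≤ ∑ j, excess a b ν j := Finset.sum_nonneg fun i _ => le_max_right _ _
  unfold uniformRate
  linarith

theorem sum_rate_add_excess_le : ∑ m, (gapNetwork a b ha hb).rate m + ∑ j, excess a b ν j ≤
    uniformRate a b ν := by
  rw [Fintype.sum_sum_type]
  simp only [gapNetwork, Sum.elim_inl, Sum.elim_inr, uniformRate]
  linarith

theorem admissible_gapNetwork : (gapNetwork a b ha hb).Admissible (uniformRate a b ν) := by
  have h3 : 0 ≤ ∑ j, excess a b ν j := Finset.sum_nonneg fun i _ => le_max_right _ _
  exact ⟨uniformRate_pos ha hb, by linarith [sum_rate_add_excess_le ha hb (ν := ν)]⟩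

/-- The action on functions of the uniformised chain of gaps. -/
abbrev gapKernel (ν : Fin N → ℝ) : ((Fin N → ℕ) → ℝ) → (Fin N → ℕ) → ℝ :=
  (gapNetwork a b ha hb).kernel (uniformRate a b ν)

variable (hν : IsTrafficSolution a b ν)

include ha hb hν in
theorem serviceRate_mul_busy_add_excess (j : Fin N) :
    serviceRate a b j * busy a b ν j + excess a b ν j * busy a b ν j = ν j := by
  have hμ := serviceRate_pos ha hb j
  have h1 : ν j = serviceRate a b j * workload a b ν j := by
    unfold workload; field_simp
  unfold excess busy
  rcases le_total (workload a b ν j) 1 with h | h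
  · rw [min_eq_left h, max_eq_right, zero_mul, add_zero, ← h1]
    rw [h1]
    nlinarith
  · rw [min_eq_right h, max_eq_left]
    · ring
    · rw [h1]
      nlinarith

include hν

/-- The chain of gaps dominates that of a thinned network, which is in equilibrium under a
product-geometric law with loads slightly smaller than `ρ ∧ 1`. -/
theorem eventually_lt_iterate_gapKernel {U : Set (Fin N → ℕ)} (hU : IsUpperSet U) {t : ℝ}
    (ht0 : 0 < t) (ht1 : t < 1) {c : ℝ}
    (hc : c < (prodLaw fun j => t * busy a b ν j).real U) (x : Fin N → ℕ) :
    ∀ᶠ n in atTop, c < (gapKernel ha hb ν)^[n] (ind U) x := by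
  set Q' := (gapNetwork a b ha hb).thin t ht0.le (excess a b ν) (fun _ => le_max_right _ _)
  have hadm : Q'.Admissible (uniformRate a b ν) :=
    Network.admissible_thin ht1.le (uniformRate_pos ha hb) (sum_rate_add_excess_le ha hb)
  have hbal : Q'.Balanced fun j => t * busy a b ν j := by
    refine Network.balanced_thin fun j => ?_
    rw [sum_outflow, sum_inflow, serviceRate_mul_busy_add_excess ha hb hν,
      (isTrafficSolution_iff ha hb ν).1 hν j]
  have hload : ∀ j, 0 < t * busy a b ν j ∧ t * busy a b ν j < 1 := fun j => by
    have h1 : 0 < busy a b ν j := lt_min (workload_pos ha hb hν j) one_pos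
    have h2 : busy a b ν j ≤ 1 := min_le_right _ _
    exact ⟨mul_pos ht0 h1, by nlinarith⟩
  have hlim := Network.tendsto_iterate_kernel_of_bounded hadm
    (Network.drains_thin (drains_gapNetwork ha hb)) (hbal.isStationary hload)
    (monotone_ind hU) (abs_ind_le U) x
  rw [integral_ind] at hlim
  filter_upwards [(tendsto_order.1 hlim).1 c hc] with n hn
  exact hn.trans_le (Network.iterate_kernel_ge (admissible_gapNetwork ha hb) hadm
    (fun f hf y => Network.gen_thin_le ht1.le hf y) (monotone_ind hU) n x)

/-- The chance of finding at least `k` holes in gap `j` is asymptotically at least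
`(ρ_j ∧ 1) ^ k`. -/
theorem eventually_lt_iterate_gapKernel_coord (j : Fin N) (k : ℕ) {c : ℝ}
    (hc : c < busy a b ν j ^ k) (x : Fin N → ℕ) :
    ∀ᶠ n in atTop, c < (gapKernel ha hb ν)^[n] (ind {y | k ≤ y j}) x := by
  have h1 : Tendsto (fun t : ℝ => (t * busy a b ν j) ^ k) (𝓝[<] 1) (𝓝 (busy a b ν j ^ k)) := by
    have : Continuous fun t : ℝ => (t * busy a b ν j) ^ k := by fun_prop
    have h2 := this.tendsto 1
    rw [one_mul] at h2
    exact h2.mono_left nhdsWithin_le_nhds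
  obtain ⟨t, htc, ht0, ht1⟩ := (((tendsto_order.1 h1).1 c hc).and
    (((eventually_gt_nhds one_pos).filter_mono nhdsWithin_le_nhds).and
      self_mem_nhdsWithin)).exists
  have hU : IsUpperSet {y : Fin N → ℕ | k ≤ y j} := fun y z hyz hy => le_trans hy (hyz j)
  refine eventually_lt_iterate_gapKernel ha hb hν hU ht0 ht1 ?_ x
  rw [prodLaw_real_coord_ge (fun i => ?_)]
  · exact htc
  · have h1 : 0 < busy a b ν i := lt_min (workload_pos ha hb hν i) one_pos
    have h2 : busy a b ν i ≤ 1 := min_le_right _ _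
    have h3 : t < 1 := ht1
    exact ⟨(mul_pos ht0 h1).le, by nlinarith⟩

section Stable

variable {ι : Type*} [DecidableEq ι] [Fintype ι] {e : ι → Fin N} (he : Function.Injective e)
  (hstable : ∀ j, workload a b ν (e j) < 1) (hunstable : ∀ j, j ∉ Set.range e → 1 ≤ workload a b ν j)

include he hstable hunstable

theorem busy_comp_eq : busy a b ν ∘ e = workload a b ν ∘ e := by
  funext j
  exact min_eq_left (hstable j).le

theorem tendsto_iterate_collapse {f : (ι → ℕ) → ℝ} (hf : Monotone f) (hlf : LinearGrowth f)
    (y : ι → ℕ) : Tendsto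
      (fun n => (((gapNetwork a b ha hb).collapse e).kernel (uniformRate a b ν))^[n] f y) atTop
      (𝓝 (∫ z, f z ∂(prodLaw (workload a b ν ∘ e)))) := by
  have hbal : ((gapNetwork a b ha hb).collapse e).Balanced (workload a b ν ∘ e) := by
    rw [← busy_comp_eq hν he hstable hunstable]
    refine Network.balanced_collapse he (fun j hj => min_eq_right (hunstable j hj)) ?_
    rintro _ ⟨i, rfl⟩
    rw [sum_outflow, sum_inflow, serviceRate_mul_busy ha hb,
      ← (isTrafficSolution_iff ha hb ν).1 hν (e i)]
    refine min_eq_left ?_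
    have h1 := hstable i
    unfold workload at h1
    rw [div_lt_one (serviceRate_pos ha hb _)] at h1
    exact h1.le
  exact Network.tendsto_iterate_kernel
    (Network.admissible_collapse (admissible_gapNetwork ha hb)) (Network.drains_collapse he (drains_gapNetwork ha hb))
    (hbal.isStationary fun i => ⟨workload_pos ha hb hν _, hstable i⟩) hf hlf y

omit hν hstable hunstable in
/-- The stable gaps are dominated by the network in which the unstable gaps are never empty. -/
theorem iterate_gapKernel_comp_le {f : (ι → ℕ) → ℝ} (hf : Monotone f) (n : ℕ) (x : Fin N → ℕ) :
    (gapKernel ha hb ν)^[n] (fun x => f (x ∘ e)) x ≤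
      (((gapNetwork a b ha hb).collapse e).kernel (uniformRate a b ν))^[n] f (x ∘ e) :=
  Network.iterate_kernel_comp_le (p := fun x => x ∘ e) (admissible_gapNetwork ha hb)
    (Network.admissible_collapse (admissible_gapNetwork ha hb))
    (fun _ hf x => Network.gen_comp_le_collapse he hf x) hf n x

/-- **Convergence to equilibrium of the stable gaps**, from any starting point. -/
theorem tendsto_iterate_gapKernel (A : Set (ι → ℕ)) (x : Fin N → ℕ) : Tendsto
    (fun n => (gapKernel ha hb ν)^[n] (ind ((fun x => x ∘ e) ⁻¹' A)) x) atTop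
      (𝓝 ((prodLaw (workload a b ν ∘ e)).real A)) := by
  refine tendsto_content_of_isUpperSet (Eventually.of_forall fun n =>
    Network.isContent_iterate_kernel (admissible_gapNetwork ha hb) (fun x => x ∘ e) n x)
    (fun U hU => ?_) A
  refine tendsto_order.2 ⟨fun c hc => ?_, fun c hc => ?_⟩
  · have h1 : Tendsto (fun t : ℝ => (prodLaw fun i => t * workload a b ν (e i)).real U) (𝓝[<] 1)
        (𝓝 ((prodLaw (workload a b ν ∘ e)).real U)) := by
      refine tendsto_content_of_singleton (Φ := fun (t : ℝ) A =>
        (prodLaw fun i => t * workload a b ν (e i)).real A)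
        (Eventually.of_forall fun t => isContent_measureReal _) (fun z => ?_) U
      rw [prodLaw_real_singleton (ρ := workload a b ν ∘ e)
        fun i => ⟨(workload_pos ha hb hν _).le, hstable i⟩]
      simp only [Function.comp_apply]
      have h2 : Continuous fun t : ℝ => ∏ i, (t * workload a b ν (e i)) ^ z i *
          (1 - t * workload a b ν (e i)) := by fun_prop
      have h3 := h2.tendsto 1
      simp only [one_mul] at h3
      refine (h3.mono_left nhdsWithin_le_nhds).congr' ?_
      filter_upwards [(eventually_gt_nhds one_pos).filter_mono nhdsWithin_le_nhds,
        self_mem_nhdsWithin] with t ht0 ht1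
      rw [prodLaw_real_singleton fun i => ⟨mul_nonneg ht0.le (workload_pos ha hb hν _).le, ?_⟩]
      have := workload_pos ha hb hν (e i)
      have := hstable i
      have : t < 1 := ht1
      nlinarith
    obtain ⟨t, htc, ht0, ht1⟩ := (((tendsto_order.1 h1).1 c hc).and
      (((eventually_gt_nhds one_pos).filter_mono nhdsWithin_le_nhds).and
        self_mem_nhdsWithin)).exists
    have hU' : IsUpperSet ((fun x : Fin N → ℕ => x ∘ e) ⁻¹' U) :=
      fun y z hyz hy => hU (fun i => hyz (e i)) hy
    refine eventually_lt_iterate_gapKernel ha hb hν hU' ht0 ht1 ?_ x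
    rw [← map_measureReal_apply Measurable.of_discrete MeasurableSet.of_discrete,
      map_comp_prodLaw he]
    have h2 : (fun j => t * busy a b ν j) ∘ e = fun i => t * workload a b ν (e i) := by
      funext i
      rw [← Function.comp_apply (f := workload a b ν),
        ← busy_comp_eq hν he hstable hunstable]
      rfl
    rwa [h2]
  · have h1 := tendsto_iterate_collapse ha hb hν he hstable hunstable (monotone_ind hU)
      (LinearGrowth.of_bounded (abs_ind_le U)) (x ∘ e)
    rw [integral_ind] at h1
    filter_upwards [(tendsto_order.1 h1).2 c hc] with n hn
    exact (iterate_gapKernel_comp_le ha hb he (monotone_ind hU) n x).trans_lt hn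

end Stable

end Exclusion

/-! ### One-dimensional laws of the exclusion process -/

section Paths

variable {N : ℕ} {a b : Fin (N + 1) → ℝ} {Ω : Type*} [MeasurableSpace Ω] {P : Measure Ω}
  [IsProbabilityMeasure P]

theorem intervalIntegrable_of_bounded {f : ℝ → ℝ} (hf : Measurable f) {C : ℝ}
    (hC : ∀ s, |f s| ≤ C) (u v : ℝ) : IntervalIntegrable f volume u v := by
  rw [intervalIntegrable_iff]
  exact Measure.integrableOn_of_bounded (M := C) (by simp) hf.aestronglyMeasurable
    (ae_of_all _ hC)

theorem integral_intervalIntegral_swap {φ : ℝ × Ω → ℝ} (hφ : Measurable φ) {C : ℝ}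
    (hC : ∀ p, |φ p| ≤ C) {u v : ℝ} (huv : u ≤ v) :
    ∫ ω, (∫ s in u..v, φ (s, ω)) ∂P = ∫ s in u..v, (∫ ω, φ (s, ω) ∂P) := by
  simp only [intervalIntegral.integral_of_le huv]
  refine integral_integral_swap (f := fun ω s => φ (s, ω)) ?_
  refine Integrable.of_bound (C := C) ?_ (ae_of_all _ fun p => hC _)
  exact (hφ.comp measurable_swap).aestronglyMeasurable

theorem measurable_intervalIntegral {φ : ℝ × Ω → ℝ} (hφ : Measurable φ) {u v : ℝ} (huv : u ≤ v) :
    Measurable fun ω => ∫ s in u..v, φ (s, ω) := by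
  simp only [intervalIntegral.integral_of_le huv]
  exact (hφ.comp measurable_swap).stronglyMeasurable.integral_prod_right'.measurable

theorem measurable_integral_left {φ : ℝ × Ω → ℝ} (hφ : Measurable φ) :
    Measurable fun s => ∫ ω, φ (s, ω) ∂P :=
  hφ.stronglyMeasurable.integral_prod_right'.measurable

theorem abs_integral_le_of_bounded {f : Ω → ℝ} {C : ℝ} (hC : ∀ ω, |f ω| ≤ C) :
    |∫ ω, f ω ∂P| ≤ C := by
  have := norm_integral_le_of_norm_le_const (μ := P) (f := f) (C := C) (ae_of_all _ hC)
  simpa using this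

theorem abs_intervalIntegral_le {f : ℝ → ℝ} {C : ℝ} (hC : ∀ s, |f s| ≤ C) {u v : ℝ}
    (huv : u ≤ v) : |∫ s in u..v, f s| ≤ C * (v - u) := by
  have := intervalIntegral.norm_integral_le_of_norm_le_const (a := u) (b := v) (f := f) (C := C)
    fun s _ => hC s
  rwa [abs_of_nonneg (sub_nonneg.2 huv)] at this

/-- The total rate of attempted jumps. -/
def jumpRate (a b : Fin (N + 1) → ℝ) : ℝ := ∑ i, (b i + a i)

theorem abs_generator_le (ha : ∀ i, 0 ≤ a i) (hb : ∀ i, 0 < b i) {f : Config N → ℝ}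
    {x : Config N} {D : ℝ} (hr : ∀ i, |f (x.jumpRight i) - f x| ≤ D)
    (hl : ∀ i, |f (x.jumpLeft i) - f x| ≤ D) : |generator a b f x| ≤ jumpRate a b * D := by
  unfold generator jumpRate
  rw [Finset.sum_mul]
  refine (Finset.abs_sum_le_sum_abs _ _).trans (Finset.sum_le_sum fun i _ => ?_)
  refine (abs_add_le _ _).trans ?_
  rw [abs_mul, abs_mul, abs_of_pos (hb i), abs_of_nonneg (ha i), add_mul]
  exact add_le_add (mul_le_mul_of_nonneg_left (hr i) (hb i).le)
    (mul_le_mul_of_nonneg_left (hl i) (ha i))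

theorem abs_generator_le_of_bounded (ha : ∀ i, 0 ≤ a i) (hb : ∀ i, 0 < b i) {f : Config N → ℝ}
    {C : ℝ} (hC : ∀ x, |f x| ≤ C) (x : Config N) :
    |generator a b f x| ≤ jumpRate a b * (2 * C) := by
  refine abs_generator_le ha hb (fun i => ?_) fun i => ?_
  · exact (abs_sub _ _).trans (by linarith [hC x, hC (x.jumpRight i)])
  · exact (abs_sub _ _).trans (by linarith [hC x, hC (x.jumpLeft i)])

namespace IsExclusionProcess

variable {x₀ : Config N} {X : ℝ≥0 → Ω → Config N} (hX : IsExclusionProcess a b x₀ P X)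

include hX

/-- Right-continuous paths in a discrete space are limits of paths that are constant on short
intervals, whence joint measurability. -/
theorem measurable_joint (f : Config N → ℝ) :
    Measurable fun p : ℝ × Ω => f (X p.1.toNNReal p.2) := by
  set σ : ℕ → ℝ≥0 → ℝ≥0 := fun n t => (⌊t * (n + 1)⌋₊ + 1) / (n + 1) with hσ
  have hlt : ∀ n t, t < σ n t := fun n t => by
    rw [hσ, lt_div_iff₀ (by positivity)]
    exact_mod_cast Nat.lt_floor_add_one (t * (n + 1))
  have hle : ∀ n t, σ n t ≤ t + 1 / (n + 1) := fun n t => by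
    have h0 : (0 : ℝ≥0) < n + 1 := by positivity
    rw [hσ, div_le_iff₀ h0, add_mul, one_div, inv_mul_cancel₀ h0.ne']
    have := Nat.floor_le (zero_le : 0 ≤ t * (n + 1))
    gcongr
  have htend : ∀ t, Tendsto (fun n => σ n t) atTop (𝓝[≥] t) := fun t => by
    refine tendsto_nhdsWithin_iff.2 ⟨?_, Eventually.of_forall fun n => (hlt n t).le⟩
    have h1 : Tendsto (fun n : ℕ => t + 1 / ((n : ℝ≥0) + 1)) atTop (𝓝 (t + 0)) :=
      tendsto_const_nhds.add tendsto_one_div_add_atTop_nhds_zero_nat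
    rw [add_zero] at h1
    exact tendsto_of_tendsto_of_tendsto_of_le_of_le tendsto_const_nhds h1
      (fun n => (hlt n t).le) (fun n => hle n t)
  have hmeas : ∀ n, Measurable fun p : ℝ × Ω => f (X (σ n p.1.toNNReal) p.2) := fun n => by
    have h1 : Measurable fun q : ℕ × Ω => f (X ((q.1 + 1) / (n + 1)) q.2) := by
      refine measurable_from_prod_countable_right fun k => ?_
      exact (Measurable.of_discrete (f := f)).comp (hX.measurable ((k + 1) / (n + 1)))
    have h2 : Measurable fun p : ℝ × Ω => ((⌊p.1.toNNReal * (n + 1)⌋₊, p.2) : ℕ × Ω) := by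
      refine Measurable.prodMk ?_ measurable_snd
      exact Nat.measurable_floor.comp (measurable_fst.real_toNNReal.mul_const _)
    have h3 := h1.comp h2
    exact h3
  refine measurable_of_tendsto_metrizable hmeas (tendsto_pi_nhds.2 fun p => ?_)
  refine tendsto_const_nhds.congr' ?_
  filter_upwards [(htend p.1.toNNReal).eventually (hX.rightContinuous p.2 p.1.toNNReal)] with n hn
  rw [hn]

theorem measurable_path (f : Config N → ℝ) (ω : Ω) :
    Measurable fun s : ℝ => f (X s.toNNReal ω) :=
  (hX.measurable_joint f).comp (measurable_id.prodMk measurable_const)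

theorem measurable_comp (f : Config N → ℝ) (t : ℝ≥0) : Measurable fun ω => f (X t ω) :=
  Measurable.of_discrete.comp (hX.measurable t)

theorem integrable_comp {f : Config N → ℝ} {C : ℝ} (hC : ∀ x, |f x| ≤ C) (t : ℝ≥0) :
    Integrable (fun ω => f (X t ω)) P :=
  Integrable.of_bound (C := C) (hX.measurable_comp f t).aestronglyMeasurable
    (ae_of_all _ fun _ => hC _)

variable (ha : ∀ i, 0 ≤ a i) (hb : ∀ i, 0 < b i)

include ha hb

/-- Dynkin's formula. -/
theorem integral_eq {f : Config N → ℝ} {C : ℝ} (hC : ∀ x, |f x| ≤ C) (t : ℝ≥0) :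
    ∫ ω, f (X t ω) ∂P =
      f x₀ + ∫ s in (0 : ℝ)..t, ∫ ω, generator a b f (X s.toNNReal ω) ∂P := by
  have hmart := hX.martingale f ⟨C, hC⟩
  have h1 := hmart.setIntegral_eq (zero_le : 0 ≤ t) MeasurableSet.univ
  have hg := abs_generator_le_of_bounded ha hb hC
  have hint : Integrable (fun ω => ∫ s in (0 : ℝ)..t, generator a b f (X s.toNNReal ω)) P := by
    refine Integrable.of_bound (C := jumpRate a b * (2 * C) * (t - 0))
      (measurable_intervalIntegral (hX.measurable_joint _) t.coe_nonneg).aestronglyMeasurable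
      (ae_of_all _ fun ω => ?_)
    exact abs_intervalIntegral_le (fun s => hg _) t.2
  simp only [setIntegral_univ, NNReal.coe_zero, intervalIntegral.integral_same, sub_zero] at h1
  rw [integral_sub (hX.integrable_comp hC t) hint,
    integral_intervalIntegral_swap (hX.measurable_joint (generator a b f)) (fun p => hg _) t.coe_nonneg] at h1
  have h2 : ∫ ω, f (X 0 ω) ∂P = f x₀ := by
    have : (fun ω => f (X 0 ω)) =ᵐ[P] fun _ => f x₀ := by
      filter_upwards [hX.initial] with ω hω
      rw [hω]
    rw [integral_congr_ae this]
    simp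
  linarith

variable {ν : Fin N → ℝ}

/-- Duhamel's formula for the gaps. -/
theorem exp_mul_integral_gap_eq {F : (Fin N → ℕ) → ℝ} {C : ℝ} (hC : ∀ x, |F x| ≤ C) (t : ℝ≥0) :
    Real.exp (uniformRate a b ν * t) * ∫ ω, F (X t ω).gap ∂P = F x₀.gap +
      ∫ s in (0 : ℝ)..t, Real.exp (uniformRate a b ν * s) *
        (uniformRate a b ν * ∫ ω, gapKernel ha hb ν F (X s.toNNReal ω).gap ∂P) := by
  set Λ := uniformRate a b ν with hΛ
  have hΛ0 : 0 < Λ := uniformRate_pos ha hb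
  set φ : ((Fin N → ℕ) → ℝ) → ℝ → ℝ := fun F s => ∫ ω, F (X s.toNNReal ω).gap ∂P with hφ
  have hgen : ∀ F : (Fin N → ℕ) → ℝ, ∀ x, generator a b (fun x => F x.gap) x =
      Λ * (gapKernel ha hb ν F x.gap - F x.gap) := fun F x => by
    rw [generator_comp_gap ha hb]
    unfold gapKernel Network.kernel
    rw [← hΛ, add_sub_cancel_left, mul_inv_cancel_left₀ hΛ0.ne']
  have hK : ∀ F : (Fin N → ℕ) → ℝ, ∀ C : ℝ, (∀ x, |F x| ≤ C) → ∀ x, |gapKernel ha hb ν F x| ≤ C :=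
    fun F C hC x => Network.abs_iterate_kernel_le (admissible_gapNetwork ha hb) hC 1 x
  have hφeq : ∀ F : (Fin N → ℕ) → ℝ, ∀ C : ℝ, (∀ x, |F x| ≤ C) → ∀ s,
      ∫ ω, generator a b (fun x => F x.gap) (X s ω) ∂P =
        Λ * (∫ ω, gapKernel ha hb ν F (X s ω).gap ∂P - ∫ ω, F (X s ω).gap ∂P) := by
    intro F C hC s
    simp only [hgen]
    rw [integral_const_mul, integral_sub]
    · exact hX.integrable_comp (f := fun x => gapKernel ha hb ν F x.gap)
        (fun x => hK F C hC _) s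
    · exact hX.integrable_comp (f := fun x => F x.gap) (fun x => hC _) s
  have hbound : ∀ F : (Fin N → ℕ) → ℝ, ∀ C : ℝ, (∀ x, |F x| ≤ C) → ∀ s, |φ F s| ≤ C :=
    fun F C hC s => abs_integral_le_of_bounded fun ω => hC _
  have hmeas : ∀ F : (Fin N → ℕ) → ℝ, Measurable (φ F) := fun F =>
    measurable_integral_left (hX.measurable_joint fun x => F x.gap)
  have hprim : ∀ F : (Fin N → ℕ) → ℝ, ∀ C : ℝ, (∀ x, |F x| ≤ C) → ∀ t : ℝ, 0 ≤ t →
      φ F t = F x₀.gap + ∫ s in (0 : ℝ)..t, Λ * (φ (gapKernel ha hb ν F) s - φ F s) := by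
    intro F C hC t ht
    have h1 := hX.integral_eq ha hb (f := fun x => F x.gap) (fun x => hC _) t.toNNReal
    simp only [hφeq F C hC] at h1
    rw [Real.coe_toNNReal t ht] at h1
    exact h1
  have hcont : ∀ F : (Fin N → ℕ) → ℝ, ∀ C : ℝ, (∀ x, |F x| ≤ C) → Continuous (φ F) := by
    intro F C hC
    have h1 : Continuous fun t : ℝ =>
        F x₀.gap + ∫ s in (0 : ℝ)..t, Λ * (φ (gapKernel ha hb ν F) s - φ F s) := by
      refine continuous_const.add (intervalIntegral.continuous_primitive (fun u v => ?_) 0)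
      refine intervalIntegrable_of_bounded (((hmeas _).sub (hmeas _)).const_mul _)
        (C := |Λ| * (2 * C)) (fun s => ?_) u v
      rw [abs_mul]
      refine mul_le_mul_of_nonneg_left ((abs_sub _ _).trans ?_) (abs_nonneg _)
      linarith [hbound _ C (hK F C hC) s, hbound F C hC s]
    have h2 : φ F = fun t => (fun t : ℝ =>
        F x₀.gap + ∫ s in (0 : ℝ)..t, Λ * (φ (gapKernel ha hb ν F) s - φ F s)) (max t 0) := by
      funext t
      simp only
      rw [← hprim F C hC (max t 0) (le_max_right _ _)]
      simp only [hφ]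
      congr 2
      ext ω
      rcases le_total t 0 with ht | ht
      · rw [max_eq_right ht, Real.toNNReal_of_nonpos ht, Real.toNNReal_zero]
      · rw [max_eq_left ht]
    rw [h2]
    exact h1.comp (continuous_id.max continuous_const)
  set g : ℝ → ℝ := fun s => Λ * (φ (gapKernel ha hb ν F) s - φ F s) with hg
  have hgc : Continuous g := ((hcont _ C (hK F C hC)).sub (hcont F C hC)).const_mul _
  set h : ℝ → ℝ := fun t => F x₀.gap + ∫ s in (0 : ℝ)..t, g s with hh
  have hderiv : ∀ s, HasDerivAt (fun t => Real.exp (Λ * t) * h t)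
      (Real.exp (Λ * s) * Λ * h s + Real.exp (Λ * s) * g s) s := fun s => by
    have h1 : HasDerivAt (fun t => Real.exp (Λ * t)) (Real.exp (Λ * s) * Λ) s := by
      have := ((hasDerivAt_id s).const_mul Λ).exp
      simpa using this
    have h2 : HasDerivAt h (g s) s :=
      ((hgc.integral_hasStrictDerivAt 0 s).hasDerivAt).const_add _
    exact h1.mul h2
  have hhc : Continuous h := continuous_const.add
    (intervalIntegral.continuous_primitive (fun u v => hgc.intervalIntegrable u v) 0)
  have hftc := intervalIntegral.integral_eq_sub_of_hasDerivAt (a := 0) (b := (t : ℝ))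
    (fun s _ => hderiv s) (Continuous.intervalIntegrable (by fun_prop) _ _)
  have h0 : h 0 = F x₀.gap := by simp [hh]
  have ht : h t = ∫ ω, F (X t ω).gap ∂P := by
    have h1 := hprim F C hC t t.coe_nonneg
    simp only [hφ, Real.toNNReal_coe] at h1
    exact h1.symm
  rw [mul_zero, Real.exp_zero, one_mul, h0, ht] at hftc
  rw [← sub_eq_iff_eq_add', ← hftc]
  refine intervalIntegral.integral_congr fun s hs => ?_
  rw [Set.uIcc_of_le t.coe_nonneg] at hs
  have h1 : h s = φ F s := (hprim F C hC s hs.1).symm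
  simp only [h1, hg, hφ]
  ring

/-- Iterating Duhamel's formula `n` times. -/
theorem abs_integral_gap_sub_le (n : ℕ) {F : (Fin N → ℕ) → ℝ} {C : ℝ} (hC : ∀ x, |F x| ≤ C)
    (t : ℝ≥0) :
    |Real.exp (uniformRate a b ν * t) * ∫ ω, F (X t ω).gap ∂P -
      ∑ k ∈ Finset.range n, (uniformRate a b ν * t) ^ k / k.factorial *
        (gapKernel ha hb ν)^[k] F x₀.gap| ≤
      C * Real.exp (uniformRate a b ν * t) * ((uniformRate a b ν * t) ^ n / n.factorial) := by
  set Λ := uniformRate a b ν with hΛ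
  have hΛ0 : 0 < Λ := uniformRate_pos ha hb
  induction n generalizing F t with
  | zero =>
    simp only [Finset.range_zero, Finset.sum_empty, sub_zero, pow_zero, Nat.factorial_zero,
      Nat.cast_one, div_one, mul_one]
    rw [abs_mul, abs_of_pos (Real.exp_pos _), mul_comm]
    exact mul_le_mul_of_nonneg_right (abs_integral_le_of_bounded fun ω => hC _)
      (Real.exp_pos _).le
  | succ n ih =>
    set G := gapKernel ha hb ν F with hG
    have hGC : ∀ x, |G x| ≤ C := Network.abs_iterate_kernel_le (admissible_gapNetwork ha hb) hC 1
    have hC0 : 0 ≤ C := (abs_nonneg _).trans (hC 0)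
    have hpow : ∀ k : ℕ, ∫ s in (0 : ℝ)..t, Λ * ((Λ * s) ^ k / k.factorial) =
        (Λ * t) ^ (k + 1) / (k + 1).factorial := fun k => by
      have h1 : (fun s : ℝ => Λ * ((Λ * s) ^ k / k.factorial)) =
          fun s => (Λ ^ (k + 1) / k.factorial) * s ^ k := by
        ext s; rw [mul_pow]; ring
      rw [h1, intervalIntegral.integral_const_mul, integral_pow, Nat.factorial_succ]
      push_cast
      have : (k.factorial : ℝ) ≠ 0 := by positivity
      have : (k : ℝ) + 1 ≠ 0 := by positivity
      field_simp
      ring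
    rw [hX.exp_mul_integral_gap_eq ha hb hC t, Finset.sum_range_succ']
    simp only [pow_zero, Nat.factorial_zero, Nat.cast_one, div_one, one_mul,
      Function.iterate_zero, id_eq, Function.iterate_succ_apply, ← hG, ← hpow]
    have hsum : ∑ k ∈ Finset.range n, (∫ s in (0 : ℝ)..t, Λ * ((Λ * s) ^ k / k.factorial)) *
        (gapKernel ha hb ν)^[k] G x₀.gap = ∫ s in (0 : ℝ)..t, ∑ k ∈ Finset.range n,
          Λ * ((Λ * s) ^ k / k.factorial) * (gapKernel ha hb ν)^[k] G x₀.gap := by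
      rw [intervalIntegral.integral_finsetSum]
      · simp only [intervalIntegral.integral_mul_const]
      · intro k _
        exact Continuous.intervalIntegrable (by fun_prop) _ _
    have hint1 : IntervalIntegrable (fun s : ℝ => Real.exp (Λ * s) *
        (Λ * ∫ ω, G (X s.toNNReal ω).gap ∂P)) volume 0 t := by
      refine IntervalIntegrable.continuousOn_mul ?_ (by fun_prop)
      refine intervalIntegrable_of_bounded (C := |Λ| * C) (Measurable.const_mul
        (measurable_integral_left (hX.measurable_joint fun x => G x.gap)) _) (fun s => ?_) _ _
      rw [abs_mul]
      exact mul_le_mul_of_nonneg_left (abs_integral_le_of_bounded fun ω => hGC _) (abs_nonneg _)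
    have hint2 : IntervalIntegrable (fun s : ℝ => ∑ k ∈ Finset.range n,
        Λ * ((Λ * s) ^ k / k.factorial) * (gapKernel ha hb ν)^[k] G x₀.gap) volume 0 t :=
      Continuous.intervalIntegrable (by fun_prop) _ _
    rw [hsum, add_comm (∫ s in (0 : ℝ)..t, _) (F x₀.gap), add_sub_add_left_eq_sub,
      ← intervalIntegral.integral_sub hint1 hint2]
    rw [← Real.norm_eq_abs]
    refine le_trans (intervalIntegral.norm_integral_le_of_norm_le (g := fun s =>
      C * Real.exp (Λ * t) * (Λ * ((Λ * s) ^ n / n.factorial))) t.coe_nonneg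
      (ae_of_all _ fun s hs => ?_) (Continuous.intervalIntegrable (by fun_prop) _ _)) ?_
    · have hs0 : 0 ≤ s := hs.1.le
      have h1 := ih (F := G) hGC s.toNNReal
      rw [Real.coe_toNNReal s hs0] at h1
      have h2 : Real.exp (Λ * s) * (Λ * ∫ ω, G (X s.toNNReal ω).gap ∂P) -
          ∑ k ∈ Finset.range n, Λ * ((Λ * s) ^ k / k.factorial) *
            (gapKernel ha hb ν)^[k] G x₀.gap =
          Λ * (Real.exp (Λ * s) * ∫ ω, G (X s.toNNReal ω).gap ∂P -
            ∑ k ∈ Finset.range n, (Λ * s) ^ k / k.factorial *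
              (gapKernel ha hb ν)^[k] G x₀.gap) := by
        rw [mul_sub, Finset.mul_sum]
        congr 1
        · ring
        · exact Finset.sum_congr rfl fun k _ => by ring
      rw [Real.norm_eq_abs, h2, abs_mul, abs_of_pos hΛ0]
      have h3 : Real.exp (Λ * s) ≤ Real.exp (Λ * t) :=
        Real.exp_le_exp.2 (mul_le_mul_of_nonneg_left hs.2 hΛ0.le)
      calc _ ≤ Λ * (C * Real.exp (Λ * s) * ((Λ * s) ^ n / n.factorial)) :=
            mul_le_mul_of_nonneg_left h1 hΛ0.le
        _ ≤ Λ * (C * Real.exp (Λ * t) * ((Λ * s) ^ n / n.factorial)) := by gcongr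
        _ = _ := by ring
    · rw [intervalIntegral.integral_const_mul, hpow]

/-- The law of the gaps is that of the uniformised chain at an independent Poisson time. -/
theorem hasSum_integral_gap {F : (Fin N → ℕ) → ℝ} {C : ℝ} (hC : ∀ x, |F x| ≤ C) (t : ℝ≥0) :
    HasSum (fun k : ℕ => (uniformRate a b ν * t) ^ k / k.factorial *
      (gapKernel ha hb ν)^[k] F x₀.gap)
      (Real.exp (uniformRate a b ν * t) * ∫ ω, F (X t ω).gap ∂P) := by
  set Λ := uniformRate a b ν with hΛ
  have hΛ0 : 0 < Λ := uniformRate_pos ha hb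
  have hs : Summable fun k : ℕ => (Λ * t) ^ k / k.factorial *
      (gapKernel ha hb ν)^[k] F x₀.gap := by
    refine Summable.of_norm_bounded ((Real.summable_pow_div_factorial (Λ * t)).mul_right C)
      fun k => ?_
    rw [norm_mul, Real.norm_of_nonneg (by positivity)]
    exact mul_le_mul_of_nonneg_left
      (Network.abs_iterate_kernel_le (admissible_gapNetwork ha hb) hC k _) (by positivity)
  refine (hs.hasSum_iff_tendsto_nat).2 ?_
  rw [tendsto_iff_norm_sub_tendsto_zero]
  have h1 := (FloorSemiring.tendsto_pow_div_factorial_atTop (Λ * t)).const_mul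
    (C * Real.exp (Λ * t))
  rw [mul_zero] at h1
  refine squeeze_zero (fun _ => norm_nonneg _) (fun n => ?_) h1
  rw [norm_sub_rev]
  exact hX.abs_integral_gap_sub_le ha hb n hC t

omit hX ha hb

/-- Poisson averages of a convergent sequence, as the Poisson parameter tends to infinity. -/
theorem _root_.ExclusionClouds.tendsto_poisson_average {c : ℕ → ℝ} {L : ℝ}
    (hc : Tendsto c atTop (𝓝 L)) :
    (∀ t : ℝ, Summable fun k : ℕ => t ^ k / k.factorial * c k) ∧
    Tendsto (fun t : ℝ => Real.exp (-t) * ∑' k : ℕ, t ^ k / k.factorial * c k) atTop (𝓝 L) := by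
  obtain ⟨B, hB⟩ : ∃ B, ∀ k, |c k - L| ≤ B := by
    obtain ⟨B, hB⟩ := (hc.sub_const L).norm.bddAbove_range
    exact ⟨B, fun k => hB ⟨k, rfl⟩⟩
  have hexp : ∀ t : ℝ, HasSum (fun k : ℕ => t ^ k / k.factorial) (Real.exp t) := fun t => by
    rw [Real.exp_eq_exp_ℝ]
    exact NormedSpace.expSeries_div_hasSum_exp t
  have hs1 : ∀ t : ℝ, Summable fun k : ℕ => t ^ k / k.factorial * (c k - L) := fun t => by
    refine Summable.of_norm_bounded ((hexp t).summable.norm.mul_right B) fun k => ?_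
    rw [norm_mul]
    exact mul_le_mul_of_nonneg_left (hB k) (norm_nonneg _)
  have hs : ∀ t : ℝ, Summable fun k : ℕ => t ^ k / k.factorial * c k := fun t => by
    refine ((hs1 t).add ((hexp t).summable.mul_right L)).congr fun k => by ring
  refine ⟨hs, ?_⟩
  have hdiff : ∀ t : ℝ, Real.exp (-t) * ∑' k : ℕ, t ^ k / k.factorial * c k - L =
      Real.exp (-t) * ∑' k : ℕ, t ^ k / k.factorial * (c k - L) := fun t => by
    have h1 : ∑' k : ℕ, t ^ k / k.factorial * (c k - L) =
        ∑' k : ℕ, t ^ k / k.factorial * c k - Real.exp t * L := by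
      simp only [mul_sub]
      rw [(hs t).tsum_sub ((hexp t).summable.mul_right L), tsum_mul_right, (hexp t).tsum_eq]
    rw [h1, mul_sub, ← mul_assoc, ← Real.exp_add, neg_add_cancel, Real.exp_zero, one_mul]
  rw [tendsto_iff_norm_sub_tendsto_zero]
  refine tendsto_order.2 ⟨fun δ hδ => Eventually.of_forall fun t => hδ.trans_le (norm_nonneg _),
    fun δ hδ => ?_⟩
  obtain ⟨n₀, hn₀⟩ := eventually_atTop.1 ((Metric.tendsto_nhds.1 hc) (δ / 2) (by positivity))
  have hhead : Tendsto (fun t : ℝ => B * ∑ k ∈ Finset.range n₀,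
      (k.factorial : ℝ)⁻¹ * (t ^ k * Real.exp (-t))) atTop (𝓝 0) := by
    have h1 : Tendsto (fun t : ℝ => ∑ k ∈ Finset.range n₀,
        (k.factorial : ℝ)⁻¹ * (t ^ k * Real.exp (-t))) atTop
        (𝓝 (∑ k ∈ Finset.range n₀, (k.factorial : ℝ)⁻¹ * 0)) :=
      tendsto_finsetSum _ fun k _ =>
        (Real.tendsto_pow_mul_exp_neg_atTop_nhds_zero k).const_mul _
    have h2 := h1.const_mul B
    simpa using h2
  filter_upwards [(tendsto_order.1 hhead).2 (δ / 2) (by positivity), eventually_ge_atTop 0]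
    with t ht ht0
  rw [hdiff, Real.norm_eq_abs, abs_mul, abs_of_pos (Real.exp_pos _)]
  have hhs : HasSum (fun k => if k ∈ Finset.range n₀ then t ^ k / k.factorial * B else 0)
      (∑ k ∈ Finset.range n₀, t ^ k / k.factorial * B) := by
    have h5 := hasSum_sum_of_ne_finset_zero (s := Finset.range n₀)
      (f := fun k : ℕ => if k ∈ Finset.range n₀ then t ^ k / k.factorial * B else 0)
      (L := SummationFilter.unconditional ℕ) (fun k hk => if_neg hk)
    rwa [Finset.sum_congr rfl fun k hk => if_pos hk] at h5
  have hbd : |∑' k : ℕ, t ^ k / k.factorial * (c k - L)| ≤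
      ∑ k ∈ Finset.range n₀, t ^ k / k.factorial * B + Real.exp t * (δ / 2) := by
    have h4 := hhs.add ((hexp t).mul_right (δ / 2))
    rw [← Real.norm_eq_abs]
    refine tsum_of_norm_bounded h4 fun k => ?_
    rw [norm_mul, Real.norm_of_nonneg (by positivity), Real.norm_eq_abs]
    have hw : 0 ≤ t ^ k / (k.factorial : ℝ) := by positivity
    split_ifs with hk
    · have := mul_le_mul_of_nonneg_left (hB k) hw
      have : 0 ≤ t ^ k / (k.factorial : ℝ) * (δ / 2) := by positivity
      linarith
    · have hk' : n₀ ≤ k := by simpa using hk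
      have h5 := hn₀ k hk'
      rw [Real.dist_eq] at h5
      rw [zero_add]
      exact mul_le_mul_of_nonneg_left h5.le hw
  calc Real.exp (-t) * |∑' k : ℕ, t ^ k / k.factorial * (c k - L)|
      ≤ Real.exp (-t) * (∑ k ∈ Finset.range n₀, t ^ k / k.factorial * B +
        Real.exp t * (δ / 2)) := mul_le_mul_of_nonneg_left hbd (Real.exp_pos _).le
    _ = B * ∑ k ∈ Finset.range n₀, (k.factorial : ℝ)⁻¹ * (t ^ k * Real.exp (-t)) + δ / 2 := by
        rw [mul_add, ← mul_assoc, ← Real.exp_add, neg_add_cancel, Real.exp_zero, one_mul,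
          Finset.mul_sum, Finset.mul_sum]
        congr 1
        exact Finset.sum_congr rfl fun k _ => by ring
    _ < δ := by linarith

include hX ha hb

/-- Limits along the uniformised chain are inherited by the process. -/
theorem tendsto_integral_gap {F : (Fin N → ℕ) → ℝ} {C : ℝ} (hC : ∀ x, |F x| ≤ C) {L : ℝ}
    (hF : Tendsto (fun n => (gapKernel ha hb ν)^[n] F x₀.gap) atTop (𝓝 L)) :
    Tendsto (fun t : ℝ≥0 => ∫ ω, F (X t ω).gap ∂P) atTop (𝓝 L) := by
  have hΛ0 : 0 < uniformRate a b ν := uniformRate_pos ha hb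
  have h1 := (tendsto_poisson_average hF).2
  have h2 : Tendsto (fun t : ℝ≥0 => uniformRate a b ν * (t : ℝ)) atTop atTop :=
    (NNReal.tendsto_coe_atTop.2 tendsto_id).const_mul_atTop hΛ0
  refine (h1.comp h2).congr fun t => ?_
  simp only [Function.comp]
  rw [(hX.hasSum_integral_gap ha hb hC t).tsum_eq, ← mul_assoc, ← Real.exp_add, neg_add_cancel,
    Real.exp_zero, one_mul]

end IsExclusionProcess
end Paths

/-! ### A strong law for Dynkin martingales -/

section StrongLaw

variable {N : ℕ} {a b : Fin (N + 1) → ℝ} {Ω : Type*} [mΩ : MeasurableSpace Ω] {P : Measure Ω}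
  [IsProbabilityMeasure P]

theorem _root_.MeasureTheory.Martingale.integral_mul_eq {ι : Type*} [Preorder ι]
    {ℱ : Filtration ι mΩ} {M : ι → Ω → ℝ} (hM : Martingale M ℱ P) {u v : ι} (huv : u ≤ v)
    {g : Ω → ℝ} (hg : StronglyMeasurable[ℱ u] g) {D : ℝ} (hD : ∀ ω, |g ω| ≤ D) :
    ∫ ω, g ω * M v ω ∂P = ∫ ω, g ω * M u ω ∂P := by
  have hint : Integrable (g * M v) P :=
    (hM.integrable v).bdd_mul (c := D) (hg.mono (ℱ.le u)).aestronglyMeasurable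
      (ae_of_all _ hD)
  have h1 := condExp_mul_of_stronglyMeasurable_left hg hint (hM.integrable v)
  have h2 := integral_condExp (μ := P) (f := g * M v) (ℱ.le u)
  calc ∫ ω, g ω * M v ω ∂P = ∫ ω, (P[g * M v | ℱ u]) ω ∂P := h2.symm
    _ = ∫ ω, g ω * M u ω ∂P := integral_congr_ae (by
        filter_upwards [h1, hM.condExp_ae_eq huv] with ω h3 h4
        rw [h3, Pi.mul_apply, h4])

/-- Doob's maximal inequality along a nondecreasing sequence of times. -/
theorem _root_.MeasureTheory.Martingale.maximal_sequence {ℱ : Filtration ℝ≥0 mΩ}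
    {M : ℝ≥0 → Ω → ℝ} (hM : Martingale M ℱ P) {τ : ℕ → ℝ≥0} (hτ : Monotone τ) (n : ℕ)
    {lam : ℝ≥0} :
    lam * P {ω | ∃ k ≤ n, (lam : ℝ) ≤ |M (τ k) ω|} ≤ ENNReal.ofReal (∫ ω, |M (τ n) ω| ∂P) := by
  set 𝒢 : Filtration ℕ mΩ := ⟨fun k => ℱ (τ k), fun i j h => ℱ.mono (hτ h), fun k => ℱ.le _⟩
  have hM' : Martingale (fun k => M (τ k)) 𝒢 P :=
    ⟨fun k => hM.1 (τ k), fun i j h => hM.2 (τ i) (τ j) (hτ h)⟩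
  have hsub : Submartingale (fun k ω => |M (τ k) ω|) 𝒢 P := by
    have := hM'.submartingale.sup hM'.neg.submartingale
    exact this
  have h1 := maximal_ineq hsub (fun k ω => abs_nonneg _) (ε := lam) n
  have h2 : {ω | (lam : ℝ) ≤ (Finset.range (n + 1)).sup' Finset.nonempty_range_add_one
      fun k => |M (τ k) ω|} = {ω | ∃ k ≤ n, (lam : ℝ) ≤ |M (τ k) ω|} := by
    ext ω
    simp only [Set.mem_ofPred_eq, Finset.le_sup'_iff, Finset.mem_range, Nat.lt_succ_iff]
  rw [h2] at h1
  refine h1.trans (ENNReal.ofReal_le_ofReal ?_)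
  exact setIntegral_le_integral (hM.integrable _).abs (ae_of_all _ fun ω => abs_nonneg _)

/-- Truncation of a real number to `[-R, R]`. -/
def clip (R : ℕ) (y : ℝ) : ℝ := max (-R) (min y R)

theorem abs_clip_le (R : ℕ) (y : ℝ) : |clip R y| ≤ R := by
  have : (0 : ℝ) ≤ R := Nat.cast_nonneg R
  unfold clip
  rw [abs_le]
  exact ⟨le_max_left _ _, max_le (by linarith) (min_le_right _ _)⟩

theorem abs_clip_sub_clip_le (R : ℕ) (y z : ℝ) : |clip R y - clip R z| ≤ |y - z| := by
  unfold clip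
  refine (abs_max_sub_max_le_max _ _ _ _).trans ?_
  rw [sub_self, abs_zero, max_eq_right (abs_nonneg _)]
  refine (abs_min_sub_min_le_max _ _ _ _).trans ?_
  rw [sub_self, abs_zero, max_eq_left (abs_nonneg _)]

theorem clip_eq {R : ℕ} {y : ℝ} (h : |y| ≤ R) : clip R y = y := by
  rw [abs_le] at h
  unfold clip
  rw [min_eq_left h.2, max_eq_right h.1]

/-- No attempted jump changes the value of `f` by more than one. -/
def UnitJumps (f : Config N → ℝ) : Prop :=
  ∀ x i, |f (x.jumpRight i) - f x| ≤ 1 ∧ |f (x.jumpLeft i) - f x| ≤ 1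

/-- The Dynkin martingale `f(X_t) - ∫₀ᵗ (L f)(X_s) ds` of `f`, where `L` is the generator. -/
def dynkin (a b : Fin (N + 1) → ℝ) (X : ℝ≥0 → Ω → Config N) (f : Config N → ℝ) (t : ℝ≥0)
    (ω : Ω) : ℝ :=
  f (X t ω) - ∫ s in (0 : ℝ)..t, generator a b f (X s.toNNReal ω)

theorem UnitJumps.abs_generator_le (ha : ∀ i, 0 ≤ a i) (hb : ∀ i, 0 < b i) {f : Config N → ℝ}
    (hf : UnitJumps f) (x : Config N) : |generator a b f x| ≤ jumpRate a b := by
  have := ExclusionClouds.abs_generator_le ha hb (fun i => (hf x i).1) fun i => (hf x i).2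
  rwa [mul_one] at this

theorem UnitJumps.clip {f : Config N → ℝ} (hf : UnitJumps f) (R : ℕ) :
    UnitJumps fun x => clip R (f x) := fun x i =>
  ⟨(abs_clip_sub_clip_le _ _ _).trans (hf x i).1, (abs_clip_sub_clip_le _ _ _).trans (hf x i).2⟩

theorem UnitJumps.generator_clip {f : Config N → ℝ} (hf : UnitJumps f) {R : ℕ} {x : Config N}
    (hR : |f x| + 1 ≤ R) :
    generator a b (fun x => ExclusionClouds.clip R (f x)) x = generator a b f x := by
  unfold generator
  have h0 : ExclusionClouds.clip R (f x) = f x := clip_eq (by linarith)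
  have h1 : ∀ y, |f y - f x| ≤ 1 → ExclusionClouds.clip R (f y) = f y := fun y hy => clip_eq (by
    have h2 : |f y| ≤ |f y - f x| + |f x| := by
      simpa using abs_add_le (f y - f x) (f x)
    linarith)
  refine Finset.sum_congr rfl fun i _ => ?_
  simp only [h0, h1 _ (hf x i).1, h1 _ (hf x i).2]

theorem jumpRate_nonneg (ha : ∀ i, 0 ≤ a i) (hb : ∀ i, 0 < b i) : 0 ≤ jumpRate a b :=
  Finset.sum_nonneg fun i _ => add_nonneg (hb i).le (ha i)

namespace IsExclusionProcess

variable {x₀ : Config N} {X : ℝ≥0 → Ω → Config N} (hX : IsExclusionProcess a b x₀ P X)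
  (ha : ∀ i, 0 ≤ a i) (hb : ∀ i, 0 < b i)

include hX

theorem stronglyMeasurable_natural (f : Config N → ℝ) (u : ℝ≥0) :
    StronglyMeasurable[Filtration.natural X (fun t => (hX.measurable t).stronglyMeasurable) u]
      fun ω => f (X u ω) := by
  have h1 := (Filtration.stronglyAdapted_natural
    (fun t => (hX.measurable t).stronglyMeasurable)) u
  have h2 : StronglyMeasurable f := Measurable.of_discrete.stronglyMeasurable
  exact (h2.measurable.comp h1.measurable).stronglyMeasurable

include ha hb

theorem intervalIntegrable_generator {f : Config N → ℝ} (hf : UnitJumps f) (ω : Ω) (u v : ℝ) :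
    IntervalIntegrable (fun s : ℝ => generator a b f (X s.toNNReal ω)) volume u v :=
  intervalIntegrable_of_bounded (hX.measurable_path _ ω)
    (fun _ => hf.abs_generator_le ha hb _) u v

theorem dynkin_sub {f : Config N → ℝ} (hf : UnitJumps f) (u v : ℝ≥0) (ω : Ω) :
    dynkin a b X f v ω - dynkin a b X f u ω =
      f (X v ω) - f (X u ω) - ∫ s in (u : ℝ)..v, generator a b f (X s.toNNReal ω) := by
  have h := hX.intervalIntegrable_generator ha hb hf ω
  unfold dynkin
  rw [← intervalIntegral.integral_interval_sub_left (h 0 v) (h 0 u)]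
  ring

theorem measurable_dynkin (f : Config N → ℝ) (t : ℝ≥0) : Measurable (dynkin a b X f t) :=
  (hX.measurable_comp f t).sub (measurable_intervalIntegral (hX.measurable_joint _) t.coe_nonneg)

theorem abs_dynkin_le {f : Config N → ℝ} (hf : UnitJumps f) {C : ℝ} (hC : ∀ x, |f x| ≤ C)
    (t : ℝ≥0) (ω : Ω) : |dynkin a b X f t ω| ≤ C + jumpRate a b * (t - 0) := by
  unfold dynkin
  refine (abs_sub _ _).trans (add_le_add (hC _) ?_)
  exact abs_intervalIntegral_le (fun s => hf.abs_generator_le ha hb _) t.coe_nonneg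

/-- A one-step bound towards a Gronwall estimate for the variance of increments. -/
theorem integral_sq_increment_le_step {f : Config N → ℝ} (hf : UnitJumps f) {C : ℝ}
    (hC : ∀ x, |f x| ≤ C) {u : ℝ≥0} {B : ℝ} {v : ℝ≥0} (huv : u ≤ v)
    (hB : ∀ s : ℝ≥0, u ≤ s → s ≤ v → ∫ ω, (f (X s ω) - f (X u ω)) ^ 2 ∂P ≤ B) :
    ∫ ω, (f (X v ω) - f (X u ω)) ^ 2 ∂P ≤
      (2 * jumpRate a b + jumpRate a b * B) * (v - u) := by
  set J := jumpRate a b with hJ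
  have hJ0 : 0 ≤ J := jumpRate_nonneg ha hb
  have hC0 : 0 ≤ C := (abs_nonneg _).trans (hC x₀)
  have hL : ∀ x, |generator a b f x| ≤ J := hf.abs_generator_le ha hb
  have hsqb : ∀ x, |f x ^ 2| ≤ C ^ 2 := fun x => by
    rw [abs_pow]; exact pow_le_pow_left₀ (abs_nonneg _) (hC x) 2
  have hLsq : ∀ x, |generator a b (fun x => f x ^ 2) x| ≤ J * (2 * C ^ 2) :=
    abs_generator_le_of_bounded ha hb hsqb
  -- the carré du champ of `f` is bounded by the total jump rate
  have hΓ : ∀ x, generator a b (fun x => f x ^ 2) x ≤ J + 2 * f x * generator a b f x := fun x => by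
    rw [hJ, ← sub_le_iff_le_add]
    unfold generator jumpRate
    rw [Finset.mul_sum, ← Finset.sum_sub_distrib]
    refine Finset.sum_le_sum fun i _ => ?_
    have h1 : (f (x.jumpRight i) - f x) ^ 2 ≤ 1 := by
      rw [← sq_abs]; exact pow_le_one₀ (abs_nonneg _) (hf x i).1
    have h2 : (f (x.jumpLeft i) - f x) ^ 2 ≤ 1 := by
      rw [← sq_abs]; exact pow_le_one₀ (abs_nonneg _) (hf x i).2
    have h3 := mul_le_mul_of_nonneg_left h1 (hb i).le
    have h4 := mul_le_mul_of_nonneg_left h2 (ha i)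
    nlinarith
  have huv' : (u : ℝ) ≤ v := by exact_mod_cast huv
  have hmart := hX.martingale f ⟨C, hC⟩
  -- the second moment
  have h1 : ∫ ω, f (X v ω) ^ 2 ∂P - ∫ ω, f (X u ω) ^ 2 ∂P =
      ∫ s in (u : ℝ)..v, ∫ ω, generator a b (fun x => f x ^ 2) (X s.toNNReal ω) ∂P := by
    have hii : ∀ c d : ℝ, IntervalIntegrable (fun s : ℝ =>
        ∫ ω, generator a b (fun x => f x ^ 2) (X s.toNNReal ω) ∂P) volume c d :=
      intervalIntegrable_of_bounded (measurable_integral_left (hX.measurable_joint _))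
        (fun s => abs_integral_le_of_bounded fun ω => hLsq _)
    rw [hX.integral_eq ha hb hsqb v, hX.integral_eq ha hb hsqb u,
      ← intervalIntegral.integral_interval_sub_left (hii 0 v) (hii 0 u)]
    ring
  -- the mixed moment
  have h2 : ∫ ω, f (X u ω) * f (X v ω) ∂P - ∫ ω, f (X u ω) ^ 2 ∂P =
      ∫ s in (u : ℝ)..v, ∫ ω, f (X u ω) * generator a b f (X s.toNNReal ω) ∂P := by
    have h3 := hmart.integral_mul_eq huv (hX.stronglyMeasurable_natural f u) (fun ω => hC _)
    have hmul : Measurable fun p : ℝ × Ω => f (X u p.2) * generator a b f (X p.1.toNNReal p.2) :=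
      ((hX.measurable_comp f u).comp measurable_snd).mul (hX.measurable_joint _)
    have hmulb : ∀ p : ℝ × Ω, |f (X u p.2) * generator a b f (X p.1.toNNReal p.2)| ≤ C * J :=
      fun p => by
        rw [abs_mul]
        exact mul_le_mul (hC _) (hL _) (abs_nonneg _) hC0
    rw [← integral_intervalIntegral_swap hmul hmulb huv']
    have hd : ∀ w : ℝ≥0, Integrable (fun ω => f (X u ω) * dynkin a b X f w ω) P := fun w => by
      refine Integrable.of_bound (C := C * (C + J * (w - 0)))
        ((hX.measurable_comp f u).mul
          (hX.measurable_dynkin ha hb f w)).aestronglyMeasurable (ae_of_all _ fun ω => ?_)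
      rw [norm_mul]
      exact mul_le_mul (hC _) (hX.abs_dynkin_le ha hb hf hC w ω) (norm_nonneg _) hC0
    have h4 : ∫ ω, f (X u ω) * (dynkin a b X f v ω - dynkin a b X f u ω) ∂P = 0 := by
      simp only [mul_sub]
      rw [integral_sub (hd v) (hd u)]
      exact sub_eq_zero.2 h3
    simp only [hX.dynkin_sub ha hb hf, mul_sub] at h4
    have i1 : Integrable (fun ω => f (X u ω) * f (X v ω)) P :=
      Integrable.of_bound (C := C * C)
        ((hX.measurable_comp f u).mul (hX.measurable_comp f v)).aestronglyMeasurable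
        (ae_of_all _ fun ω => by
          rw [norm_mul]
          exact mul_le_mul (hC _) (hC _) (norm_nonneg _) hC0)
    have i2 : Integrable (fun ω => f (X u ω) * f (X u ω)) P :=
      Integrable.of_bound (C := C * C)
        ((hX.measurable_comp f u).mul (hX.measurable_comp f u)).aestronglyMeasurable
        (ae_of_all _ fun ω => by
          rw [norm_mul]
          exact mul_le_mul (hC _) (hC _) (norm_nonneg _) hC0)
    have i3 : Integrable (fun ω =>
        f (X u ω) * ∫ s in (u : ℝ)..v, generator a b f (X s.toNNReal ω)) P :=
      Integrable.of_bound (C := C * (J * (v - u)))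
        ((hX.measurable_comp f u).mul
          (measurable_intervalIntegral (hX.measurable_joint _) huv')).aestronglyMeasurable
        (ae_of_all _ fun ω => by
          rw [norm_mul]
          exact mul_le_mul (hC _) (abs_intervalIntegral_le (fun s => hL _) huv')
            (norm_nonneg _) hC0)
    have i4 : Integrable (fun ω => f (X u ω) * f (X v ω) - f (X u ω) * f (X u ω)) P := i1.sub i2
    rw [integral_sub i4 i3, integral_sub i1 i2] at h4
    simp only [intervalIntegral.integral_const_mul, sq]
    linarith
  have hsum : ∫ ω, (f (X v ω) - f (X u ω)) ^ 2 ∂P =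
      (∫ ω, f (X v ω) ^ 2 ∂P - ∫ ω, f (X u ω) ^ 2 ∂P) -
        2 * (∫ ω, f (X u ω) * f (X v ω) ∂P - ∫ ω, f (X u ω) ^ 2 ∂P) := by
    have e1 : ∀ ω, (f (X v ω) - f (X u ω)) ^ 2 =
        f (X v ω) ^ 2 - 2 * (f (X u ω) * f (X v ω)) + f (X u ω) ^ 2 := fun ω => by ring
    have i1 : Integrable (fun ω => f (X u ω) * f (X v ω)) P :=
      Integrable.of_bound (C := C * C)
        ((hX.measurable_comp f u).mul (hX.measurable_comp f v)).aestronglyMeasurable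
        (ae_of_all _ fun ω => by
          rw [norm_mul]
          exact mul_le_mul (hC _) (hC _) (norm_nonneg _) hC0)
    have i2 := hX.integrable_comp hsqb
    simp only [e1]
    have i3 : Integrable (fun ω => f (X v ω) ^ 2 - 2 * (f (X u ω) * f (X v ω))) P :=
      (i2 v).sub (i1.const_mul 2)
    rw [integral_add i3 (i2 u), integral_sub (i2 v) (i1.const_mul 2),
      integral_const_mul]
    ring
  have hii1 : IntervalIntegrable (fun s : ℝ =>
      ∫ ω, generator a b (fun x => f x ^ 2) (X s.toNNReal ω) ∂P) volume u v :=
    intervalIntegrable_of_bounded (measurable_integral_left (hX.measurable_joint _))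
      (fun s => abs_integral_le_of_bounded fun ω => hLsq _) _ _
  have hii2 : IntervalIntegrable (fun s : ℝ =>
      ∫ ω, f (X u ω) * generator a b f (X s.toNNReal ω) ∂P) volume u v := by
    refine intervalIntegrable_of_bounded (C := C * J) (measurable_integral_left
      (φ := fun p : ℝ × Ω => f (X u p.2) * generator a b f (X p.1.toNNReal p.2))
      (((hX.measurable_comp f u).comp measurable_snd).mul (hX.measurable_joint _)))
      (fun s => abs_integral_le_of_bounded fun ω => ?_) _ _
    rw [abs_mul]
    exact mul_le_mul (hC _) (hL _) (abs_nonneg _) hC0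
  rw [hsum, h1, h2, ← intervalIntegral.integral_const_mul,
    ← intervalIntegral.integral_sub hii1 (hii2.const_mul 2)]
  have hbound : ∀ s ∈ Set.Icc (u : ℝ) v,
      ∫ ω, generator a b (fun x => f x ^ 2) (X s.toNNReal ω) ∂P -
        2 * ∫ ω, f (X u ω) * generator a b f (X s.toNNReal ω) ∂P ≤ 2 * J + J * B := by
    intro s hs
    have hs1 : u ≤ s.toNNReal := NNReal.le_toNNReal_of_coe_le hs.1
    have hs2 : s.toNNReal ≤ v := Real.toNNReal_le_iff_le_coe.2 hs.2
    have i1 := hX.integrable_comp hLsq s.toNNReal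
    have i2 : Integrable (fun ω => f (X u ω) * generator a b f (X s.toNNReal ω)) P :=
      Integrable.of_bound (C := C * J)
        ((hX.measurable_comp f u).mul (hX.measurable_comp _ _)).aestronglyMeasurable
        (ae_of_all _ fun ω => by
          rw [norm_mul]
          exact mul_le_mul (hC _) (hL _) (norm_nonneg _) hC0)
    have i3 : Integrable (fun ω => (f (X s.toNNReal ω) - f (X u ω)) ^ 2) P :=
      Integrable.of_bound (C := (2 * C) ^ 2)
        (((hX.measurable_comp f _).sub (hX.measurable_comp f u)).pow_const 2).aestronglyMeasurable
        (ae_of_all _ fun ω => by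
          rw [norm_pow]
          refine pow_le_pow_left₀ (norm_nonneg _) ((abs_sub _ _).trans ?_) 2
          linarith [hC (X s.toNNReal ω), hC (X u ω)])
    rw [← integral_const_mul, ← integral_sub i1 (i2.const_mul 2)]
    have h5 : ∫ ω, (generator a b (fun x => f x ^ 2) (X s.toNNReal ω) -
        2 * (f (X u ω) * generator a b f (X s.toNNReal ω))) ∂P ≤
        ∫ ω, (2 * J + J * (f (X s.toNNReal ω) - f (X u ω)) ^ 2) ∂P := by
      refine integral_mono (i1.sub (i2.const_mul 2))
        ((integrable_const _).add (i3.const_mul J)) fun ω => ?_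
      have h6 := hΓ (X s.toNNReal ω)
      have h7 := abs_le.1 (hL (X s.toNNReal ω))
      set y := f (X s.toNNReal ω) - f (X u ω) with hy
      set g := generator a b f (X s.toNNReal ω)
      have h8 : 2 * y * g ≤ J * (1 + y ^ 2) := by
        rcases le_total 0 y with h9 | h9
        · nlinarith [sq_nonneg (y - 1)]
        · nlinarith [sq_nonneg (y + 1)]
      simp only
      have h10 : f (X s.toNNReal ω) = y + f (X u ω) := by rw [hy]; ring
      rw [h10] at h6
      linarith
    refine h5.trans ?_
    rw [integral_add (integrable_const _) (i3.const_mul J)]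
    simp only [integral_const_mul, integral_const, probReal_univ, one_smul]
    exact add_le_add le_rfl (mul_le_mul_of_nonneg_left (hB _ hs1 hs2) hJ0)
  have h6 := intervalIntegral.integral_mono_on huv' (hii1.sub (hii2.const_mul 2))
    (intervalIntegrable_const (c := 2 * J + J * B)) hbound
  rw [intervalIntegral.integral_const, smul_eq_mul] at h6
  linarith

/-- The bound depends neither on `f` nor on the bound `C`, so that it survives the removal of
truncations. -/
theorem integral_sq_increment_le {f : Config N → ℝ} (hf : UnitJumps f) {C : ℝ}
    (hC : ∀ x, |f x| ≤ C) {u v : ℝ≥0} (huv : u ≤ v)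
    (hvu : ((v : ℝ) - u) * (2 * (jumpRate a b + 1)) ≤ 1) :
    ∫ ω, (f (X v ω) - f (X u ω)) ^ 2 ∂P ≤ 2 := by
  set J := jumpRate a b with hJ
  have hJ0 : 0 ≤ J := jumpRate_nonneg ha hb
  -- a bound `B` on short time intervals improves to `1 + B / 2`
  have key : ∀ k : ℕ, ∀ w : ℝ≥0, u ≤ w → w ≤ v →
      ∫ ω, (f (X w ω) - f (X u ω)) ^ 2 ∂P ≤ 2 + (2 * C) ^ 2 * (1 / 2) ^ k := by
    intro k
    induction k with
    | zero =>
      intro w _ _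
      refine (le_abs_self _).trans ((abs_integral_le_of_bounded (C := (2 * C) ^ 2)
        fun ω => ?_).trans (by simp))
      rw [abs_pow]
      refine pow_le_pow_left₀ (abs_nonneg _) ((abs_sub _ _).trans ?_) 2
      linarith [hC (X w ω), hC (X u ω)]
    | succ k ih =>
      intro w huw hwv
      refine (hX.integral_sq_increment_le_step ha hb hf hC huw
        fun s hus hsw => ih s hus (hsw.trans hwv)).trans ?_
      have h1 : (u : ℝ) ≤ w := by exact_mod_cast huw
      have h2 : (w : ℝ) ≤ v := by exact_mod_cast hwv
      have h3 : 0 ≤ (2 * C) ^ 2 * (1 / 2 : ℝ) ^ k := by positivity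
      have h5 : ((w : ℝ) - u) * (2 * (J + 1)) ≤ 1 :=
        (mul_le_mul_of_nonneg_right (by linarith) (by linarith)).trans hvu
      have h6 : J * ((w : ℝ) - u) ≤ 1 / 2 := by nlinarith
      calc (2 * J + J * (2 + (2 * C) ^ 2 * (1 / 2) ^ k)) * ((w : ℝ) - u)
          = (J * ((w : ℝ) - u)) * (4 + (2 * C) ^ 2 * (1 / 2) ^ k) := by ring
        _ ≤ 1 / 2 * (4 + (2 * C) ^ 2 * (1 / 2) ^ k) :=
            mul_le_mul_of_nonneg_right h6 (by linarith)
        _ = 2 + (2 * C) ^ 2 * (1 / 2) ^ (k + 1) := by rw [pow_succ]; ring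
  have hlim : Tendsto (fun k : ℕ => 2 + (2 * C) ^ 2 * (1 / 2 : ℝ) ^ k) atTop (𝓝 2) := by
    have h1 := ((tendsto_pow_atTop_nhds_zero_of_lt_one (r := (1 / 2 : ℝ)) (by norm_num)
      (by norm_num)).const_mul ((2 * C) ^ 2)).const_add 2
    simpa using h1
  exact ge_of_tendsto' hlim fun k => key k v huv le_rfl

/-- The second moment of a Dynkin martingale grows at most linearly, uniformly over functions with unit
jumps. -/
theorem integral_sq_dynkin_le {f : Config N → ℝ} (hf : UnitJumps f) {C : ℝ}
    (hC : ∀ x, |f x| ≤ C) (h0 : f x₀ = 0) (n : ℕ) {t : ℝ≥0}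
    (ht : (t : ℝ) * (2 * (jumpRate a b + 1)) ≤ n) :
    ∫ ω, dynkin a b X f t ω ^ 2 ∂P ≤ 5 * n := by
  set J := jumpRate a b with hJ
  have hJ0 : 0 ≤ J := jumpRate_nonneg ha hb
  have hmart := hX.martingale f ⟨C, hC⟩
  have hb' := hX.abs_dynkin_le ha hb hf hC
  have hmeas := hX.measurable_dynkin ha hb f
  induction n generalizing t with
  | zero =>
    have ht0 : t = 0 := by
      have h1 : (t : ℝ) ≤ 0 := by
        by_contra hlt
        rw [not_le] at hlt
        have : 0 < (t : ℝ) * (2 * (J + 1)) := by positivity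
        simp only [Nat.cast_zero] at ht
        linarith
      exact le_antisymm (by exact_mod_cast h1) zero_le
    have h2 : (fun ω => dynkin a b X f t ω ^ 2) =ᵐ[P] fun _ => 0 := by
      filter_upwards [hX.initial] with ω hω
      simp [dynkin, ht0, hω, h0]
    rw [integral_congr_ae h2]
    simp
  | succ n ih =>
    set h : ℝ≥0 := ⟨1 / (2 * (J + 1)), by positivity⟩ with hh
    have hhc : (h : ℝ) = 1 / (2 * (J + 1)) := rfl
    set u : ℝ≥0 := t - h with hu
    have hut : u ≤ t := tsub_le_self
    have huc : (t : ℝ) - u ≤ h := by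
      have : t ≤ u + h := by rw [hu]; exact le_tsub_add
      have : (t : ℝ) ≤ u + h := by exact_mod_cast this
      linarith
    have hpos : 0 < 2 * (J + 1) := by positivity
    have hun : (u : ℝ) * (2 * (J + 1)) ≤ n := by
      rcases le_total h t with hht | hht
      · rw [hu, NNReal.coe_sub hht, sub_mul, hhc, one_div, inv_mul_cancel₀ hpos.ne']
        push_cast at ht
        linarith
      · rw [hu, tsub_eq_zero_of_le hht, NNReal.coe_zero, zero_mul]
        exact Nat.cast_nonneg n
    have hut' : (u : ℝ) ≤ t := by exact_mod_cast hut
    have hvar := hX.integral_sq_increment_le ha hb hf hC hut (by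
      rw [hhc, le_div_iff₀ hpos] at huc
      exact huc)
    have hincr : ∫ ω, (dynkin a b X f t ω - dynkin a b X f u ω) ^ 2 ∂P ≤ 5 := by
      have h1 : ∫ ω, (dynkin a b X f t ω - dynkin a b X f u ω) ^ 2 ∂P ≤
          ∫ ω, (2 * (f (X t ω) - f (X u ω)) ^ 2 + 1) ∂P := by
        refine integral_mono_of_nonneg (ae_of_all _ fun ω => sq_nonneg _) ?_
          (ae_of_all _ fun ω => ?_)
        · refine (Integrable.const_mul ?_ 2).add (integrable_const _)
          refine Integrable.of_bound (C := (2 * C) ^ 2)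
            (((hX.measurable_comp f _).sub
              (hX.measurable_comp f u)).pow_const 2).aestronglyMeasurable
            (ae_of_all _ fun ω => ?_)
          rw [norm_pow]
          refine pow_le_pow_left₀ (norm_nonneg _) ((abs_sub _ _).trans ?_) 2
          linarith [hC (X t ω), hC (X u ω)]
        · simp only
          rw [hX.dynkin_sub ha hb hf]
          have h2 := abs_intervalIntegral_le (f := fun s : ℝ => generator a b f (X s.toNNReal ω))
            (fun s => hf.abs_generator_le ha hb (X s.toNNReal ω)) hut'
          set z := ∫ s in (u : ℝ)..t, generator a b f (X s.toNNReal ω)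
          have h3 : |z| ≤ 1 / 2 := by
            refine h2.trans ?_
            calc J * ((t : ℝ) - u) ≤ J * h := mul_le_mul_of_nonneg_left huc hJ0
              _ = J / (2 * (J + 1)) := by rw [hhc]; ring
              _ ≤ 1 / 2 := by rw [div_le_div_iff₀ hpos two_pos]; linarith
          have h4 : z ^ 2 ≤ 1 / 4 := by
            rw [← sq_abs]
            nlinarith [abs_nonneg z]
          nlinarith [sq_nonneg (f (X t ω) - f (X u ω) + z)]
      refine h1.trans ?_
      rw [integral_add, integral_const_mul]
      · simp only [integral_const, probReal_univ, one_smul]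
        linarith
      · refine Integrable.const_mul ?_ 2
        refine Integrable.of_bound (C := (2 * C) ^ 2)
            (((hX.measurable_comp f _).sub
              (hX.measurable_comp f u)).pow_const 2).aestronglyMeasurable
            (ae_of_all _ fun ω => ?_)
        rw [norm_pow]
        refine pow_le_pow_left₀ (norm_nonneg _) ((abs_sub _ _).trans ?_) 2
        linarith [hC (X t ω), hC (X u ω)]
      · exact integrable_const _
    -- increments of a martingale are orthogonal
    have horth := hmart.integral_mul_eq hut (hmart.1 u) (hb' u)
    have hprod : ∀ w w' : ℝ≥0,
        Integrable (fun ω => dynkin a b X f w ω * dynkin a b X f w' ω) P := fun w w' => by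
      refine Integrable.of_bound (C := (C + J * (w - 0)) * (C + J * (w' - 0)))
        ((hmeas w).mul (hmeas w')).aestronglyMeasurable (ae_of_all _ fun ω => ?_)
      rw [norm_mul]
      exact mul_le_mul (hb' w ω) (hb' w' ω) (norm_nonneg _)
        ((abs_nonneg _).trans (hb' w ω))
    have e1 : ∀ ω, dynkin a b X f t ω ^ 2 =
        (dynkin a b X f t ω - dynkin a b X f u ω) ^ 2 +
          (2 * (dynkin a b X f u ω * dynkin a b X f t ω) -
            dynkin a b X f u ω * dynkin a b X f u ω) := fun ω => by ring
    have e2 : ∀ ω, (dynkin a b X f t ω - dynkin a b X f u ω) ^ 2 =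
        dynkin a b X f t ω * dynkin a b X f t ω - 2 * (dynkin a b X f u ω * dynkin a b X f t ω) +
          dynkin a b X f u ω * dynkin a b X f u ω := fun ω => by ring
    have hi : Integrable (fun ω => (dynkin a b X f t ω - dynkin a b X f u ω) ^ 2) P := by
      simp only [e2]
      exact ((hprod t t).sub ((hprod u t).const_mul 2)).add (hprod u u)
    have hih := ih hun
    simp only [sq (dynkin a b X f u _)] at hih
    have horth' : ∫ ω, dynkin a b X f u ω * dynkin a b X f t ω ∂P =
      ∫ ω, dynkin a b X f u ω * dynkin a b X f u ω ∂P := horth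
    simp only [e1]
    have hi' : Integrable (fun ω => 2 * (dynkin a b X f u ω * dynkin a b X f t ω) -
        dynkin a b X f u ω * dynkin a b X f u ω) P :=
      ((hprod u t).const_mul 2).sub (hprod u u)
    rw [integral_add hi hi', integral_sub ((hprod u t).const_mul 2) (hprod u u), integral_const_mul, horth']
    push_cast
    linarith

end IsExclusionProcess
end StrongLaw

section StrongLawLimit

variable {N : ℕ} {a b : Fin (N + 1) → ℝ} {Ω : Type*} [mΩ : MeasurableSpace Ω] {P : Measure Ω}
  [IsProbabilityMeasure P]

theorem measure_le_of_eventually_mem {S : Set Ω} {s : ℕ → Set Ω} {c : ℝ≥0∞}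
    (hS : ∀ ω ∈ S, ∀ᶠ R in atTop, ω ∈ s R) (hs : ∀ R, P (s R) ≤ c) : P S ≤ c := by
  have hsub : S ⊆ ⋃ n, ⋂ R ≥ n, s R := fun ω hω => by
    obtain ⟨n, hn⟩ := eventually_atTop.1 (hS ω hω)
    exact Set.mem_iUnion.2 ⟨n, Set.mem_iInter₂.2 hn⟩
  have hmono : Monotone fun n => ⋂ R ≥ n, s R := fun m n hmn =>
    Set.biInter_mono (fun R (hR : n ≤ R) => hmn.trans hR) fun _ _ => le_rfl
  refine (measure_mono hsub).trans ?_
  rw [hmono.measure_iUnion]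
  exact iSup_le fun n => (measure_mono (Set.biInter_subset_of_mem (le_refl n))).trans (hs n)

namespace IsExclusionProcess

variable {x₀ : Config N} {X : ℝ≥0 → Ω → Config N} (hX : IsExclusionProcess a b x₀ P X)
  (ha : ∀ i, 0 ≤ a i) (hb : ∀ i, 0 < b i)

include hX ha hb

/-- First moments at the times `4 ^ n`, from second moments by `2 s |M| ≤ M ^ 2 + s ^ 2` with
`s = 2 ^ n`. -/
theorem integral_abs_dynkin_le {f : Config N → ℝ} (hf : UnitJumps f) {C : ℝ}
    (hC : ∀ x, |f x| ≤ C) (h0 : f x₀ = 0) (n : ℕ) :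
    ∫ ω, |dynkin a b X f (4 ^ n) ω| ∂P ≤ (5 * jumpRate a b + 8) * 2 ^ n := by
  set J := jumpRate a b with hJ
  have hJ0 : 0 ≤ J := jumpRate_nonneg ha hb
  have hceil := Nat.le_ceil ((4 : ℝ) ^ n * (2 * (J + 1)))
  have hceil' := (Nat.ceil_lt_add_one (a := (4 : ℝ) ^ n * (2 * (J + 1))) (by positivity)).le
  have h1 := hX.integral_sq_dynkin_le ha hb hf hC h0 ⌈(4 : ℝ) ^ n * (2 * (J + 1))⌉₊ (t := 4 ^ n)
    (by push_cast; exact hceil)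
  have hb' := hX.abs_dynkin_le ha hb hf hC (4 ^ n)
  have hmeas := hX.measurable_dynkin ha hb f (4 ^ n)
  set M := dynkin a b X f (4 ^ n) with hM
  set D := C + J * (((4 ^ n : ℝ≥0) : ℝ) - 0) with hD
  have h2 : (0 : ℝ) < 2 ^ n := by positivity
  have h4 : (4 : ℝ) ^ n = 2 ^ n * 2 ^ n := by rw [← mul_pow]; norm_num
  have i1 : Integrable (fun ω => |M ω|) P :=
    Integrable.of_bound (C := D) hmeas.abs.aestronglyMeasurable (ae_of_all _ fun ω => by
      rw [Real.norm_eq_abs, abs_abs]; exact hb' ω)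
  have i2 : Integrable (fun ω => M ω ^ 2) P :=
    Integrable.of_bound (C := D ^ 2) (hmeas.pow_const 2).aestronglyMeasurable
      (ae_of_all _ fun ω => by
        rw [norm_pow]; exact pow_le_pow_left₀ (norm_nonneg _) (hb' ω) 2)
  have h5 : ∫ ω, 2 * 2 ^ n * |M ω| ∂P ≤ ∫ ω, (M ω ^ 2 + 4 ^ n) ∂P :=
    integral_mono (i1.const_mul _) (i2.add (integrable_const _)) fun ω => by
      simp only
      rw [h4, ← sq_abs (M ω)]
      nlinarith [sq_nonneg (|M ω| - 2 ^ n)]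
  rw [integral_const_mul, integral_add i2 (integrable_const _)] at h5
  simp only [integral_const, probReal_univ, one_smul] at h5
  have h6 : (1 : ℝ) ≤ 4 ^ n := one_le_pow₀ (by norm_num)
  have h7 : 2 * 2 ^ n * ∫ ω, |M ω| ∂P ≤ 2 * 2 ^ n * ((5 * J + 8) * 2 ^ n) := by
    calc 2 * 2 ^ n * ∫ ω, |M ω| ∂P ≤ 5 * (4 ^ n * (2 * (J + 1)) + 1) + 4 ^ n := by linarith
      _ ≤ 4 ^ n * (10 * J + 16) := by nlinarith
      _ = 2 * 2 ^ n * ((5 * J + 8) * 2 ^ n) := by rw [h4]; ring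
  exact le_of_mul_le_mul_left h7 (by positivity)

theorem tendsto_dynkin_clip {f : Config N → ℝ} (hf : UnitJumps f) (t : ℝ≥0) (ω : Ω) :
    Tendsto (fun R : ℕ => dynkin a b X (fun x => clip R (f x)) t ω) atTop
      (𝓝 (dynkin a b X f t ω)) := by
  have hev : ∀ x, ∀ᶠ R : ℕ in atTop, |f x| + 1 ≤ R := fun x =>
    tendsto_natCast_atTop_atTop.eventually_ge_atTop _
  refine Tendsto.sub ?_ ?_
  · refine tendsto_const_nhds.congr' ?_
    filter_upwards [hev (X t ω)] with R hR
    exact (clip_eq (by linarith)).symm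
  · refine intervalIntegral.tendsto_integral_filter_of_dominated_convergence
      (fun _ => jumpRate a b) (Eventually.of_forall fun R => ?_)
      (Eventually.of_forall fun R => ae_of_all _ fun s _ => ?_) intervalIntegrable_const
      (ae_of_all _ fun s _ => ?_)
    · exact (hX.measurable_path _ ω).aestronglyMeasurable
    · exact (hf.clip R).abs_generator_le ha hb _
    · refine tendsto_const_nhds.congr' ?_
      filter_upwards [hev (X s.toNNReal ω)] with R hR
      exact (hf.generator_clip hR).symm

theorem dynkin_rightContinuous {f : Config N → ℝ} (hf : UnitJumps f) (t : ℝ≥0) (ω : Ω) :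
    ContinuousWithinAt (fun s => dynkin a b X f s ω) (Set.Ici t) t := by
  refine ContinuousWithinAt.sub ?_ ?_
  · refine tendsto_const_nhds.congr' ?_
    filter_upwards [hX.rightContinuous ω t] with s hs
    rw [hs]
  · have h1 := intervalIntegral.continuous_primitive
      (hX.intervalIntegrable_generator ha hb hf ω) 0
    exact (h1.comp NNReal.continuous_coe).continuousWithinAt

/-- A maximal inequality for the Dynkin martingale on the time interval `[0, 4 ^ n)`: Doob's
inequality on finite grids, for truncations of `f`, passes to the limit by right-continuity. -/
theorem measure_exists_lt_dynkin_le {f : Config N → ℝ} (hf : UnitJumps f)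
    (h0 : f x₀ = 0) (n : ℕ) (lam : ℝ≥0) :
    P {ω | ∃ t : ℝ≥0, t < 4 ^ n ∧ (lam : ℝ) < |dynkin a b X f t ω|} ≤
      ENNReal.ofReal ((5 * jumpRate a b + 8) * 2 ^ n) / lam := by
  set c := ENNReal.ofReal ((5 * jumpRate a b + 8) * 2 ^ n) with hc
  set T : ℝ≥0 := 4 ^ n with hT
  have hT0 : 0 < T := by positivity
  set τ : ℕ → ℕ → ℝ≥0 := fun m k => T * (k / (m + 1 : ℕ)) with hτ
  have hτm : ∀ m, Monotone (τ m) := fun m k l hkl => by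
    simp only [hτ]; gcongr
  have hτT : ∀ m, τ m (m + 1) = T := fun m => by
    simp only [hτ]
    rw [div_self (by positivity), mul_one]
  have hgrid : ∀ m R : ℕ, P {ω | ∃ k ≤ m + 1,
      (lam : ℝ) ≤ |dynkin a b X (fun x => clip R (f x)) (τ m k) ω|} ≤ c / lam := fun m R => by
    have h1 := (hX.martingale (fun x => clip R (f x)) ⟨R, fun x => abs_clip_le R _⟩).maximal_sequence
      (hτm m) (m + 1) (lam := lam)
    have h2 := hX.integral_abs_dynkin_le ha hb (hf.clip R) (fun x => abs_clip_le R _)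
      (by rw [h0]; exact clip_eq (by simp)) n
    rw [hτT] at h1
    by_cases hl : lam = 0
    · rw [hl, ENNReal.coe_zero, ENNReal.div_zero]
      · exact le_top
      · rw [hc]
        have := jumpRate_nonneg ha hb
        exact (ENNReal.ofReal_pos.2 (by positivity)).ne'
    · rw [ENNReal.le_div_iff_mul_le (Or.inl (by exact_mod_cast hl)) (Or.inl ENNReal.coe_ne_top),
        mul_comm]
      exact h1.trans (ENNReal.ofReal_le_ofReal h2)
  have hgrid' : ∀ m : ℕ, P {ω | ∃ k ≤ m + 1, (lam : ℝ) < |dynkin a b X f (τ m k) ω|} ≤ c / lam :=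
    fun m => by
      refine measure_le_of_eventually_mem (fun ω hω => ?_) (hgrid m)
      obtain ⟨k, hk, hlt⟩ := hω
      have h1 := (hX.tendsto_dynkin_clip ha hb hf (τ m k) ω).abs
      filter_upwards [h1.eventually_const_lt hlt] with R hR
      exact ⟨k, hk, hR.le⟩
  refine measure_le_of_eventually_mem (fun ω hω => ?_) hgrid'
  obtain ⟨t, htT, hlt⟩ := hω
  have h1 : ∀ᶠ s in 𝓝[≥] t, (lam : ℝ) < |dynkin a b X f s ω| :=
    (hX.dynkin_rightContinuous ha hb hf t ω).abs.eventually_const_lt hlt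
  obtain ⟨v, hv, hvs⟩ := (mem_nhdsGE_iff_exists_Ico_subset' (htT)).1 h1
  have hv' : (0 : ℝ) < v - t := by
    have : (t : ℝ) < v := by exact_mod_cast hv
    linarith
  -- once the mesh is fine enough, the grid meets every right neighbourhood of `t`
  have hmesh : ∀ᶠ m : ℕ in atTop, (T : ℝ) / (v - t) < m :=
    tendsto_natCast_atTop_atTop.eventually_gt_atTop _
  filter_upwards [hmesh] with m hm
  have hT0' : (0 : ℝ) < T := by exact_mod_cast hT0
  have htT' : (t : ℝ) < T := by exact_mod_cast htT
  have hm0 : (0 : ℝ) < (m + 1 : ℕ) := by positivity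
  have hstep : (T : ℝ) / (m + 1 : ℕ) < v - t := by
    rw [div_lt_iff₀ hv'] at hm
    rw [div_lt_iff₀ hm0]
    push_cast
    nlinarith
  set k := ⌈(t : ℝ) * (m + 1 : ℕ) / T⌉₊ with hk
  have hk1 : (t : ℝ) * (m + 1 : ℕ) / T ≤ k := Nat.le_ceil _
  have hk2 : (k : ℝ) < (t : ℝ) * (m + 1 : ℕ) / T + 1 := Nat.ceil_lt_add_one (by positivity)
  have hτc : ((τ m k : ℝ≥0) : ℝ) = T * k / (m + 1 : ℕ) := by
    simp only [hτ, NNReal.coe_mul, NNReal.coe_div, NNReal.coe_natCast]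
    ring
  refine ⟨k, ?_, hvs ⟨?_, ?_⟩⟩
  · refine Nat.ceil_le.2 ?_
    rw [div_le_iff₀ hT0', mul_comm]
    exact mul_le_mul_of_nonneg_left htT'.le hm0.le
  · rw [← NNReal.coe_le_coe, hτc, le_div_iff₀ hm0]
    rw [div_le_iff₀ hT0'] at hk1
    linarith
  · rw [← NNReal.coe_lt_coe, hτc]
    have h2 : (T : ℝ) * k < t * (m + 1 : ℕ) + T := by
      have := mul_lt_mul_of_pos_left hk2 hT0'
      calc (T : ℝ) * k < T * (t * (m + 1 : ℕ) / T + 1) := this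
        _ = t * (m + 1 : ℕ) + T := by field_simp
    have h3 : (T : ℝ) * k / (m + 1 : ℕ) < t + T / (m + 1 : ℕ) := by
      rw [div_lt_iff₀ hm0, add_mul, div_mul_cancel₀ _ hm0.ne']
      exact h2
    linarith

/-- The strong law for Dynkin martingales of functions with unit jumps. On `[0, 4 ^ n)` the maximal
inequality at level `ε 4 ^ n` has the summable bound `O(2 ^ (-n) / ε)`; for `4 ^ n ≤ t < 4 ^ (n + 1)`
the martingale is then at most `ε 4 ^ (n + 1) ≤ 4 ε t`. -/
theorem ae_tendsto_dynkin_div {f : Config N → ℝ} (hf : UnitJumps f) :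
    ∀ᵐ ω ∂P, Tendsto (fun t : ℝ≥0 => dynkin a b X f t ω / t) atTop (𝓝 0) := by
  set g : Config N → ℝ := fun x => f x - f x₀ with hg
  have hgu : UnitJumps g := fun x i => by
    simp only [hg, sub_sub_sub_cancel_right]
    exact hf x i
  have hgen : ∀ x, generator a b g x = generator a b f x := fun x => by
    simp only [generator, hg, sub_sub_sub_cancel_right]
  have hdyn : ∀ t ω, dynkin a b X f t ω = dynkin a b X g t ω + f x₀ := fun t ω => by
    simp only [dynkin, hgen]
    simp only [hg]
    ring
  have hBC : ∀ q : ℕ, ∀ᵐ ω ∂P, ∀ᶠ n : ℕ in atTop, ω ∉ {ω | ∃ t : ℝ≥0, t < 4 ^ n ∧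
      (((1 / (q + 1 : ℕ) * 4 ^ n : ℝ≥0)) : ℝ) < |dynkin a b X g t ω|} := fun q => by
    refine ae_eventually_notMem (ne_top_of_le_ne_top ?_ (ENNReal.tsum_le_tsum fun n =>
      hX.measure_exists_lt_dynkin_le ha hb hgu (by simp [hg]) n _))
    have hK : 0 ≤ 5 * jumpRate a b + 8 := by
      have := jumpRate_nonneg ha hb
      positivity
    have h1 : ∀ n : ℕ, ENNReal.ofReal ((5 * jumpRate a b + 8) * 2 ^ n) /
        ((1 / (q + 1 : ℕ) * 4 ^ n : ℝ≥0) : ℝ≥0∞) =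
        ENNReal.ofReal ((5 * jumpRate a b + 8) * (q + 1 : ℕ) * (1 / 2) ^ n) := fun n => by
      have h2 : ((1 / (q + 1 : ℕ) * 4 ^ n : ℝ≥0) : ℝ≥0∞) =
          ENNReal.ofReal (1 / (q + 1 : ℕ) * 4 ^ n) := by
        rw [← ENNReal.ofReal_coe_nnreal]
        norm_num
      rw [h2, ← ENNReal.ofReal_div_of_pos (by positivity)]
      congr 1
      have h4 : (4 : ℝ) ^ n = 2 ^ n * 2 ^ n := by rw [← mul_pow]; norm_num
      rw [h4, one_div_pow]
      field_simp
    simp only [h1]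
    have hsum : Summable fun n : ℕ => (5 * jumpRate a b + 8) * (q + 1 : ℕ) * (1 / 2 : ℝ) ^ n :=
      summable_geometric_two.mul_left _
    rw [← ENNReal.ofReal_tsum_of_nonneg (fun n => by positivity) hsum]
    exact ENNReal.ofReal_ne_top
  filter_upwards [ae_all_iff.2 hBC] with ω hω
  have hgl : Tendsto (fun t : ℝ≥0 => dynkin a b X g t ω / t) atTop (𝓝 0) := by
    rw [Metric.tendsto_atTop]
    intro ε hε
    obtain ⟨q, hq⟩ := exists_nat_one_div_lt (show 0 < ε / 4 by positivity)
    obtain ⟨n₀, hn₀⟩ := eventually_atTop.1 (hω q)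
    refine ⟨4 ^ n₀, fun t ht => ?_⟩
    have ht' : (4 : ℝ) ^ n₀ ≤ t := by exact_mod_cast ht
    have ht1 : (1 : ℝ) ≤ t := le_trans (one_le_pow₀ (by norm_num)) ht'
    obtain ⟨n, hn1, hn2⟩ := exists_nat_pow_near ht1 (show (1 : ℝ) < 4 by norm_num)
    have hnn : n₀ ≤ n + 1 :=
      ((pow_lt_pow_iff_right₀ (show (1 : ℝ) < 4 by norm_num)).1 (ht'.trans_lt hn2)).le
    have h3 := hn₀ (n + 1) hnn
    have h4 : |dynkin a b X g t ω| ≤ 1 / (q + 1) * 4 ^ (n + 1) := by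
      by_contra hlt
      refine h3 ⟨t, by exact_mod_cast hn2, ?_⟩
      push_cast
      exact not_le.1 hlt
    have ht0 : (0 : ℝ) < t := by linarith
    rw [Real.dist_eq, sub_zero, abs_div, abs_of_pos ht0, div_lt_iff₀ ht0]
    have h5 : (0 : ℝ) < 1 / (q + 1) := by positivity
    calc |dynkin a b X g t ω| ≤ 1 / (q + 1) * 4 ^ (n + 1) := h4
      _ = 1 / (q + 1) * 4 * 4 ^ n := by rw [pow_succ]; ring
      _ ≤ 1 / (q + 1) * 4 * t := mul_le_mul_of_nonneg_left hn1 (by positivity)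
      _ < ε * t := mul_lt_mul_of_pos_right (by linarith) ht0
  have hcst : Tendsto (fun t : ℝ≥0 => f x₀ / (t : ℝ)) atTop (𝓝 0) :=
    tendsto_const_nhds.div_atTop (NNReal.tendsto_coe_atTop.2 tendsto_id)
  have := hgl.add hcst
  rw [add_zero] at this
  refine this.congr fun t => ?_
  rw [hdyn, add_div]

end IsExclusionProcess
end StrongLawLimit

/-! ### Time averages -/

section TimeAverage

variable {α : Type*}

/-- The average of `F` along the path `γ` over the time interval `[0, T]`. -/
def timeAvg (γ : ℝ → α) (F : α → ℝ) (T : ℝ≥0) : ℝ := 1 / (T : ℝ) * ∫ s in (0 : ℝ)..T, F (γ s)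

variable {γ : ℝ → α} (hγ : ∀ F : α → ℝ, Measurable fun s => F (γ s))

theorem timeAvg_const {T : ℝ≥0} (hT : 0 < T) (c : ℝ) : timeAvg γ (fun _ => c) T = c := by
  have : (0 : ℝ) < T := hT
  simp only [timeAvg, intervalIntegral.integral_const, smul_eq_mul, sub_zero]
  field_simp

theorem timeAvg_const_mul (c : ℝ) (F : α → ℝ) (T : ℝ≥0) :
    timeAvg γ (fun x => c * F x) T = c * timeAvg γ F T := by
  simp only [timeAvg, intervalIntegral.integral_const_mul]
  ring

include hγ

theorem timeAvg_add {F G : α → ℝ} {C C' : ℝ} (hF : ∀ x, |F x| ≤ C) (hG : ∀ x, |G x| ≤ C')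
    (T : ℝ≥0) : timeAvg γ (fun x => F x + G x) T = timeAvg γ F T + timeAvg γ G T := by
  unfold timeAvg
  rw [intervalIntegral.integral_add (intervalIntegrable_of_bounded (hγ F) (fun _ => hF _) _ _)
    (intervalIntegrable_of_bounded (hγ G) (fun _ => hG _) _ _), mul_add]

theorem timeAvg_mono {F G : α → ℝ} {C C' : ℝ} (hF : ∀ x, |F x| ≤ C) (hG : ∀ x, |G x| ≤ C')
    (h : ∀ x, F x ≤ G x) (T : ℝ≥0) : timeAvg γ F T ≤ timeAvg γ G T :=
  mul_le_mul_of_nonneg_left (intervalIntegral.integral_mono T.coe_nonneg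
    (intervalIntegrable_of_bounded (hγ F) (fun _ => hF _) _ _)
    (intervalIntegrable_of_bounded (hγ G) (fun _ => hG _) _ _) fun _ => h _)
    (one_div_nonneg.2 T.coe_nonneg)

theorem timeAvg_sum {ι : Type*} (s : Finset ι) {F : ι → α → ℝ} {C : ℝ} (hF : ∀ i x, |F i x| ≤ C)
    (T : ℝ≥0) : timeAvg γ (fun x => ∑ i ∈ s, F i x) T = ∑ i ∈ s, timeAvg γ (F i) T := by
  unfold timeAvg
  rw [intervalIntegral.integral_finsetSum fun i _ =>
    intervalIntegrable_of_bounded (hγ (F i)) (fun _ => hF i _) _ _, Finset.mul_sum]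

theorem timeAvg_nonneg {F : α → ℝ} {C : ℝ} (hF : ∀ x, |F x| ≤ C) (h : ∀ x, 0 ≤ F x) (T : ℝ≥0) :
    0 ≤ timeAvg γ F T := by
  have := timeAvg_mono hγ (F := fun _ => 0) (C := 0) (by simp) hF h T
  simpa [timeAvg] using this

theorem isContent_timeAvg {β : Type*} (p : α → β) {T : ℝ≥0} (hT : 0 < T) :
    IsContent fun A : Set β => timeAvg γ (ind (p ⁻¹' A)) T where
  nonneg A := timeAvg_nonneg hγ (abs_ind_le _) (ind_nonneg _) T
  union A B hAB := by
    have : ind (p ⁻¹' (A ∪ B)) = fun x => ind (p ⁻¹' A) x + ind (p ⁻¹' B) x := by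
      rw [Set.preimage_union]
      exact Set.indicator_union_of_disjoint (hAB.preimage p) _
    rw [this, timeAvg_add hγ (abs_ind_le _) (abs_ind_le _)]
  univ := by
    have : ind (p ⁻¹' Set.univ) = fun _ => (1 : ℝ) := by
      ext; simp [ind]
    rw [this, timeAvg_const hT]

end TimeAverage

/-! ### Speeds and busy fractions -/

section Speeds

variable {N : ℕ} {a b : Fin (N + 1) → ℝ} (ha : ∀ i, 0 ≤ a i) (hb : ∀ i, 0 < b i)
  {ν : Fin N → ℝ} (hν : IsTrafficSolution a b ν) {T : Type*} {l : Filter T} {D : T → Fin N → ℝ}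
  {Y : Fin (N + 1) → T → ℝ}
  (hD1 : ∀ t j, D t j ≤ 1) (hD : ∀ j, ∀ c < busy a b ν j, ∀ᶠ t in l, c < D t j)
  (hY : ∀ i, Tendsto (fun t => Y i t - drift a b (D t) i) l (𝓝 0))
  (hmono : ∀ j : Fin N, ∀ᶠ t in l, Y j.castSucc t ≤ Y j.succ t)

include ha hb hν hD1 hD hY hmono

/-- Lower bounds on the busy fractions, together with the fact that particles keep their order,
determine all speeds: upper bounds on the speeds propagate from right to left, lower bounds from
left to right. -/
theorem tendsto_drift (i : Fin (N + 1)) :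
    Tendsto (fun t => drift a b (D t) i) l (𝓝 (drift a b (busy a b ν) i)) := by
  have hl1 : ∀ t s, load (D t) s ≤ 1 := fun t s => by
    cases s
    · exact le_rfl
    · exact hD1 t _
  have hl : ∀ s, ∀ c < load (busy a b ν) s, ∀ᶠ t in l, c < load (D t) s := fun s c hc => by
    cases s
    · exact Eventually.of_forall fun t => hc
    · exact hD _ c hc
  have hmul : ∀ r : ℝ, 0 ≤ r → ∀ s, ∀ ε > 0,
      ∀ᶠ t in l, r * load (busy a b ν) s - ε < r * load (D t) s := fun r hr s ε hε => by
    have h1 : load (busy a b ν) s - ε / (r + 1) < load (busy a b ν) s := by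
      have : 0 < ε / (r + 1) := by positivity
      linarith
    filter_upwards [hl s _ h1] with t ht
    have h2 := mul_le_mul_of_nonneg_left ht.le hr
    have h3 : r * (ε / (r + 1)) < ε := by
      rw [← mul_div_assoc, div_lt_iff₀ (by positivity)]
      nlinarith
    linarith
  have hstep : ∀ j : Fin N, ∀ ε > 0, ∀ᶠ t in l,
      drift a b (D t) j.castSucc < drift a b (D t) j.succ + ε := fun j ε hε => by
    filter_upwards [hmono j, (hY j.castSucc).eventually (Ioo_mem_nhds (neg_lt_zero.2 (half_pos hε))
      (half_pos hε)), (hY j.succ).eventually (Ioo_mem_nhds (neg_lt_zero.2 (half_pos hε))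
      (half_pos hε))] with t h1 h2 h3
    linarith [h2.1, h3.2]
  have hflat : ∀ j : Fin N, busy a b ν j < 1 →
      drift a b (busy a b ν) j.succ = drift a b (busy a b ν) j.castSucc := fun j hj => by
    have h1 := drift_busy_succ_sub ha hb hν j
    have h2 : workload a b ν j < 1 := by
      by_contra h
      exact hj.ne (min_eq_right (not_lt.1 h))
    rw [max_eq_right (by linarith), zero_mul] at h1
    linarith
  have hb1 : ∀ s, load (busy a b ν) s ≤ 1 := fun s => by
    cases s
    · exact le_rfl
    · exact min_le_right _ _
  have hupper : ∀ ε > 0, ∀ᶠ t in l, drift a b (D t) i < drift a b (busy a b ν) i + ε := by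
    induction i using Fin.reverseInduction with
    | last =>
      intro ε hε
      filter_upwards [hmul _ (ha (Fin.last N)) (leftGap (Fin.last N)) ε hε] with t ht
      simp only [drift, rightGap_last, load_none]
      linarith
    | cast j ih =>
      intro ε hε
      rcases lt_or_ge (busy a b ν j) 1 with hj | hj
      · filter_upwards [hstep j (ε / 2) (half_pos hε), ih (ε / 2) (half_pos hε)] with t h1 h2
        rw [hflat j hj] at h2
        linarith
      · filter_upwards [hmul _ (ha j.castSucc) (leftGap j.castSucc) ε hε] with t ht
        have h1 : load (busy a b ν) (rightGap j.castSucc) = 1 := by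
          rw [rightGap_castSucc, load_some]
          exact le_antisymm (min_le_right _ _) hj
        have h2 := mul_le_mul_of_nonneg_left (hl1 t (rightGap j.castSucc)) (hb j.castSucc).le
        simp only [drift, h1]
        linarith
  have hlower : ∀ ε > 0, ∀ᶠ t in l, drift a b (busy a b ν) i - ε < drift a b (D t) i := by
    clear hupper
    induction i using Fin.induction with
    | zero =>
      intro ε hε
      filter_upwards [hmul _ (hb 0).le (rightGap 0) ε hε] with t ht
      simp only [drift, leftGap_zero, load_none]
      linarith
    | succ j ih =>
      intro ε hε
      rcases lt_or_ge (busy a b ν j) 1 with hj | hj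
      · filter_upwards [hstep j (ε / 2) (half_pos hε), ih (ε / 2) (half_pos hε)] with t h1 h2
        rw [hflat j hj]
        linarith
      · filter_upwards [hmul _ (hb j.succ).le (rightGap j.succ) ε hε] with t ht
        have h1 : load (busy a b ν) (leftGap j.succ) = 1 := by
          rw [leftGap_succ, load_some]
          exact le_antisymm (min_le_right _ _) hj
        have h2 := mul_le_mul_of_nonneg_left (hl1 t (leftGap j.succ)) (ha j.succ)
        simp only [drift, h1]
        linarith
  refine tendsto_order.2 ⟨fun c hc => ?_, fun c hc => ?_⟩
  · filter_upwards [hlower _ (sub_pos.2 hc)] with t ht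
    linarith
  · filter_upwards [hupper _ (sub_pos.2 hc)] with t ht
    linarith

/-- The speeds determine the busy fractions, from left to right. -/
theorem tendsto_busy (j : Fin N) : Tendsto (fun t => D t j) l (𝓝 (busy a b ν j)) := by
  have key : ∀ i : Fin (N + 1),
      Tendsto (fun t => load (D t) (leftGap i)) l (𝓝 (load (busy a b ν) (leftGap i))) := fun i => by
    induction i using Fin.induction with
    | zero => simpa using tendsto_const_nhds
    | succ j ih =>
      have h1 := (((tendsto_drift ha hb hν hD1 hD hY hmono j.castSucc).add
        (ih.const_mul (a j.castSucc))).const_mul (b j.castSucc)⁻¹)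
      have hb0 := (hb j.castSucc).ne'
      simp only [drift, sub_add_cancel, inv_mul_cancel_left₀ hb0, rightGap_castSucc] at h1
      simpa using h1
  simpa using key j.succ

end Speeds

/-! ### Almost sure time averages of the gaps -/

section Invariant

variable {N : ℕ} {a b : Fin (N + 1) → ℝ} (ha : ∀ i, 0 ≤ a i) (hb : ∀ i, 0 < b i)
  {ν : Fin N → ℝ} (hν : IsTrafficSolution a b ν) {γ : ℝ → Fin N → ℕ}

/-- Along the path `γ`, the time averages of `F` are asymptotically invariant under the gap
dynamics. -/
def AsympInvariant (ν : Fin N → ℝ) (γ : ℝ → Fin N → ℕ) (F : (Fin N → ℕ) → ℝ) : Prop :=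
  ∀ n, Tendsto (fun T => timeAvg γ ((gapKernel ha hb ν)^[n] F) T - timeAvg γ F T) atTop (𝓝 0)

variable {ha hb} (hγ : ∀ F : (Fin N → ℕ) → ℝ, Measurable fun s => F (γ s))

include hγ

/-- By monotonicity, time averages of an increasing function dominate its averages over the gap
dynamics started from the origin. -/
theorem AsympInvariant.eventually_lt {F : (Fin N → ℕ) → ℝ} (hF : AsympInvariant ha hb ν γ F)
    (hmono : Monotone F) {C : ℝ} (hC : ∀ x, |F x| ≤ C) {c : ℝ} {n : ℕ}
    (hc : c < (gapKernel ha hb ν)^[n] F 0) : ∀ᶠ T in atTop, c < timeAvg γ F T := by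
  have h1 := (hF n).eventually (gt_mem_nhds (sub_pos.2 hc))
  filter_upwards [h1, eventually_gt_atTop 0] with T hT hT0
  have h2 := timeAvg_mono hγ (F := fun _ => (gapKernel ha hb ν)^[n] F 0)
    (fun _ => Network.abs_iterate_kernel_le (admissible_gapNetwork ha hb) hC n 0)
    (Network.abs_iterate_kernel_le (admissible_gapNetwork ha hb) hC n)
    (fun x => Network.iterate_kernel_monotone (admissible_gapNetwork ha hb) hmono n
      (fun _ => Nat.zero_le _)) T
  rw [timeAvg_const hT0] at h2
  linarith

omit hγ in
/-- A gap loses at most one hole per step. -/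
theorem iterate_gapKernel_coord_eq_one (j : Fin N) (n : ℕ) {x : Fin N → ℕ} (hx : n < x j) :
    (gapKernel ha hb ν)^[n] (ind {y | 1 ≤ y j}) x = 1 := by
  induction n generalizing x with
  | zero =>
    exact Set.indicator_of_mem (show x ∈ {y : Fin N → ℕ | 1 ≤ y j} from hx) fun _ => (1 : ℝ)
  | succ n ih =>
    rw [Function.iterate_succ_apply']
    set G := (gapKernel ha hb ν)^[n] (ind {y | 1 ≤ y j}) with hG
    have h1 : ∀ m, G (transfer ((gapNetwork a b ha hb).src m) ((gapNetwork a b ha hb).dst m) x) = 1 :=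
      fun m => ih (by
        have h2 : dec ((gapNetwork a b ha hb).src m) x j ≤
            transfer ((gapNetwork a b ha hb).src m) ((gapNetwork a b ha hb).dst m) x j :=
          dec_le_transfer _ _ x j
        rw [dec_apply] at h2
        split_ifs at h2 <;> omega)
    have h0 : G x = 1 := ih (by omega)
    change G x + (uniformRate a b ν)⁻¹ * ∑ m, (gapNetwork a b ha hb).rate m *
      (G (transfer ((gapNetwork a b ha hb).src m) ((gapNetwork a b ha hb).dst m) x) - G x) = 1
    simp only [h1, h0, sub_self, mul_zero, Finset.sum_const_zero, add_zero]

include hν in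
/-- The lengths of a stable gap are tight along time averages: the fraction of time during which
gap `j` is large cannot exceed the slack between its busy fraction and the approximations from
below. -/
theorem AsympInvariant.exists_eventually_lt (j : Fin N) (hj : workload a b ν j < 1)
    (hF : AsympInvariant ha hb ν γ (ind {y | 1 ≤ y j}))
    (hbusy : Tendsto (timeAvg γ (ind {y | 1 ≤ y j})) atTop (𝓝 (busy a b ν j))) {ε : ℝ}
    (hε : 0 < ε) :
    ∃ n₀, ∀ n ≥ n₀, ∀ᶠ T in atTop, timeAvg γ (ind {y | n < y j}) T < ε := by
  have hb1 : busy a b ν j < 1 := (min_le_left _ _).trans_lt hj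
  have h1 : busy a b ν j - ε * (1 - busy a b ν j) / 2 < busy a b ν j ^ 1 := by
    have : 0 < ε * (1 - busy a b ν j) := mul_pos hε (by linarith)
    rw [pow_one]
    linarith
  obtain ⟨n₀, hn₀⟩ := eventually_atTop.1
    (eventually_lt_iterate_gapKernel_coord ha hb hν j 1 h1 0)
  refine ⟨n₀, fun n hn => ?_⟩
  have hc := hn₀ n hn
  set c := (gapKernel ha hb ν)^[n] (ind {y | 1 ≤ y j}) 0 with hcdef
  have hcb : c ≤ busy a b ν j := by
    by_contra hlt
    rw [not_le] at hlt
    obtain ⟨d, hd1, hd2⟩ := exists_between hlt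
    have h2 := hF.eventually_lt hγ (monotone_ind fun x y hxy hx => le_trans hx (hxy j))
      (abs_ind_le _) hd2
    obtain ⟨T, hT1, hT2⟩ := (h2.and (hbusy.eventually (gt_mem_nhds hd1))).exists
    exact absurd hT1 (not_lt.2 hT2.le)
  have hkb := Network.abs_iterate_kernel_le (admissible_gapNetwork ha hb (ν := ν))
    (abs_ind_le {y : Fin N → ℕ | 1 ≤ y j}) n
  have h3 : ∀ x, c + (1 - c) * ind {y | n < y j} x ≤
      (gapKernel ha hb ν)^[n] (ind {y | 1 ≤ y j}) x := fun x => by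
    by_cases hx : n < x j
    · rw [iterate_gapKernel_coord_eq_one j n hx, ind,
        Set.indicator_of_mem (show x ∈ {y : Fin N → ℕ | n < y j} from hx)]
      linarith
    · rw [ind, Set.indicator_of_notMem (show x ∉ {y : Fin N → ℕ | n < y j} from hx), mul_zero,
        add_zero]
      exact Network.iterate_kernel_monotone (admissible_gapNetwork ha hb)
        (monotone_ind fun x y hxy hx => le_trans hx (hxy j)) n fun _ => Nat.zero_le _
  have h4 := (hF n).add hbusy
  simp only [sub_add_cancel, zero_add] at h4
  have h5 : busy a b ν j < busy a b ν j + ε * (1 - busy a b ν j) / 2 := by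
    have : 0 < ε * (1 - busy a b ν j) := mul_pos hε (by linarith)
    linarith
  filter_upwards [h4.eventually (gt_mem_nhds h5), eventually_gt_atTop 0] with T hT hT0
  have hm : ∀ x, |(1 - c) * ind {y : Fin N → ℕ | n < y j} x| ≤ |1 - c| := fun x => by
    rw [abs_mul]
    exact mul_le_of_le_one_right (abs_nonneg _) (abs_ind_le _ x)
  have h6 := timeAvg_mono hγ (fun x => (abs_add_le _ _).trans (add_le_add_right (hm x) |c|)) hkb h3 T
  rw [timeAvg_add hγ (fun _ => le_refl |c|) hm, timeAvg_const hT0, timeAvg_const_mul] at h6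
  have h7 : (1 - busy a b ν j) * timeAvg γ (ind {y | n < y j}) T ≤
      (1 - c) * timeAvg γ (ind {y | n < y j}) T :=
    mul_le_mul_of_nonneg_right (by linarith)
      (timeAvg_nonneg hγ (abs_ind_le _) (ind_nonneg _) T)
  have h8 : (1 - busy a b ν j) * timeAvg γ (ind {y | n < y j}) T < (1 - busy a b ν j) * ε := by
    linarith
  exact lt_of_mul_lt_mul_left h8 (by linarith)

variable {ι : Type*} [DecidableEq ι] [Fintype ι] {e : ι → Fin N} (he : Function.Injective e)
  (hstable : ∀ j, workload a b ν (e j) < 1) (hunstable : ∀ j, j ∉ Set.range e → 1 ≤ workload a b ν j)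

include hν he hstable hunstable

/-- The lower bound holds by monotonicity; the upper bound compares with the collapsed network,
started from a level that tight gaps rarely exceed. -/
theorem tendsto_timeAvg_of_isUpperSet {U : Set (ι → ℕ)} (hU : IsUpperSet U)
    (hF : AsympInvariant ha hb ν γ (ind ((fun x => x ∘ e) ⁻¹' U)))
    (hcoord : ∀ j, AsympInvariant ha hb ν γ (ind {y | 1 ≤ y j}))
    (hbusy : ∀ j, Tendsto (timeAvg γ (ind {y | 1 ≤ y j})) atTop (𝓝 (busy a b ν j))) :
    Tendsto (timeAvg γ (ind ((fun x => x ∘ e) ⁻¹' U))) atTop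
      (𝓝 ((prodLaw (workload a b ν ∘ e)).real U)) := by
  have hU' : IsUpperSet ((fun x : Fin N → ℕ => x ∘ e) ⁻¹' U) :=
    fun y z hyz hy => hU (fun i => hyz (e i)) hy
  refine tendsto_order.2 ⟨fun c hc => ?_, fun c hc => ?_⟩
  · obtain ⟨n, hn⟩ := ((tendsto_iterate_gapKernel ha hb hν he hstable hunstable U 0).eventually
      (lt_mem_nhds hc)).exists
    exact hF.eventually_lt hγ (monotone_ind hU') (abs_ind_le _) hn
  · obtain ⟨c', hc1, hc2⟩ := exists_between hc
    set ε := (c - c') / (Fintype.card ι + 2) with hε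
    have hε0 : 0 < ε := div_pos (sub_pos.2 hc2) (by positivity)
    choose n₀ hn₀ using fun j : ι =>
      (hcoord (e j)).exists_eventually_lt hν hγ (e j) (hstable j) (hbusy (e j)) hε0
    set m := Finset.univ.sup n₀ with hm
    -- on the event that all stable gaps are at most `m`, compare with the collapsed network
    have h1 := tendsto_iterate_collapse ha hb hν he hstable hunstable (monotone_ind hU)
      (LinearGrowth.of_bounded (abs_ind_le U)) fun _ => m
    rw [integral_ind] at h1
    obtain ⟨n, hn⟩ := (h1.eventually (gt_mem_nhds hc1)).exists
    have hadm := Network.admissible_collapse (e := e) (admissible_gapNetwork ha hb (ν := ν))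
    set k := (((gapNetwork a b ha hb).collapse e).kernel (uniformRate a b ν))^[n] (ind U)
      (fun _ => m) with hk
    have hk0 : 0 ≤ k := by
      have := Network.iterate_kernel_mono hadm (f := fun _ => (0 : ℝ)) (g := ind U)
        (fun y => ind_nonneg _ y) n (fun _ => m)
      rwa [Network.iterate_kernel_const] at this
    have hkb := Network.abs_iterate_kernel_le (admissible_gapNetwork ha hb (ν := ν))
      (abs_ind_le ((fun x : Fin N → ℕ => x ∘ e) ⁻¹' U)) n
    have h2 : ∀ x, (gapKernel ha hb ν)^[n] (ind ((fun x => x ∘ e) ⁻¹' U)) x ≤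
        k + ∑ j : ι, ind {y | m < y (e j)} x := fun x => by
      by_cases hx : ∃ j, m < x (e j)
      · obtain ⟨j, hj⟩ := hx
        have h3 : (1 : ℝ) ≤ ∑ j : ι, ind {y | m < y (e j)} x := by
          have h4 := Finset.single_le_sum (f := fun j => ind {y : Fin N → ℕ | m < y (e j)} x)
            (fun j _ => ind_nonneg _ x) (Finset.mem_univ j)
          simp only [ind] at h4
          rw [Set.indicator_of_mem (show x ∈ {y : Fin N → ℕ | m < y (e j)} from hj)] at h4
          exact h4
        linarith [(abs_le.1 (hkb x)).2]
      · simp only [not_exists, not_lt] at hx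
        have h3 : 0 ≤ ∑ j : ι, ind {y : Fin N → ℕ | m < y (e j)} x :=
          Finset.sum_nonneg fun j _ => ind_nonneg _ x
        have h4 := iterate_gapKernel_comp_le ha hb he (ν := ν) (monotone_ind hU) n x
        have h5 := Network.iterate_kernel_monotone hadm (monotone_ind hU) n
          (show x ∘ e ≤ fun _ => m from fun j => hx j)
        exact (h4.trans h5).trans (le_add_of_nonneg_right h3)
    have hsb : ∀ x, |∑ j : ι, ind {y : Fin N → ℕ | m < y (e j)} x| ≤ ∑ _j : ι, (1 : ℝ) := fun x =>
      (Finset.abs_sum_le_sum_abs _ _).trans (Finset.sum_le_sum fun j _ => abs_ind_le _ x)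
    have hall : ∀ᶠ T in atTop, ∀ j : ι, timeAvg γ (ind {y | m < y (e j)}) T < ε :=
      eventually_all.2 fun j => hn₀ j m (Finset.le_sup (Finset.mem_univ j))
    have hinv := (hF n).eventually (lt_mem_nhds (neg_lt_zero.2 hε0))
    filter_upwards [hall, hinv, eventually_gt_atTop 0] with T hT1 hT2 hT0
    have h6 := timeAvg_mono hγ hkb (fun x => (abs_add_le _ _).trans (add_le_add_right (hsb x) |k|))
      h2 T
    rw [timeAvg_add hγ (fun _ => le_refl |k|) hsb, timeAvg_const hT0,
      timeAvg_sum hγ _ fun j x => abs_ind_le _ x] at h6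
    have h7 : ∑ j : ι, timeAvg γ (ind {y | m < y (e j)}) T ≤ Fintype.card ι * ε := by
      refine (Finset.sum_le_sum fun j _ => (hT1 j).le).trans (le_of_eq ?_)
      simp
    have h8 : ε * (Fintype.card ι + 2) = c - c' := div_mul_cancel₀ _ (by positivity)
    change k < c' at hn
    linarith

end Invariant

section Paths

variable {N : ℕ} {a b : Fin (N + 1) → ℝ} {Ω : Type*} [mΩ : MeasurableSpace Ω] {P : Measure Ω}
  [IsProbabilityMeasure P] {x₀ : Config N} {X : ℝ≥0 → Ω → Config N}

/-- The path of the gaps. -/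
def gapPath (X : ℝ≥0 → Ω → Config N) (ω : Ω) (s : ℝ) : Fin N → ℕ := (X s.toNNReal ω).gap

open scoped Classical in
/-- The rate of change of the position of a particle. -/
theorem generator_coord (i : Fin (N + 1)) (x : Config N) :
    generator a b (fun x => (x.1 i : ℝ)) x =
      b i * ind {y | Avail (rightGap i) y} x.gap - a i * ind {y | Avail (leftGap i) y} x.gap := by
  have hR : ∀ k, (((x.jumpRight k).1 i : ℤ) : ℝ) - x.1 i =
      if k = i then ind {y | Avail (rightGap i) y} x.gap else 0 := fun k => by
    unfold Config.jumpRight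
    by_cases hk : k = i
    · subst hk
      by_cases h : x.IsVacant (x.1 k + 1)
      · have h1 : x.gap ∈ {y | Avail (rightGap k) y} := (isVacant_add_one_iff x k).1 h
        rw [dif_pos h, if_pos rfl, ind, Set.indicator_of_mem h1]
        simp
      · have h1 : x.gap ∉ {y | Avail (rightGap k) y} := fun h' => h ((isVacant_add_one_iff x k).2 h')
        rw [dif_neg h, if_pos rfl, ind, Set.indicator_of_notMem h1, sub_self]
    · rw [if_neg hk]
      split_ifs
      · simp [Function.update_of_ne (Ne.symm hk)]
      · exact sub_self _
  have hL : ∀ k, (((x.jumpLeft k).1 i : ℤ) : ℝ) - x.1 i =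
      if k = i then -ind {y | Avail (leftGap i) y} x.gap else 0 := fun k => by
    unfold Config.jumpLeft
    by_cases hk : k = i
    · subst hk
      by_cases h : x.IsVacant (x.1 k - 1)
      · have h1 : x.gap ∈ {y | Avail (leftGap k) y} := (isVacant_sub_one_iff x k).1 h
        rw [dif_pos h, if_pos rfl, ind, Set.indicator_of_mem h1]
        simp
      · have h1 : x.gap ∉ {y | Avail (leftGap k) y} := fun h' => h ((isVacant_sub_one_iff x k).2 h')
        rw [dif_neg h, if_pos rfl, ind, Set.indicator_of_notMem h1, sub_self, neg_zero]
    · rw [if_neg hk]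
      split_ifs
      · simp [Function.update_of_ne (Ne.symm hk)]
      · exact sub_self _
  unfold generator
  simp only [hR, hL, mul_ite, mul_zero, Finset.sum_add_distrib, Finset.sum_ite_eq', Finset.mem_univ,
    if_true]
  ring

theorem unitJumps_coord (i : Fin (N + 1)) : UnitJumps fun x : Config N => (x.1 i : ℝ) := by
  intro x k
  unfold Config.jumpRight Config.jumpLeft
  constructor
  · split_ifs
    · by_cases hk : i = k
      · subst hk; simp
      · simp [Function.update_of_ne hk]
    · simp
  · split_ifs
    · by_cases hk : i = k
      · subst hk; simp
      · simp [Function.update_of_ne hk]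
    · simp

theorem timeAvg_avail (γ : ℝ → Fin N → ℕ) (s : Option (Fin N)) {T : ℝ≥0} (hT : 0 < T) :
    timeAvg γ (ind {y | Avail s y}) T = load (fun j => timeAvg γ (ind {y | 1 ≤ y j}) T) s := by
  cases s with
  | none =>
    have : ind {y : Fin N → ℕ | Avail none y} = fun _ => (1 : ℝ) := by
      ext; simp [ind, avail_none]
    rw [this, timeAvg_const hT, load_none]
  | some j =>
    simp only [avail_some, load_some, Nat.one_le_iff_ne_zero]

namespace IsExclusionProcess

variable (hX : IsExclusionProcess a b x₀ P X) (ha : ∀ i, 0 ≤ a i) (hb : ∀ i, 0 < b i)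

include hX

theorem measurable_gapPath (ω : Ω) (F : (Fin N → ℕ) → ℝ) : Measurable fun s => F (gapPath X ω s) :=
  hX.measurable_path (fun x => F x.gap) ω

include ha hb

/-- Time averages of generators vanish in the limit, by the strong law for `f / (2 C + 1)`, which has
unit jumps. -/
theorem ae_tendsto_timeAvg_generator {f : Config N → ℝ} {C : ℝ} (hC : ∀ x, |f x| ≤ C) :
    ∀ᵐ ω ∂P, Tendsto (timeAvg (fun s => X s.toNNReal ω) (generator a b f)) atTop (𝓝 0) := by
  have hC0 : 0 ≤ C := (abs_nonneg _).trans (hC x₀)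
  have hpos : 0 < 2 * C + 1 := by linarith
  set g : Config N → ℝ := fun x => (2 * C + 1)⁻¹ * f x with hg
  have hgu : UnitJumps g := by
    have h1 : ∀ y x, |g y - g x| ≤ 1 := fun y x => by
      simp only [hg]
      rw [← mul_sub, abs_mul, abs_of_pos (inv_pos.2 hpos), inv_mul_le_iff₀ hpos, mul_one]
      refine (abs_sub _ _).trans ?_
      linarith [hC x, hC y]
    exact fun x i => ⟨h1 _ _, h1 _ _⟩
  have hgen : ∀ x, generator a b g x = (2 * C + 1)⁻¹ * generator a b f x := fun x => by
    simp only [generator, hg, Finset.mul_sum]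
    exact Finset.sum_congr rfl fun i _ => by ring
  have hT : Tendsto (fun T : ℝ≥0 => (T : ℝ)) atTop atTop := NNReal.tendsto_coe_atTop.2 tendsto_id
  filter_upwards [hX.ae_tendsto_dynkin_div ha hb hgu] with ω hω
  have h1 : Tendsto (fun T : ℝ≥0 => g (X T ω) / (T : ℝ)) atTop (𝓝 0) := by
    refine squeeze_zero_norm (fun T => ?_)
      ((tendsto_const_nhds (x := (2 * C + 1)⁻¹ * C)).div_atTop hT)
    rw [norm_div, Real.norm_eq_abs, Real.norm_eq_abs, abs_of_nonneg T.coe_nonneg]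
    refine div_le_div_of_nonneg_right ?_ T.coe_nonneg
    simp only [hg]
    rw [abs_mul, abs_of_pos (inv_pos.2 hpos)]
    exact mul_le_mul_of_nonneg_left (hC _) (inv_pos.2 hpos).le
  have h2 := (h1.sub hω).const_mul (2 * C + 1)
  rw [sub_zero, mul_zero] at h2
  refine h2.congr fun T => ?_
  simp only [dynkin, timeAvg, hgen, intervalIntegral.integral_const_mul]
  field_simp
  ring

theorem ae_asympInvariant {ν : Fin N → ℝ} {F : (Fin N → ℕ) → ℝ} {C : ℝ} (hC : ∀ x, |F x| ≤ C) :
    ∀ᵐ ω ∂P, AsympInvariant ha hb ν (gapPath X ω) F := by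
  refine ae_all_iff.2 fun n => ?_
  induction n with
  | zero => exact ae_of_all _ fun ω => by simp
  | succ n ih =>
    have hb' := Network.abs_iterate_kernel_le (admissible_gapNetwork ha hb (ν := ν)) hC n
    set G := (gapKernel ha hb ν)^[n] F with hG
    filter_upwards [ih, hX.ae_tendsto_timeAvg_generator ha hb (f := fun x => G x.gap)
      (fun x => hb' _)] with ω h1 h2
    have hstep : ∀ T, timeAvg (gapPath X ω) ((gapKernel ha hb ν)^[n + 1] F) T =
        timeAvg (gapPath X ω) G T + (uniformRate a b ν)⁻¹ *
          timeAvg (fun s => X s.toNNReal ω) (generator a b fun x => G x.gap) T := fun T => by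
      have hgenb : ∀ s, |(gapNetwork a b ha hb).gen G (gapPath X ω s)| ≤
          jumpRate a b * (2 * C) := fun s => by
        have h4 := abs_generator_le_of_bounded ha hb (f := fun x => G x.gap) (fun x => hb' _)
          (X s.toNNReal ω)
        rwa [generator_comp_gap ha hb] at h4
      have h3 : timeAvg (fun s => X s.toNNReal ω) (generator a b fun x => G x.gap) T =
          timeAvg (gapPath X ω) ((gapNetwork a b ha hb).gen G) T := by
        simp only [timeAvg, generator_comp_gap ha hb, gapPath]
      rw [h3, Function.iterate_succ_apply', ← hG]
      simp only [timeAvg, gapKernel, Network.kernel]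
      rw [intervalIntegral.integral_add
        (intervalIntegrable_of_bounded (hX.measurable_gapPath ω G) (fun _ => hb' _) _ _)
        ((intervalIntegrable_of_bounded (hX.measurable_gapPath ω _) hgenb _ _).const_mul _),
        intervalIntegral.integral_const_mul]
      ring
    have h3 := h1.add (h2.const_mul (uniformRate a b ν)⁻¹)
    rw [mul_zero, add_zero] at h3
    refine h3.congr fun T => ?_
    rw [hstep]
    ring

variable {ν : Fin N → ℝ} (hν : IsTrafficSolution a b ν)

include hν

theorem ae_tendsto_speed_and_busy : ∀ᵐ ω ∂P,
    (∀ j, AsympInvariant ha hb ν (gapPath X ω) (ind {y | 1 ≤ y j})) ∧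
    (∀ i, Tendsto (fun t : ℝ≥0 => ((X t ω).1 i : ℝ) / (t : ℝ)) atTop
      (𝓝 (drift a b (busy a b ν) i))) ∧
    ∀ j, Tendsto (timeAvg (gapPath X ω) (ind {y | 1 ≤ y j})) atTop (𝓝 (busy a b ν j)) := by
  filter_upwards [ae_all_iff.2 fun j => hX.ae_asympInvariant ha hb (ν := ν)
      (abs_ind_le {y : Fin N → ℕ | 1 ≤ y j}),
    ae_all_iff.2 fun i => hX.ae_tendsto_dynkin_div ha hb (unitJumps_coord i)] with ω hinv hdyn
  have hγ := hX.measurable_gapPath ω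
  have hD1 : ∀ (t : ℝ≥0) (j : Fin N), timeAvg (gapPath X ω) (ind {y | 1 ≤ y j}) t ≤ 1 :=
    fun t j => by
      rcases eq_or_ne t 0 with rfl | ht
      · simp [timeAvg]
      · have h1 := timeAvg_mono hγ (abs_ind_le {y : Fin N → ℕ | 1 ≤ y j})
          (G := fun _ => 1) (C' := 1) (by simp) (ind_le_one _) t
        rwa [timeAvg_const (pos_iff_ne_zero.2 ht)] at h1
  have hD : ∀ j, ∀ c < busy a b ν j,
      ∀ᶠ t in atTop, c < timeAvg (gapPath X ω) (ind {y | 1 ≤ y j}) t := fun j c hc => by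
    obtain ⟨n, hn⟩ := (eventually_lt_iterate_gapKernel_coord ha hb hν j 1
      (by rwa [pow_one]) 0).exists
    exact (hinv j).eventually_lt hγ (monotone_ind fun x y hxy hx => le_trans hx (hxy j))
      (abs_ind_le _) hn
  have hY : ∀ i, Tendsto (fun t : ℝ≥0 => ((X t ω).1 i : ℝ) / (t : ℝ) -
      drift a b (fun j => timeAvg (gapPath X ω) (ind {y | 1 ≤ y j}) t) i) atTop (𝓝 0) := fun i => by
    refine (hdyn i).congr' ?_
    filter_upwards [eventually_gt_atTop 0] with t ht
    simp only [drift]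
    rw [← timeAvg_avail _ _ ht, ← timeAvg_avail _ _ ht, dynkin, sub_div]
    congr 1
    simp only [generator_coord]
    rw [intervalIntegral.integral_sub, intervalIntegral.integral_const_mul,
      intervalIntegral.integral_const_mul]
    · simp only [timeAvg, gapPath]
      ring
    · exact (intervalIntegrable_of_bounded (hγ (ind {y | Avail (rightGap i) y}))
        (fun _ => abs_ind_le _ _) _ _).const_mul _
    · exact (intervalIntegrable_of_bounded (hγ (ind {y | Avail (leftGap i) y}))
        (fun _ => abs_ind_le _ _) _ _).const_mul _
  have hmono : ∀ j : Fin N, ∀ᶠ t : ℝ≥0 in atTop,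
      ((X t ω).1 j.castSucc : ℝ) / (t : ℝ) ≤ ((X t ω).1 j.succ : ℝ) / (t : ℝ) := fun j =>
    Eventually.of_forall fun t => div_le_div_of_nonneg_right
      (by exact_mod_cast ((X t ω).2 (Fin.castSucc_lt_succ (i := j))).le) t.coe_nonneg
  refine ⟨hinv, fun i => ?_, fun j => ?_⟩
  · have h1 := (hY i).add (tendsto_drift ha hb hν hD1 hD hY hmono i)
    simpa using h1
  · exact tendsto_busy ha hb hν hD1 hD hY hmono j

variable {ι : Type*} [DecidableEq ι] [Fintype ι] {e : ι → Fin N} (he : Function.Injective e)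
  (hstable : ∀ j, workload a b ν (e j) < 1) (hunstable : ∀ j, j ∉ Set.range e → 1 ≤ workload a b ν j)

include he hstable hunstable

/-- The exceptional null set does not depend on `A`, as only the countably many sets `Ici z` and
`Ioi z` matter. -/
theorem ae_tendsto_timeAvg : ∀ᵐ ω ∂P, ∀ A : Set (ι → ℕ),
    Tendsto (timeAvg (gapPath X ω) (ind ((fun x => x ∘ e) ⁻¹' A))) atTop
      (𝓝 ((prodLaw (workload a b ν ∘ e)).real A)) := by
  filter_upwards [hX.ae_tendsto_speed_and_busy ha hb hν,
    ae_all_iff.2 fun z : ι → ℕ => hX.ae_asympInvariant ha hb (ν := ν)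
      (abs_ind_le ((fun x => x ∘ e) ⁻¹' Set.Ici z)),
    ae_all_iff.2 fun z : ι → ℕ => hX.ae_asympInvariant ha hb (ν := ν)
      (abs_ind_le ((fun x => x ∘ e) ⁻¹' Set.Ioi z))] with ω hω hIci hIoi
  have hγ := hX.measurable_gapPath ω
  refine tendsto_content_of_Ici_of_Ioi
    (Φ := fun T A => timeAvg (gapPath X ω) (ind ((fun x => x ∘ e) ⁻¹' A)) T) ?_
    (fun z => tendsto_timeAvg_of_isUpperSet hν hγ he hstable hunstable (isUpperSet_Ici z) (hIci z)
      hω.1 hω.2.2)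
    (fun z => tendsto_timeAvg_of_isUpperSet hν hγ he hstable hunstable (isUpperSet_Ioi z) (hIoi z)
      hω.1 hω.2.2)
  filter_upwards [eventually_gt_atTop 0] with T hT
  exact isContent_timeAvg hγ _ hT

end IsExclusionProcess
end Paths

/-! ### Laws and expectations of the gaps at large times -/

section Expectation

variable {N : ℕ} {a b : Fin (N + 1) → ℝ} {Ω : Type*} [mΩ : MeasurableSpace Ω] {P : Measure Ω}
  [IsProbabilityMeasure P] {x₀ : Config N} {X : ℝ≥0 → Ω → Config N}

namespace IsExclusionProcess

variable (hX : IsExclusionProcess a b x₀ P X) (ha : ∀ i, 0 ≤ a i) (hb : ∀ i, 0 < b i)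
  {ν : Fin N → ℝ} (hν : IsTrafficSolution a b ν)

include hX

theorem integral_ind_gap (A : Set (Fin N → ℕ)) (t : ℝ≥0) :
    ∫ ω, ind A (X t ω).gap ∂P = P.real {ω | (X t ω).gap ∈ A} := by
  have h1 : MeasurableSet {ω | (X t ω).gap ∈ A} :=
    hX.measurable t (MeasurableSet.of_discrete (s := {x : Config N | x.gap ∈ A}))
  have h2 : (fun ω => ind A (X t ω).gap) =
      Set.indicator {ω | (X t ω).gap ∈ A} fun _ => (1 : ℝ) := rfl
  rw [h2, integral_indicator h1]
  simp

include ha hb hν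

/-- An unstable gap diverges in probability. -/
theorem tendsto_measure_gap_lt {j : Fin N} (hj : 1 ≤ workload a b ν j) (k : ℕ) :
    Tendsto (fun t : ℝ≥0 => P.real {ω | (X t ω).gap j < k}) atTop (𝓝 0) := by
  have hbusy : busy a b ν j = 1 := min_eq_right hj
  have h1 : Tendsto (fun n => (gapKernel ha hb ν)^[n] (ind {y | k ≤ y j}) x₀.gap) atTop (𝓝 1) := by
    refine tendsto_order.2 ⟨fun c hc => ?_, fun c hc => Eventually.of_forall fun n => ?_⟩
    · exact eventually_lt_iterate_gapKernel_coord ha hb hν j k (by rwa [hbusy, one_pow]) _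
    · exact ((abs_le.1 (Network.abs_iterate_kernel_le (admissible_gapNetwork ha hb)
        (abs_ind_le _) n _)).2).trans_lt hc
  have h2 := (hX.tendsto_integral_gap ha hb (abs_ind_le _) h1).const_sub 1
  rw [sub_self] at h2
  refine h2.congr fun t => ?_
  rw [hX.integral_ind_gap]
  have h3 : MeasurableSet {ω | (X t ω).gap ∈ {y : Fin N → ℕ | k ≤ y j}} :=
    hX.measurable t (MeasurableSet.of_discrete (s := {x : Config N | k ≤ x.gap j}))
  rw [← probReal_compl_eq_one_sub h3]
  congr 1
  ext ω
  simp

variable {ι : Type*} [DecidableEq ι] [Fintype ι] {e : ι → Fin N} (he : Function.Injective e)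
  (hstable : ∀ j, workload a b ν (e j) < 1) (hunstable : ∀ j, j ∉ Set.range e → 1 ≤ workload a b ν j)

include he hstable hunstable

theorem tendsto_measure_gap (A : Set (ι → ℕ)) :
    Tendsto (fun t : ℝ≥0 => P.real {ω | (X t ω).gap ∘ e ∈ A}) atTop
      (𝓝 ((prodLaw (workload a b ν ∘ e)).real A)) := by
  refine (hX.tendsto_integral_gap ha hb (abs_ind_le _)
    (tendsto_iterate_gapKernel ha hb hν he hstable hunstable A x₀.gap)).congr fun t => ?_
  exact hX.integral_ind_gap _ t

/-- The expectation of a stable gap is dominated by its counterpart in the collapsed network. -/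
theorem exists_integral_min_gap_le (i : ι) : ∃ u : ℝ≥0 → ℝ,
    (∀ t (R : ℕ), ∫ ω, min ((X t ω).gap (e i) : ℝ) R ∂P ≤ u t) ∧
    Tendsto u atTop (𝓝 (workload a b ν (e i) / (1 - workload a b ν (e i)))) := by
  have hΛ0 : 0 < uniformRate a b ν := uniformRate_pos ha hb
  have hmono : Monotone fun z : ι → ℕ => (z i : ℝ) := fun z w h => Nat.cast_le.2 (h i)
  have h1 := tendsto_iterate_collapse ha hb hν he hstable hunstable hmono (LinearGrowth.coord i)
    (x₀.gap ∘ e)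
  rw [integral_coord (ρ := workload a b ν ∘ e)
    fun i => ⟨(workload_pos ha hb hν _).le, hstable i⟩] at h1
  obtain ⟨h2, h3⟩ := tendsto_poisson_average h1
  have hT : Tendsto (fun t : ℝ≥0 => uniformRate a b ν * (t : ℝ)) atTop atTop :=
    (NNReal.tendsto_coe_atTop.2 tendsto_id).const_mul_atTop hΛ0
  refine ⟨_, fun t R => ?_, h3.comp hT⟩
  set F : (ι → ℕ) → ℝ := fun z => min (z i : ℝ) R with hF
  have hFm : Monotone F := fun z w h => min_le_min_right _ (hmono h)
  have hFb : ∀ x : Fin N → ℕ, |F (x ∘ e)| ≤ R := fun x => by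
    rw [abs_of_nonneg (le_min (Nat.cast_nonneg _) (Nat.cast_nonneg _))]
    exact min_le_right _ _
  have hadm := Network.admissible_collapse (e := e) (admissible_gapNetwork ha hb (ν := ν))
  have h4 := hX.hasSum_integral_gap ha hb (ν := ν) hFb t
  have h5 := hasSum_le (fun k => mul_le_mul_of_nonneg_left
    ((iterate_gapKernel_comp_le ha hb he hFm k x₀.gap).trans
      (Network.iterate_kernel_mono hadm (fun z => min_le_left _ _) k (x₀.gap ∘ e)))
    (by positivity)) h4 (h2 (uniformRate a b ν * t)).hasSum
  have h6 := mul_le_mul_of_nonneg_left h5 (Real.exp_pos (-(uniformRate a b ν * t))).le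
  rw [← mul_assoc, ← Real.exp_add, neg_add_cancel, Real.exp_zero, one_mul] at h6
  exact h6

theorem integrable_gap (i : ι) (t : ℝ≥0) : Integrable (fun ω => ((X t ω).gap (e i) : ℝ)) P := by
  obtain ⟨u, hu, _⟩ := hX.exists_integral_min_gap_le ha hb hν he hstable hunstable i
  have hmeas : Measurable fun ω => ((X t ω).gap (e i) : ℝ) :=
    hX.measurable_comp (fun x => (x.gap (e i) : ℝ)) t
  refine ⟨hmeas.aestronglyMeasurable, ?_⟩
  rw [hasFiniteIntegral_iff_ofReal (ae_of_all _ fun ω => Nat.cast_nonneg _)]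
  have h1 : Tendsto (fun R : ℕ => ∫⁻ ω, ENNReal.ofReal (min ((X t ω).gap (e i) : ℝ) R) ∂P) atTop
      (𝓝 (∫⁻ ω, ENNReal.ofReal ((X t ω).gap (e i) : ℝ) ∂P)) := by
    refine lintegral_tendsto_of_tendsto_of_monotone
      (fun R => (hmeas.min measurable_const).ennreal_ofReal.aemeasurable)
      (ae_of_all _ fun ω R R' h => ENNReal.ofReal_le_ofReal
        (min_le_min_left _ (Nat.cast_le.2 h))) (ae_of_all _ fun ω => ?_)
    refine tendsto_const_nhds.congr' ?_
    filter_upwards [eventually_ge_atTop ((X t ω).gap (e i))] with R hR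
    rw [min_eq_left (Nat.cast_le.2 hR)]
  refine lt_of_le_of_lt (le_of_tendsto' (b := ENNReal.ofReal (u t)) h1 fun R => ?_)
    ENNReal.ofReal_lt_top
  rw [← ofReal_integral_eq_lintegral_ofReal
    (Integrable.of_bound (C := R) (hmeas.min measurable_const).aestronglyMeasurable
      (ae_of_all _ fun ω => by
        rw [Real.norm_eq_abs, abs_of_nonneg (le_min (Nat.cast_nonneg _) (Nat.cast_nonneg _))]
        exact min_le_right _ _))
    (ae_of_all _ fun ω => le_min (Nat.cast_nonneg _) (Nat.cast_nonneg _))]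
  exact ENNReal.ofReal_le_ofReal (hu t R)

theorem tendsto_integral_gap_coord (i : ι) :
    Tendsto (fun t : ℝ≥0 => ∫ ω, ((X t ω).gap (e i) : ℝ) ∂P) atTop
      (𝓝 (workload a b ν (e i) / (1 - workload a b ν (e i)))) := by
  have hint := hX.integrable_gap ha hb hν he hstable hunstable i
  set ρ := workload a b ν (e i) with hρ
  have hρ0 : 0 ≤ ρ := (workload_pos ha hb hν _).le
  have hρ1 : ρ < 1 := hstable i
  refine tendsto_order.2 ⟨fun c hc => ?_, fun c hc => ?_⟩
  · have hgeo : Tendsto (fun R => ∑ k ∈ Finset.range R, ρ ^ (k + 1)) atTop (𝓝 (ρ / (1 - ρ))) := by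
      have h1 := ((hasSum_geometric_of_lt_one hρ0 hρ1).mul_left ρ).tendsto_sum_nat
      simpa only [pow_succ', div_eq_mul_inv] using h1
    obtain ⟨R, hR⟩ := (hgeo.eventually (lt_mem_nhds hc)).exists
    have h2 : Tendsto (fun t : ℝ≥0 => ∑ k ∈ Finset.range R,
        P.real {ω | (X t ω).gap ∘ e ∈ {z : ι → ℕ | k + 1 ≤ z i}}) atTop
        (𝓝 (∑ k ∈ Finset.range R, ρ ^ (k + 1))) := tendsto_finsetSum _ fun k _ => by
      have h3 := hX.tendsto_measure_gap ha hb hν he hstable hunstable {z | k + 1 ≤ z i}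
      rwa [prodLaw_real_coord_ge (ρ := workload a b ν ∘ e) fun i => ⟨(workload_pos ha hb hν _).le, hstable i⟩] at h3
    filter_upwards [h2.eventually (lt_mem_nhds hR)] with t ht
    refine ht.trans_le ?_
    have h4 : ∀ k, P.real {ω | k + 1 ≤ ((X t ω).gap ∘ e) i} =
        ∫ ω, ind {y : Fin N → ℕ | k + 1 ≤ y (e i)} (X t ω).gap ∂P := fun k =>
      (hX.integral_ind_gap {y | k + 1 ≤ y (e i)} t).symm
    have hi : ∀ k, Integrable (fun ω => ind {y : Fin N → ℕ | k + 1 ≤ y (e i)} (X t ω).gap) P :=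
      fun k => hX.integrable_comp (f := fun x => ind {y : Fin N → ℕ | k + 1 ≤ y (e i)} x.gap)
        (fun _ => abs_ind_le _ _) t
    rw [Finset.sum_congr rfl fun k _ => h4 k]
    rw [← integral_finsetSum _ fun k _ => hi k]
    refine integral_mono (integrable_finsetSum _ fun k _ => hi k) (hint t) fun ω => ?_
    -- a natural number `y` is the number of `k` with `k + 1 ≤ y`
    have h5 : ∀ k, ind {y : Fin N → ℕ | k + 1 ≤ y (e i)} (X t ω).gap =
        if k ∈ Finset.range ((X t ω).gap (e i)) then 1 else 0 := fun k => by
      by_cases hk : k < (X t ω).gap (e i)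
      · have hm : (X t ω).gap ∈ {y : Fin N → ℕ | k + 1 ≤ y (e i)} := hk
        rw [if_pos (Finset.mem_range.2 hk), ind, Set.indicator_of_mem hm]
      · have hm : (X t ω).gap ∉ {y : Fin N → ℕ | k + 1 ≤ y (e i)} := hk
        rw [if_neg (by rwa [Finset.mem_range]), ind, Set.indicator_of_notMem hm]
    simp only [h5]
    rw [Finset.sum_ite_mem, Finset.sum_const, nsmul_eq_mul, mul_one]
    have h6 := Finset.card_le_card (Finset.inter_subset_right
      (s₁ := Finset.range R) (s₂ := Finset.range ((X t ω).gap (e i))))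
    rw [Finset.card_range] at h6
    exact_mod_cast h6
  · obtain ⟨u, hu, hlim⟩ := hX.exists_integral_min_gap_le ha hb hν he hstable hunstable i
    filter_upwards [hlim.eventually (gt_mem_nhds hc)] with t ht
    refine lt_of_le_of_lt ?_ ht
    have h1 : Tendsto (fun R : ℕ => ∫ ω, min ((X t ω).gap (e i) : ℝ) R ∂P) atTop
        (𝓝 (∫ ω, ((X t ω).gap (e i) : ℝ) ∂P)) := by
      refine tendsto_integral_of_dominated_convergence (fun ω => ((X t ω).gap (e i) : ℝ))
        (fun R => ((hX.measurable_comp (fun x => (x.gap (e i) : ℝ)) t).min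
          measurable_const).aestronglyMeasurable) (hint t)
        (fun R => ae_of_all _ fun ω => ?_) (ae_of_all _ fun ω => ?_)
      · rw [Real.norm_eq_abs, abs_of_nonneg (le_min (Nat.cast_nonneg _) (Nat.cast_nonneg _))]
        exact min_le_left _ _
      · refine tendsto_const_nhds.congr' ?_
        filter_upwards [eventually_ge_atTop ((X t ω).gap (e i))] with R hR
        rw [min_eq_left (Nat.cast_le.2 hR)]
    exact le_of_tendsto' h1 fun R => hu t R

end IsExclusionProcess

end Expectation

/-! ### Diameters and joint laws of the clouds -/

section Clouds

variable {N : ℕ}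

theorem inner_Icc_succ {p : Fin (N + 1)} {q : Fin N} (h : p ≤ q.castSucc) :
    inner (Finset.Icc p q.succ) = insert q (inner (Finset.Icc p q.castSucc)) := by
  ext j
  simp only [inner, Finset.mem_filter, Finset.mem_univ, true_and, Finset.mem_insert,
    Finset.mem_Icc, Fin.le_def, Fin.ext_iff, Fin.val_succ, Fin.val_castSucc] at h ⊢
  omega

theorem Config.sum_gap_add_one (x : Config N) {p q : Fin (N + 1)} (h : p ≤ q) :
    ∑ j ∈ inner (Finset.Icc p q), ((x.gap j : ℤ) + 1) = x.1 q - x.1 p := by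
  have hsub : ∀ p : Fin (N + 1), inner (Finset.Icc p p) = ∅ := fun p => by
    ext j
    simp only [inner, Finset.mem_filter, Finset.mem_univ, true_and, Finset.mem_Icc, Fin.le_def,
      Fin.val_succ, Fin.val_castSucc, Finset.notMem_empty, iff_false]
    omega
  induction q using Fin.induction with
  | zero =>
    rw [le_antisymm h (Fin.zero_le p), hsub, Finset.sum_empty, sub_self]
  | succ q ih =>
    rcases h.lt_or_eq with hlt | rfl
    · have hle : p ≤ q.castSucc := Fin.le_castSucc_iff.2 hlt
      have hq : q ∉ inner (Finset.Icc p q.castSucc) := by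
        simp only [inner, Finset.mem_filter, Finset.mem_univ, true_and, Finset.mem_Icc, Fin.le_def,
          Fin.val_succ, Fin.val_castSucc]
        omega
      rw [inner_Icc_succ hle, Finset.sum_insert hq, ih hle, x.gap_cast]
      ring
    · rw [hsub, Finset.sum_empty, sub_self]

theorem Config.diameter_Icc (x : Config N) {p q : Fin (N + 1)} (h : p ≤ q) :
    x.diameter (Finset.Icc p q) (Finset.nonempty_Icc.2 h) =
      ∑ j ∈ inner (Finset.Icc p q), ((x.gap j : ℤ) + 1) := by
  rw [x.sum_gap_add_one h, Config.diameter]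
  congr 1
  · refine le_antisymm (Finset.sup'_le _ _ fun i hi => ?_)
      (Finset.le_sup' x.1 (Finset.right_mem_Icc.2 h))
    exact x.2.monotone (Finset.mem_Icc.1 hi).2
  · refine le_antisymm (Finset.inf'_le x.1 (Finset.left_mem_Icc.2 h))
      (Finset.le_inf' _ _ fun i hi => ?_)
    exact x.2.monotone (Finset.mem_Icc.1 hi).1

theorem diameter_part (Θ : OrderedPartition N) (x : Config N) (k : Fin Θ.size) :
    x.diameter (Θ.part k) (Θ.nonempty k) = ∑ j ∈ inner (Θ.part k), ((x.gap j : ℤ) + 1) := by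
  obtain ⟨p, q, hpq, hk⟩ := Θ.interval k
  have := x.diameter_Icc hpq
  generalize_proofs at this ⊢
  simpa only [hk] using this

/-- Sampling the product-geometric law on a disjoint union of index sets amounts to independent
samples on the pieces. -/
theorem prodLaw_real_sigma {κ : Type*} [Fintype κ] [DecidableEq κ] {β : κ → Type*}
    [∀ k, Fintype (β k)] [∀ k, DecidableEq (β k)] {ρ : (Σ k, β k) → ℝ}
    (hρ : ∀ i, 0 ≤ ρ i ∧ ρ i < 1) (A : ∀ k, Set (β k → ℕ)) :
    (prodLaw ρ).real {z | ∀ k, (fun j => z ⟨k, j⟩) ∈ A k} =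
      ∏ k, (prodLaw fun j => ρ ⟨k, j⟩).real (A k) := by
  have h1 : (prodLaw ρ).map (fun z k j => z ⟨k, j⟩) =
      Measure.pi fun k => prodLaw fun j => ρ ⟨k, j⟩ := by
    refine Measure.ext_of_singleton fun w => ?_
    have hpre : (fun (z : (Σ k, β k) → ℕ) k j => z ⟨k, j⟩) ⁻¹' {w} = {fun i => w i.1 i.2} := by
      ext z
      simp only [Set.mem_preimage, Set.mem_singleton_iff]
      constructor
      · rintro rfl
        rfl
      · rintro rfl
        rfl
    have hw : ({w} : Set (∀ k, β k → ℕ)) = Set.univ.pi fun k => {w k} :=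
      (Set.univ_pi_singleton w).symm
    rw [Measure.map_apply Measurable.of_discrete MeasurableSet.of_discrete, hpre, hw,
      Measure.pi_pi, prodLaw_singleton hρ]
    simp only [prodLaw_singleton fun j => hρ ⟨_, j⟩]
    rw [← ENNReal.ofReal_prod_of_nonneg fun k _ => Finset.prod_nonneg fun j _ =>
      mul_nonneg (pow_nonneg (hρ _).1 _) (sub_nonneg.2 (hρ _).2.le), Fintype.prod_sigma]
  have h2 : {z : (Σ k, β k) → ℕ | ∀ k, (fun j => z ⟨k, j⟩) ∈ A k} =
      (fun z k j => z ⟨k, j⟩) ⁻¹' (Set.univ.pi A) := by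
    ext z
    simp [Set.mem_pi]
  rw [h2, ← map_measureReal_apply Measurable.of_discrete MeasurableSet.of_discrete, h1,
    measureReal_def, Measure.pi_pi, ENNReal.toReal_prod]
  rfl

variable {a b : Fin (N + 1) → ℝ}

theorem cloudLaw_eq {I : Finset (Fin (N + 1))} {ρ : inner I → ℝ}
    (hρ : ∀ j, 0 ≤ ρ j ∧ ρ j < 1) (h : ∀ j, ρ j = intrinsicLoad a b I j) (A : Set (inner I → ℕ)) :
    cloudLaw a b I A = (prodLaw ρ).real A := by
  rw [← (hasSum_measureReal_singleton A).tsum_eq]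
  refine tsum_congr fun z => ?_
  rw [prodLaw_real_singleton hρ]
  simp only [h]
  rfl

end Clouds

/-! ### Limit theorems for the clouds -/

section CloudLimits

variable {N : ℕ} {a b : Fin (N + 1) → ℝ} {ν : Fin N → ℝ} {Θ : OrderedPartition N}

/-- The gaps inside the non-singleton parts of `Θ`. -/
abbrev InnerGap (Θ : OrderedPartition N) : Type := Σ k : Θ.nonSingletons, inner (Θ.part k)

/-- The label of a gap inside a part. -/
def InnerGap.label (i : InnerGap Θ) : Fin N := i.2

theorem InnerGap.label_injective : Function.Injective (InnerGap.label (Θ := Θ)) := by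
  rintro ⟨⟨k, hk⟩, ⟨j, hj⟩⟩ ⟨⟨k', hk'⟩, ⟨j', hj'⟩⟩ h
  obtain rfl : j = j' := h
  obtain rfl : k = k' := OrderedPartition.eq_of_mem (Finset.mem_filter.1 hj).2.1
    (Finset.mem_filter.1 hj').2.1
  rfl

theorem cloudEvent_eq (A : ∀ k, Set (inner (Θ.part k) → ℕ)) :
    cloudEvent Θ A = {x | x.gap ∘ InnerGap.label ∈
      {z : InnerGap Θ → ℕ | ∀ k : Θ.nonSingletons, (fun j => z ⟨k, j⟩) ∈ A k}} := by
  ext x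
  exact ⟨fun h k => h k.1 k.2, fun h k hk => h ⟨k, hk⟩⟩

variable (ha : ∀ i, 0 ≤ a i) (hb : ∀ i, 0 < b i) (hν : IsTrafficSolution a b ν)
  (hΘ : Θ.CutsAt (workload a b ν))

include hΘ

/-- Two particles in different parts are separated by an unstable gap. -/
theorem OrderedPartition.CutsAt.exists_unstable {l r : Fin Θ.size} (hlr : l < r)
    {i j : Fin (N + 1)} (hi : i ∈ Θ.part l) (hj : j ∈ Θ.part r) :
    ∃ k : Fin N, i ≤ k.castSucc ∧ k.succ ≤ j ∧ 1 ≤ workload a b ν k := by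
  obtain ⟨p, q, hpq, hl⟩ := Θ.interval l
  have hq : q ∈ Θ.part l := by rw [hl]; exact Finset.right_mem_Icc.2 hpq
  have hqj : q < j := Θ.ordered l r hlr q hq j hj
  have hiq : i ≤ q := by
    rw [hl] at hi
    exact (Finset.mem_Icc.1 hi).2
  obtain ⟨k, rfl⟩ : ∃ k : Fin N, k.castSucc = q :=
    ⟨q.castPred (hqj.trans_le (Fin.le_last j)).ne, Fin.castSucc_castPred _ _⟩
  refine ⟨k, hiq, Fin.castSucc_lt_iff_succ_le.1 hqj, not_lt.1 fun hlt => ?_⟩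
  have h1 := (hΘ k l hq).2 hlt
  rw [hl] at h1
  exact absurd (Finset.mem_Icc.1 h1).2 (not_le.2 Fin.castSucc_lt_succ)

theorem OrderedPartition.CutsAt.one_le_workload (j : Fin N)
    (hj : j ∉ Set.range (InnerGap.label (Θ := Θ))) : 1 ≤ workload a b ν j := by
  by_contra hlt
  have h1 := Θ.mem_part_index j.castSucc
  have h2 := (hΘ j _ h1).2 (not_le.1 hlt)
  have h3 : j ∈ inner (Θ.part (Θ.index j.castSucc)) :=
    Finset.mem_filter.2 ⟨Finset.mem_univ _, h1, h2⟩
  exact hj ⟨⟨⟨_, OrderedPartition.mem_nonSingletons_of_mem_inner h3⟩, ⟨j, h3⟩⟩, rfl⟩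

include ha hb hν

theorem OrderedPartition.CutsAt.workload_label_lt (i : InnerGap Θ) :
    workload a b ν i.label < 1 :=
  (hΘ.workload_eq ha hb hν i.2.2).2

theorem OrderedPartition.CutsAt.prodLaw_real_eq (A : ∀ k, Set (inner (Θ.part k) → ℕ)) :
    (prodLaw (workload a b ν ∘ InnerGap.label)).real
      {z : InnerGap Θ → ℕ | ∀ k : Θ.nonSingletons, (fun j => z ⟨k, j⟩) ∈ A k} =
      ∏ k ∈ Θ.nonSingletons, cloudLaw a b (Θ.part k) (A k) := by
  rw [prodLaw_real_sigma (ρ := workload a b ν ∘ InnerGap.label) (fun i =>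
    ⟨(workload_pos ha hb hν _).le, hΘ.workload_label_lt ha hb hν i⟩) fun k : Θ.nonSingletons => A k,
    ← Finset.prod_coe_sort Θ.nonSingletons fun k => cloudLaw a b (Θ.part k) (A k)]
  refine Finset.prod_congr rfl fun k _ => ?_
  exact (cloudLaw_eq (ρ := fun j : inner (Θ.part k) => workload a b ν j)
    (fun j => ⟨(workload_pos ha hb hν _).le, (hΘ.workload_eq ha hb hν j.2).2⟩)
    (fun j => (hΘ.workload_eq ha hb hν j.2).1) (A k)).symm

theorem OrderedPartition.CutsAt.speed_succ_sub (i : Fin N) :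
    Θ.speed a b i.succ - Θ.speed a b i.castSucc =
      max (workload a b ν i - 1) 0 * (b i.castSucc + a i.succ) := by
  rw [hΘ.speed_eq ha hb hν, hΘ.speed_eq ha hb hν, drift_busy_succ_sub ha hb hν, serviceRate]

theorem OrderedPartition.CutsAt.monotone_speed : Monotone (Θ.speed a b) := by
  refine Fin.monotone_iff_le_succ.2 fun i => ?_
  rw [← sub_nonneg, hΘ.speed_succ_sub ha hb hν]
  exact mul_nonneg (le_max_right _ _) (serviceRate_pos ha hb i).le

variable {Ω : Type*} [mΩ : MeasurableSpace Ω] {P : Measure Ω} [IsProbabilityMeasure P]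
  {x₀ : Config N} {X : ℝ≥0 → Ω → Config N} (hX : IsExclusionProcess a b x₀ P X)

namespace IsExclusionProcess

omit ha hb hν hΘ

theorem abs_occupation_le (E : Set (Config N)) (t : ℝ≥0) (ω : Ω) :
    |occupation X E t ω| ≤ 1 := by
  unfold occupation
  rcases eq_or_ne t 0 with rfl | ht
  · simp
  · have ht0 : (0 : ℝ) < t := NNReal.coe_pos.2 (pos_iff_ne_zero.2 ht)
    rw [abs_mul, abs_of_nonneg (by positivity : (0 : ℝ) ≤ 1 / t), one_div, inv_mul_le_iff₀ ht0]
    have := abs_intervalIntegral_le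
      (f := fun s : ℝ => E.indicator (fun _ => (1 : ℝ)) (X s.toNNReal ω))
      (fun s => abs_ind_le E _) ht0.le
    linarith

include hX

theorem measurable_occupation (E : Set (Config N)) (t : ℝ≥0) :
    Measurable (occupation X E t) :=
  (measurable_intervalIntegral (hX.measurable_joint _) t.coe_nonneg).const_mul _

theorem integrable_occupation (E : Set (Config N)) (t : ℝ≥0) : Integrable (occupation X E t) P :=
  Integrable.of_bound (C := 1) (hX.measurable_occupation E t).aestronglyMeasurable
    (ae_of_all _ fun ω => abs_occupation_le E t ω)

theorem tendsto_eLpNorm_occupation {E : Set (Config N)} {c : ℝ}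
    (h : ∀ᵐ ω ∂P, Tendsto (fun t : ℝ≥0 => occupation X E t ω) atTop (𝓝 c)) :
    Tendsto (fun t : ℝ≥0 => eLpNorm (fun ω => occupation X E t ω - c) 1 P) atTop (𝓝 0) := by
  simp only [eLpNorm_one_eq_lintegral_enorm]
  have h1 := tendsto_lintegral_filter_of_dominated_convergence (μ := P) (l := atTop)
    (F := fun (t : ℝ≥0) ω => ‖occupation X E t ω - c‖ₑ) (f := fun _ => 0)
    (fun _ => ENNReal.ofReal (1 + |c|))
    (Eventually.of_forall fun t => ((hX.measurable_occupation E t).sub_const c).enorm)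
    (Eventually.of_forall fun t => ae_of_all _ fun ω => ?_) (by simp) ?_
  · simpa using h1
  · rw [Real.enorm_eq_ofReal_abs]
    exact ENNReal.ofReal_le_ofReal ((abs_sub _ _).trans
      (add_le_add (abs_occupation_le E t ω) le_rfl))
  · filter_upwards [h] with ω hω
    have h2 := (hω.sub_const c).enorm
    simpa using h2

include ha hb hν hΘ

theorem ae_tendsto_occupation_cloudEvent (A : ∀ k, Set (inner (Θ.part k) → ℕ)) :
    ∀ᵐ ω ∂P, Tendsto (fun t : ℝ≥0 => occupation X (cloudEvent Θ A) t ω) atTop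
      (𝓝 (∏ k ∈ Θ.nonSingletons, cloudLaw a b (Θ.part k) (A k))) := by
  filter_upwards [hX.ae_tendsto_timeAvg ha hb hν InnerGap.label_injective
    (hΘ.workload_label_lt ha hb hν) hΘ.one_le_workload] with ω hω
  have h1 := hω {z : InnerGap Θ → ℕ | ∀ k : Θ.nonSingletons, (fun j => z ⟨k, j⟩) ∈ A k}
  rw [hΘ.prodLaw_real_eq ha hb hν] at h1
  rw [cloudEvent_eq]
  exact h1

theorem tendsto_measure_cloudEvent (A : ∀ k, Set (inner (Θ.part k) → ℕ)) :
    Tendsto (fun t : ℝ≥0 => P.real {ω | X t ω ∈ cloudEvent Θ A}) atTop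
      (𝓝 (∏ k ∈ Θ.nonSingletons, cloudLaw a b (Θ.part k) (A k))) := by
  have h1 := hX.tendsto_measure_gap ha hb hν InnerGap.label_injective
    (hΘ.workload_label_lt ha hb hν) hΘ.one_le_workload
    {z : InnerGap Θ → ℕ | ∀ k : Θ.nonSingletons, (fun j => z ⟨k, j⟩) ∈ A k}
  rw [hΘ.prodLaw_real_eq ha hb hν] at h1
  rw [cloudEvent_eq]
  exact h1

theorem diameter_limit (k : Fin Θ.size) (hk : k ∈ Θ.nonSingletons) :
    (∀ t : ℝ≥0, Integrable
      (fun ω => ((X t ω).diameter (Θ.part k) (Θ.nonempty k) : ℝ)) P) ∧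
    Tendsto (fun t : ℝ≥0 => ∫ ω, ((X t ω).diameter (Θ.part k) (Θ.nonempty k) : ℝ) ∂P) atTop
      (𝓝 (∑ j ∈ inner (Θ.part k), 1 / (1 - intrinsicLoad a b (Θ.part k) j))) := by
  have hint : ∀ j ∈ inner (Θ.part k), ∀ t, Integrable (fun ω => ((X t ω).gap j : ℝ) + 1) P :=
    fun j hj t => (hX.integrable_gap ha hb hν InnerGap.label_injective
      (hΘ.workload_label_lt ha hb hν) hΘ.one_le_workload ⟨⟨k, hk⟩, ⟨j, hj⟩⟩ t).add
        (integrable_const _)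
  have hdiam : ∀ t ω, ((X t ω).diameter (Θ.part k) (Θ.nonempty k) : ℝ) =
      ∑ j ∈ inner (Θ.part k), (((X t ω).gap j : ℝ) + 1) := fun t ω => by
    rw [diameter_part]
    push_cast
    rfl
  simp only [hdiam]
  refine ⟨fun t => integrable_finsetSum _ fun j hj => hint j hj t, ?_⟩
  simp only [integral_finsetSum _ fun j hj => hint j hj _]
  refine tendsto_finsetSum _ fun j hj => ?_
  have h1 := (hX.tendsto_integral_gap_coord ha hb hν InnerGap.label_injective
    (hΘ.workload_label_lt ha hb hν) hΘ.one_le_workload ⟨⟨k, hk⟩, ⟨j, hj⟩⟩).add_const 1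
  have h2 : InnerGap.label (Θ := Θ) ⟨⟨k, hk⟩, ⟨j, hj⟩⟩ = j := rfl
  obtain ⟨h3, h4⟩ := hΘ.workload_eq ha hb hν hj
  rw [h2, div_add_one (by linarith), add_sub_cancel, h3] at h1
  refine h1.congr fun t => ?_
  have h5 : Integrable (fun ω => ((X t ω).gap j : ℝ)) P :=
    hX.integrable_gap ha hb hν InnerGap.label_injective (hΘ.workload_label_lt ha hb hν)
      hΘ.one_le_workload ⟨⟨k, hk⟩, ⟨j, hj⟩⟩ t
  rw [integral_add h5 (integrable_const _)]
  simp

theorem tendsto_measure_near {l r : Fin Θ.size} (hlr : l < r) {i j : Fin (N + 1)}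
    (hi : i ∈ Θ.part l) (hj : j ∈ Θ.part r) (B : ℝ) :
    Tendsto (fun t : ℝ≥0 => P.real {ω | |((X t ω).1 j : ℝ) - ((X t ω).1 i : ℝ)| ≤ B})
      atTop (𝓝 0) := by
  obtain ⟨k, hik, hkj, hk⟩ := hΘ.exists_unstable hlr hi hj
  refine squeeze_zero (fun t => measureReal_nonneg) (fun t => measureReal_mono fun ω hω => ?_)
    (hX.tendsto_measure_gap_lt ha hb hν hk (⌈B⌉₊ + 1))
  have h1 := (X t ω).2.monotone hik
  have h2 := (X t ω).2.monotone hkj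
  have h3 := (X t ω).gap_cast k
  have h4 : (((X t ω).gap k : ℤ) : ℝ) ≤ (((X t ω).1 j - (X t ω).1 i : ℤ) : ℝ) :=
    Int.cast_le.2 (by omega)
  push_cast at h4
  have h5 : ((X t ω).gap k : ℝ) ≤ (⌈B⌉₊ : ℝ) :=
    (h4.trans ((le_abs_self _).trans hω)).trans (Nat.le_ceil B)
  exact Nat.lt_succ_of_le (Nat.cast_le.1 h5)

end IsExclusionProcess
end CloudLimits

end ExclusionClouds

end

open ExclusionClouds in
theorem mainTheorem1 (N : ℕ) (hN : 1 ≤ N) (a b : Fin (N + 1) → ℝ)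
    (ha : ∀ i, 0 ≤ a i) (hb : ∀ i, 0 < b i) :
    (∃! ν : Fin N → ℝ, IsTrafficSolution a b ν) ∧
    ∀ ν : Fin N → ℝ, IsTrafficSolution a b ν →
      (∃! Θ : OrderedPartition N, IsCloudPartition a b ν Θ) ∧
      ∀ Θ : OrderedPartition N, IsCloudPartition a b ν Θ →
        -- the speeds are ordered, with explicit increments
        (Monotone (Θ.speed a b) ∧
          ∀ i : Fin N, Θ.speed a b i.succ - Θ.speed a b i.castSucc =
            max (workload a b ν i - 1) 0 * (b i.castSucc + a i.succ)) ∧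
        ∀ (Ω : Type*) [MeasurableSpace Ω] (P : Measure Ω) [IsProbabilityMeasure P]
          (x₀ : Config N) (X : ℝ≥0 → Ω → Config N), IsExclusionProcess a b x₀ P X →
          -- (i) limits for the gaps inside the clouds
          (∀ A : ∀ k, Set (inner (Θ.part k) → ℕ),
            (∀ᵐ ω ∂P, Tendsto (fun t : ℝ≥0 => occupation X (cloudEvent Θ A) t ω) atTop
              (𝓝 (∏ k ∈ Θ.nonSingletons, cloudLaw a b (Θ.part k) (A k)))) ∧
            (∀ t : ℝ≥0, Integrable (occupation X (cloudEvent Θ A) t) P) ∧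
            Tendsto (fun t : ℝ≥0 => eLpNorm (fun ω => occupation X (cloudEvent Θ A) t ω -
                ∏ k ∈ Θ.nonSingletons, cloudLaw a b (Θ.part k) (A k)) 1 P) atTop (𝓝 0) ∧
            Tendsto (fun t : ℝ≥0 => P.real {ω | X t ω ∈ cloudEvent Θ A}) atTop
              (𝓝 (∏ k ∈ Θ.nonSingletons, cloudLaw a b (Θ.part k) (A k)))) ∧
          -- (i) limits of the expected cloud diameters
          (∀ k ∈ Θ.nonSingletons,
            (∀ t : ℝ≥0, Integrable
              (fun ω => ((X t ω).diameter (Θ.part k) (Θ.nonempty k) : ℝ)) P) ∧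
            Tendsto
              (fun t : ℝ≥0 => ∫ ω, ((X t ω).diameter (Θ.part k) (Θ.nonempty k) : ℝ) ∂P) atTop
              (𝓝 (∑ j ∈ inner (Θ.part k), 1 / (1 - intrinsicLoad a b (Θ.part k) j)))) ∧
          -- (ii) separation of distinct clouds
          (∀ l r : Fin Θ.size, l < r → ∀ i ∈ Θ.part l, ∀ j ∈ Θ.part r, ∀ B : ℝ, 0 ≤ B →
            Tendsto (fun t : ℝ≥0 => P.real {ω | |((X t ω).1 j : ℝ) - ((X t ω).1 i : ℝ)| ≤ B})
              atTop (𝓝 0)) ∧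
          -- (iii) asymptotic speeds
          (∀ i : Fin (N + 1), ∀ᵐ ω ∂P,
            Tendsto (fun t : ℝ≥0 => ((X t ω).1 i : ℝ) / (t : ℝ)) atTop
              (𝓝 (Θ.speed a b i))) := by
  refine ⟨?_, fun ν hν => ⟨existsUnique_cloudPartition ha hb hν, fun Θ hΘ => ?_⟩⟩
  · obtain ⟨ν, hν, _⟩ := exists_trafficSolution ha hb
    exact ⟨ν, hν, fun ν' hν' => trafficSolution_unique ha hb hν' hν⟩
  have hcut := hΘ.cutsAt
  refine ⟨⟨hcut.monotone_speed ha hb hν, hcut.speed_succ_sub ha hb hν⟩, ?_⟩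
  intro Ω _ P _ x₀ X hX
  refine ⟨fun A => ?_, hX.diameter_limit ha hb hν hcut, fun l r hlr i hi j hj B _ =>
    hX.tendsto_measure_near ha hb hν hcut hlr hi hj B, fun i => ?_⟩
  · have h1 := hX.ae_tendsto_occupation_cloudEvent ha hb hν hcut A
    exact ⟨h1, hX.integrable_occupation _, hX.tendsto_eLpNorm_occupation h1,
      hX.tendsto_measure_cloudEvent ha hb hν hcut A⟩
  · filter_upwards [hX.ae_tendsto_speed_and_busy ha hb hν] with ω hω
    rw [hcut.speed_eq ha hb hν]
    exact hω.2.1 i
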